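/- Let $S_1^3$ be the upper half-space $\{x_3>0\}\subset\mathbb R^3$ with the Lorentz metric $ds^2=x_3^{-2}(dx_1^2+dx_2^2-dx_3^2)$, and let $\langle X,Y\rangle=X_1Y_1+X_2Y_2-X_3Y_3$ be the scalar product of Minkowski space $L^3$. Identify $S_1^3$ with the Lie group with product $p\cdot q=(p_3q_1+p_1,\;p_3q_2+p_2,\;p_3q_3)$ and identity $e=(0,0,1)$, for which the metric is left-invariant. For a time-like immersed surface $x:D\to S_1^3$ ($D\subset\mathbb R^2$ open) with unit normal field $N$, let $\mathrm{I}$ and $\mathrm{II}$ be its first and second fundamental forms in $S_1^3$. Its normal Gauss map $\widetilde N$ is $N$ left-translated to $T_e S_1^3$, and $\mathrm{IV}=\langle d\widetilde N,d\widetilde N\rangle$. The normal Gauss map is called conformal if $\mathrm{IV}=\rho\,\mathrm{II}$ for some smooth function $\rho$ on $D$. An umbilic is a point at which $\mathrm{II}$ is a multiple of $\mathrm{I}$. A ruled surface is one of the form $x(u,v)=\alpha(v)+u\beta(v)$ with smooth $\alpha,\beta$. **Theorem 7.4.** Let $x:D\to S_1^3$ be a (smooth) time-like ruled surface with conformal normal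 Gauss map, and suppose that every connected non-empty open piece of the surface all of whose points are umbilics lies in a Euclidean plane (for example, that the surface has no umbilics, or is a Euclidean plane). Then every point of $D$ has an open neighbourhood $U\subset D$ such that, after an isometry $$(x_1,x_2,x_3)\mapsto(x_1\cos\theta-x_2\sin\theta+a,\;x_1\sin\theta+x_2\cos\theta+b,\;x_3)$$ of $S_1^3$ and a smooth injective change of parameters, $x|_U$ is a part of one of the following surfaces: 1. an ordinary Euclidean time-like plane; 2. a Euclidean generalized cylinder $\alpha(v)+u(0,0,1)$, where $\alpha$ is a smooth curve in $L^3$, defined on an open interval, with $\langle\alpha',\alpha'\rangle>0$; 3. $(u\cosh v,\;c\sinh v,\;u\sinh v)$ for a constant $c\neq0$; 4. $(c_2\sinh v+u\cosh v,\;c_1\sinh v,\;c_2\cosh v+u\sinh v)$ for constants $c_1\ne0$, $c_2\neq0$; 5. $(u\sinh v,\;c\cosh v,\;u\cosh v)$ for a constant $c\neq0$; 6. $(c_2\cosh v+u\sinh v,\;c_1\cosh v,\;c_2\sinh v+u\cosh v)$ for constants $c_1\ne0$, $c_2\neq0$; 7. Flaherty's time-like surfaces $\alpha(v)+u\beta$,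 where $\beta=(1,0,1)$ and $\alpha$ is a smooth curve in $L^3$, defined on an open interval, with $\langle\alpha',\beta\rangle\neq0$. -/

import Mathlib

open scoped ContDiff

noncomputable section

namespace DeSitter

/-- Coordinate vectors `(x₁, x₂, x₃)`, written with indices `0, 1, 2`. Only the topology of this
space is used for differentiation; all scalar products are the ones defined below. -/
abbrev Vec3 : Type := Fin 3 → ℝ

/-- The Lorentz-Minkowski scalar product of `L³`. -/
def lorentz (X Y : Vec3) : ℝ := X 0 * Y 0 + X 1 * Y 1 - X 2 * Y 2

/-- The upper half-space `x₃ > 0`, the underlying set of the model of `S₁³`. -/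
def upperHalfSpace : Set Vec3 := {p | 0 < p 2}

/-- The metric `(dx₁² + dx₂² - dx₃²) / x₃²` of `S₁³` at the point `p`. -/
def metric (p X Y : Vec3) : ℝ := lorentz X Y / p 2 ^ 2

/-- The Christoffel symbols of the first kind of the Levi-Civita connection of `metric`:
`⟨Γ(X, Y), Z⟩ = ½ (X⟨Y, Z⟩ + Y⟨X, Z⟩ - Z⟨X, Y⟩)` for constant coordinate fields `X, Y, Z`. -/
def christoffel (p X Y Z : Vec3) : ℝ :=
  (fderiv ℝ (fun q : Vec3 => metric q Y Z) p X + fderiv ℝ (fun q : Vec3 => metric q X Z) p Y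
    - fderiv ℝ (fun q : Vec3 => metric q X Y) p Z) / 2

/-- The product of the Lie group structure on the upper half-space, that is, the product of the
matrices `[1, 0, 0, log x₃; 0, x₃, 0, x₁; 0, 0, x₃, x₂; 0, 0, 0, 1]`; the identity is `(0, 0, 1)`
and the metric is left-invariant. -/
def groupMul (p q : Vec3) : Vec3 := ![p 2 * q 0 + p 0, p 2 * q 1 + p 1, p 2 * q 2]

/-- The inverse in the Lie group structure on the upper half-space. -/
def groupInv (p : Vec3) : Vec3 := ![-p 0 / p 2, -p 1 / p 2, 1 / p 2]

/-- The first fundamental form of the parametrized surface `x` at the parameter `q`. -/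
def firstForm (x : ℝ × ℝ → Vec3) (q ξ ζ : ℝ × ℝ) : ℝ :=
  metric (x q) (fderiv ℝ x q ξ) (fderiv ℝ x q ζ)

/-- `x : D → S₁³` is a time-like immersed surface: it takes values in the upper half-space and
its first fundamental form is Lorentzian (which forces `x` to be an immersion). -/
def IsTimelikeSurface (D : Set (ℝ × ℝ)) (x : ℝ × ℝ → Vec3) : Prop :=
  IsOpen D ∧ ContDiffOn ℝ ∞ x D ∧ (∀ q ∈ D, x q ∈ upperHalfSpace) ∧
    ∀ q ∈ D, firstForm x q (1, 0) (1, 0) * firstForm x q (0, 1) (0, 1)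
      - firstForm x q (1, 0) (0, 1) ^ 2 < 0

/-- `x : D → S₁³` is a ruled surface `x(u, v) = α(v) + u β(v)`, with smooth `α` and `β`. -/
def IsRuled (D : Set (ℝ × ℝ)) (x : ℝ × ℝ → Vec3) : Prop :=
  ∃ α β : ℝ → Vec3, ContDiffOn ℝ ∞ α (Prod.snd '' D) ∧ ContDiffOn ℝ ∞ β (Prod.snd '' D) ∧
    ∀ q ∈ D, x q = α q.2 + q.1 • β q.2

/-- `N` is a smooth (space-like) unit normal vector field along `x : D → S₁³`. -/
def IsUnitNormal (D : Set (ℝ × ℝ)) (x N : ℝ × ℝ → Vec3) : Prop :=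
  ContDiffOn ℝ ∞ N D ∧ ∀ q ∈ D, metric (x q) (N q) (N q) = 1 ∧
    ∀ ξ : ℝ × ℝ, metric (x q) (N q) (fderiv ℝ x q ξ) = 0

/-- The second fundamental form `⟨∇_ξ (dx ζ), N⟩` of `x` in `S₁³` with respect to `N`. -/
def secondForm (x N : ℝ × ℝ → Vec3) (q ξ ζ : ℝ × ℝ) : ℝ :=
  metric (x q) (fderiv ℝ (fun r => fderiv ℝ x r ζ) q ξ) (N q)
    + christoffel (x q) (fderiv ℝ x q ξ) (fderiv ℝ x q ζ) (N q)

/-- The normal Gauss map: `N` left-translated to the tangent space at the identity. -/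
def normalGaussMap (x N : ℝ × ℝ → Vec3) (q : ℝ × ℝ) : Vec3 :=
  fderiv ℝ (groupMul (groupInv (x q))) (x q) (N q)

/-- The fourth fundamental form `⟨dÑ, dÑ⟩`, `Ñ` the normal Gauss map, `⟨·, ·⟩` that of `L³`. -/
def fourthForm (x N : ℝ × ℝ → Vec3) (q ξ ζ : ℝ × ℝ) : ℝ :=
  lorentz (fderiv ℝ (normalGaussMap x N) q ξ) (fderiv ℝ (normalGaussMap x N) q ζ)

/-- The normal Gauss map is conformal: the fourth fundamental form is `ρ` times the second one
for a smooth function `ρ`. -/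
def HasConformalNormalGaussMap (D : Set (ℝ × ℝ)) (x N : ℝ × ℝ → Vec3) : Prop :=
  ∃ ρ : ℝ × ℝ → ℝ, ContDiffOn ℝ ∞ ρ D ∧
    ∀ q ∈ D, ∀ ξ ζ : ℝ × ℝ, fourthForm x N q ξ ζ = ρ q * secondForm x N q ξ ζ

/-- `q` is an umbilic: the second fundamental form is a multiple of the first one there. -/
def IsUmbilic (x N : ℝ × ℝ → Vec3) (q : ℝ × ℝ) : Prop :=
  ∃ c : ℝ, ∀ ξ ζ : ℝ × ℝ, secondForm x N q ξ ζ = c * firstForm x q ξ ζ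

/-- A set of points lies in an ordinary Euclidean (affine) plane. -/
def LiesInPlane (S : Set Vec3) : Prop :=
  ∃ (n : Vec3) (d : ℝ), n ≠ 0 ∧ ∀ p ∈ S, n 0 * p 0 + n 1 * p 1 + n 2 * p 2 = d

/-- Every totally umbilic open connected piece of the surface is planar. -/
def UmbilicPiecesPlanar (D : Set (ℝ × ℝ)) (x N : ℝ × ℝ → Vec3) : Prop :=
  ∀ V : Set (ℝ × ℝ), V ⊆ D → IsOpen V → IsConnected V → (∀ q ∈ V, IsUmbilic x N q) →
    LiesInPlane (x '' V)

/-- The isometry of `S₁³` that rotates by `θ` about the `x₃`-axis and translates by `(a, b)`. -/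
def isom (θ a b : ℝ) (p : Vec3) : Vec3 :=
  ![p 0 * Real.cos θ - p 1 * Real.sin θ + a, p 0 * Real.sin θ + p 1 * Real.cos θ + b, p 2]

/-- The seven types of surfaces, each as a parameter domain together with a parametrization
`(u, v) ↦ y(u, v)`; here `q.1` is `u` and `q.2` is `v`. -/
inductive Listed : Set (ℝ × ℝ) → (ℝ × ℝ → Vec3) → Prop
  /-- time-like Euclidean planes -/
  | plane (p a b : Vec3) (h : lorentz a a * lorentz b b - lorentz a b ^ 2 < 0) :
      Listed Set.univ (fun q => p + q.1 • a + q.2 • b)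
  /-- vertical generalized cylinders over a curve with `⟨α', α'⟩ > 0` -/
  | cylinder (J : Set ℝ) (α : ℝ → Vec3) (hJ : IsOpen J) (hJ' : J.OrdConnected)
      (hα : ContDiffOn ℝ ∞ α J) (h : ∀ v ∈ J, 0 < lorentz (deriv α v) (deriv α v)) :
      Listed (Set.univ ×ˢ J) (fun q => α q.2 + q.1 • ![0, 0, 1])
  | three (c : ℝ) (hc : c ≠ 0) :
      Listed Set.univ (fun q =>
        ![q.1 * Real.cosh q.2, c * Real.sinh q.2, q.1 * Real.sinh q.2])
  | four (c₁ c₂ : ℝ) (h₁ : c₁ ≠ 0) (h₂ : c₂ ≠ 0) :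
      Listed Set.univ (fun q =>
        ![c₂ * Real.sinh q.2 + q.1 * Real.cosh q.2, c₁ * Real.sinh q.2,
          c₂ * Real.cosh q.2 + q.1 * Real.sinh q.2])
  | five (c : ℝ) (hc : c ≠ 0) :
      Listed Set.univ (fun q =>
        ![q.1 * Real.sinh q.2, c * Real.cosh q.2, q.1 * Real.cosh q.2])
  | six (c₁ c₂ : ℝ) (h₁ : c₁ ≠ 0) (h₂ : c₂ ≠ 0) :
      Listed Set.univ (fun q =>
        ![c₂ * Real.cosh q.2 + q.1 * Real.sinh q.2, c₁ * Real.cosh q.2,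
          c₂ * Real.sinh q.2 + q.1 * Real.cosh q.2])
  /-- Flaherty surfaces, ruled by parallel null lines -/
  | flaherty (J : Set ℝ) (α : ℝ → Vec3) (hJ : IsOpen J) (hJ' : J.OrdConnected)
      (hα : ContDiffOn ℝ ∞ α J) (h : ∀ v ∈ J, lorentz (deriv α v) ![1, 0, 1] ≠ 0) :
      Listed (Set.univ ×ˢ J) (fun q => α q.2 + q.1 • ![1, 0, 1])

/-- Near the parameter `q₀`, the surface `x : D → S₁³` is, after one of the isometries `isom`, a
part of a listed surface `y`, up to a smooth injective change `φ` of the parameters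
(its differential is invertible because `x` is an immersion). -/
def IsLocallyListedAt (D : Set (ℝ × ℝ)) (x : ℝ × ℝ → Vec3) (q₀ : ℝ × ℝ) : Prop :=
  ∃ (θ a b : ℝ) (E : Set (ℝ × ℝ)) (y : ℝ × ℝ → Vec3) (U : Set (ℝ × ℝ)) (φ : ℝ × ℝ → ℝ × ℝ),
    Listed E y ∧ IsOpen U ∧ q₀ ∈ U ∧ U ⊆ D ∧ ContDiffOn ℝ ∞ φ U ∧ Set.InjOn φ U ∧
      Set.MapsTo φ U E ∧ ∀ q ∈ U, isom θ a b (x q) = y (φ q)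

end DeSitter

end

/-! Left translation turns the unit normal into the unit normal η of the surface in flat Minkowski
space. So IV is the flat third fundamental form, while II = h/x₃ + η₃ I₀/x₃², where I₀ and h are the
flat first and second forms. By Cayley–Hamilton, IV = 2H h − K I₀. Away from umbilics h is not a
multiple of I₀, and comparing coefficients in IV = ρ II gives x₃ K + 2H η₃ = 0. For α + uβ this
reads `defect = 0`, a cubic in u whose coefficients are differential equations in v. Continuity and
the hypothesis on umbilic pieces carry it to all of D (`defect_eq_zero_of_mem`); being polynomial in
u, it then holds on each entire line, also outside the half-space.

The classification depends on `twist` = det(β', β, α'), which vanishes exactly when the tangent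
plane is constant along the ruling.

Twisted rulings. Evaluating the cubic where the tangent plane is vertical forces that point to
height zero, and the linear coefficient then shows that the horizontal direction of β does not turn
(`RuledData.area_dir_eq_zero`). After a rotation the rulings are parallel to a fixed vertical plane,
and the remaining equations integrate explicitly (`first_integrals_horizontal`,
`first_integrals_vertical`). A hyperbolic angle as parameter gives types 3 to 6. The delicate point
is the boundary of the twisted set: by the first integrals, twisted rulings can only degenerate at a
vertical ruling, and the solution continues through it with the same constants
(`RuledData.hasVerticalForm_of_vertical`).

Untwisted rulings. Here η depends on v only, and the equation says that where η' ≠ 0 the ruling is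
null or the tangent plane is vertical. Hence all tangent planes near a given point share a fixed
null or vertical vector (`exists_common_direction`), and the surface is locally a cylinder in that
direction (`exists_cylinder`): type 7 or 2. A time-like plane contains null directions, so planar
pieces are covered as well. -/

noncomputable section

namespace DeSitter

/-! ### Lorentzian linear algebra and the curvature equation at one point -/

/-- The determinant of three coordinate vectors. -/
def det3 (a b c : Vec3) : ℝ :=
  a 0 * (b 1 * c 2 - b 2 * c 1) - a 1 * (b 0 * c 2 - b 2 * c 0) + a 2 * (b 0 * c 1 - b 1 * c 0)

/-- The area spanned by the horizontal parts of two vectors. -/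
def area (a b : Vec3) : ℝ := a 0 * b 1 - a 1 * b 0

/-- The Gram determinant of two vectors for the Lorentz scalar product. -/
def gram (a b : Vec3) : ℝ := lorentz a a * lorentz b b - lorentz a b ^ 2

/-- The defect, at the parameter `u`, of the equation `x₃ K + 2 H η₃ = 0` for the ruled surface
`α + u β`, in terms of the 2-jets `(A, A₁, A₂)` of `α` and `(B, B₁, B₂)` of `β`. -/
def defect (A A₁ A₂ B B₁ B₂ : Vec3) (u : ℝ) : ℝ :=
  (A 2 + u * B 2) * det3 B₁ B A₁ ^ 2
    + area B (A₁ + u • B₁) * (lorentz B B * det3 B (A₁ + u • B₁) (A₂ + u • B₂)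
      - 2 * lorentz B (A₁ + u • B₁) * det3 B₁ B A₁)

lemma lorentz_comm (X Y : Vec3) : lorentz X Y = lorentz Y X := by
  simp only [lorentz]; ring

lemma lorentz_add_left (X Y Z : Vec3) : lorentz (X + Y) Z = lorentz X Z + lorentz Y Z := by
  simp only [lorentz, Pi.add_apply]; ring

lemma lorentz_sub_left (X Y Z : Vec3) : lorentz (X - Y) Z = lorentz X Z - lorentz Y Z := by
  simp only [lorentz, Pi.sub_apply]; ring

lemma lorentz_smul_left (c : ℝ) (X Z : Vec3) : lorentz (c • X) Z = c * lorentz X Z := by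
  simp only [lorentz, Pi.smul_apply, smul_eq_mul]; ring

lemma metric_eq (p X Y : Vec3) : metric p X Y = lorentz X Y / p 2 ^ 2 := rfl

lemma fderiv_metric {p : Vec3} (hp : p 2 ≠ 0) (X Y Z : Vec3) :
    fderiv ℝ (fun q : Vec3 => metric q Y Z) p X = -2 * lorentz Y Z * X 2 / p 2 ^ 3 := by
  have h1 : HasFDerivAt (fun q : Vec3 => q 2) (ContinuousLinearMap.proj (R := ℝ) 2) p :=
    (ContinuousLinearMap.proj (R := ℝ) (φ := fun _ : Fin 3 => ℝ) 2).hasFDerivAt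
  have h2 : HasDerivAt (fun t : ℝ => lorentz Y Z / t ^ 2) (-2 * lorentz Y Z / p 2 ^ 3) (p 2) := by
    have := (hasDerivAt_const (p 2) (lorentz Y Z)).div (hasDerivAt_pow 2 (p 2)) (by positivity)
    refine this.congr_deriv ?_
    field_simp
    simp
    ring
  have h3 := h2.comp_hasFDerivAt p h1
  have h4 : fderiv ℝ (fun q : Vec3 => metric q Y Z) p = _ := h3.fderiv
  rw [h4]
  simp
  ring

lemma christoffel_eq {p : Vec3} (hp : p 2 ≠ 0) (X Y Z : Vec3) :
    christoffel p X Y Z =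
      -(lorentz Y Z * X 2 + lorentz X Z * Y 2 - lorentz X Y * Z 2) / p 2 ^ 3 := by
  simp only [christoffel, fderiv_metric hp]
  ring

/-- Left translation is a homothety composed with a horizontal translation; only the ratio 1/x₃
survives in its differential. -/
lemma normalGaussMap_eq (x N : ℝ × ℝ → Vec3) (q : ℝ × ℝ) :
    normalGaussMap x N q = (x q 2)⁻¹ • N q := by
  have h : HasFDerivAt (groupMul (groupInv (x q)))
      ((x q 2)⁻¹ • ContinuousLinearMap.id ℝ Vec3) (x q) := by
    have : groupMul (groupInv (x q)) = fun p =>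
        ((x q 2)⁻¹ • ContinuousLinearMap.id ℝ Vec3) p
          + ![-x q 0 / x q 2, -x q 1 / x q 2, 0] := by
      funext p i
      fin_cases i <;> simp [groupMul, groupInv]
    rw [this]
    exact (ContinuousLinearMap.hasFDerivAt _).add_const _
  rw [normalGaussMap, h.fderiv]
  simp

lemma hasFDerivAt_ruled {a b : ℝ → Vec3} {a' b' : Vec3} {q : ℝ × ℝ}
    (ha : HasDerivAt a a' q.2) (hb : HasDerivAt b b' q.2) :
    HasFDerivAt (fun r : ℝ × ℝ => a r.2 + r.1 • b r.2)
      ((ContinuousLinearMap.fst ℝ ℝ ℝ).smulRight (b q.2)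
        + (ContinuousLinearMap.snd ℝ ℝ ℝ).smulRight (a' + q.1 • b')) q := by
  have h1 : HasFDerivAt (fun r : ℝ × ℝ => r.1) (ContinuousLinearMap.fst ℝ ℝ ℝ) q :=
    hasFDerivAt_fst
  have h2 : HasFDerivAt (fun r : ℝ × ℝ => r.2) (ContinuousLinearMap.snd ℝ ℝ ℝ) q :=
    hasFDerivAt_snd
  have h3 := (ha.hasFDerivAt.comp q h2).add (h1.smul (hb.hasFDerivAt.comp q h2))
  refine h3.congr_fderiv ?_
  ext ξ <;> simp

/-- A vector which is orthogonal to a basis vanishes: here the basis consists of a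
non-degenerate pair and a unit vector orthogonal to it. -/
lemma tangent_decomposition {X Y n Z : Vec3} (hn : lorentz n n = 1) (hX : lorentz n X = 0)
    (hY : lorentz n Y = 0) (hZ : lorentz n Z = 0) (hg : gram X Y ≠ 0) (T : Vec3) :
    gram X Y * lorentz Z T =
      (lorentz Y Y * lorentz Z X - lorentz X Y * lorentz Z Y) * lorentz X T
      + (lorentz X X * lorentz Z Y - lorentz X Y * lorentz Z X) * lorentz Y T := by
  set Z' : Vec3 := gram X Y • Z - (lorentz Y Y * lorentz Z X - lorentz X Y * lorentz Z Y) • X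
    - (lorentz X X * lorentz Z Y - lorentz X Y * lorentz Z X) • Y with hZ'
  have e1 : lorentz Z' X = 0 := by
    simp only [hZ', lorentz_sub_left, lorentz_smul_left, gram]
    rw [lorentz_comm Y X]; ring
  have e2 : lorentz Z' Y = 0 := by
    simp only [hZ', lorentz_sub_left, lorentz_smul_left, gram]; ring
  have e3 : lorentz Z' n = 0 := by
    rw [lorentz_comm] at hX hY hZ
    simp only [hZ', lorentz_sub_left, lorentz_smul_left, hX, hY, hZ]; ring
  -- The Gram determinant of three vectors is −det², the sign coming from the signature; since n is
  -- a unit vector orthogonal to X and Y, it reduces to that of X and Y.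
  have hd : det3 X Y n ^ 2 = -gram X Y := by
    have h : det3 X Y n ^ 2 = -(gram X Y * lorentz n n - lorentz X X * lorentz n Y ^ 2
      - lorentz Y Y * lorentz n X ^ 2 + 2 * lorentz X Y * lorentz n X * lorentz n Y) := by
      simp only [det3, gram, lorentz]; ring
    rw [h, hn, hX, hY]; ring
  have hd0 : det3 X Y n ≠ 0 := by
    intro h; rw [h] at hd; exact hg (by linarith)
  -- Cramer's rule: Z' is orthogonal to the basis X, Y, n.
  have key : ∀ i, det3 X Y n * Z' i = 0 := by
    simp only [lorentz] at e1 e2 e3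
    intro i
    fin_cases i <;> simp only [det3, Fin.zero_eta, Fin.mk_one, Fin.reduceFinMk]
    · linear_combination (Y 1 * n 2 - Y 2 * n 1) * e1 + (n 1 * X 2 - n 2 * X 1) * e2
        + (X 1 * Y 2 - X 2 * Y 1) * e3
    · linear_combination (Y 2 * n 0 - Y 0 * n 2) * e1 + (n 2 * X 0 - n 0 * X 2) * e2
        + (X 2 * Y 0 - X 0 * Y 2) * e3
    · linear_combination -(Y 0 * n 1 - Y 1 * n 0) * e1 - (n 0 * X 1 - n 1 * X 0) * e2
        - (X 0 * Y 1 - X 1 * Y 0) * e3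
  have hz : Z' = 0 := by
    funext i
    simpa [hd0] using key i
  have : lorentz Z' T = 0 := by rw [hz]; simp [lorentz]
  simp only [hZ', lorentz_sub_left, lorentz_smul_left] at this
  linarith

/-- A unit normal is proportional to the cross product. -/
lemma exists_normal_factor {X Y n : Vec3} (hn : lorentz n n = 1) (hX : lorentz n X = 0)
    (hY : lorentz n Y = 0) (hg : gram X Y ≠ 0) :
    ∃ κ : ℝ, κ ≠ 0 ∧ n 2 = -κ * area X Y ∧ ∀ Z, lorentz Z n = κ * det3 Z X Y := by
  have hd : det3 X Y n ^ 2 = -gram X Y := by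
    have h : det3 X Y n ^ 2 = -(gram X Y * lorentz n n - lorentz X X * lorentz n Y ^ 2
      - lorentz Y Y * lorentz n X ^ 2 + 2 * lorentz X Y * lorentz n X * lorentz n Y) := by
      simp only [det3, gram, lorentz]; ring
    rw [h, hn, hX, hY]; ring
  have hd0 : det3 X Y n ≠ 0 := by
    intro h; rw [h] at hd; exact hg (by linarith)
  simp only [lorentz] at hn hX hY
  have h0 : det3 X Y n * n 0 = X 1 * Y 2 - X 2 * Y 1 := by
    simp only [det3]
    linear_combination (X 1 * Y 2 - X 2 * Y 1) * hn + (Y 1 * n 2 - Y 2 * n 1) * hX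
      + (n 1 * X 2 - n 2 * X 1) * hY
  have h1 : det3 X Y n * n 1 = X 2 * Y 0 - X 0 * Y 2 := by
    simp only [det3]
    linear_combination (X 2 * Y 0 - X 0 * Y 2) * hn + (Y 2 * n 0 - Y 0 * n 2) * hX
      + (n 2 * X 0 - n 0 * X 2) * hY
  have h2 : det3 X Y n * n 2 = -(X 0 * Y 1 - X 1 * Y 0) := by
    simp only [det3]
    linear_combination -(X 0 * Y 1 - X 1 * Y 0) * hn - (Y 0 * n 1 - Y 1 * n 0) * hX
      - (n 0 * X 1 - n 1 * X 0) * hY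
  refine ⟨(det3 X Y n)⁻¹, inv_ne_zero hd0, ?_, fun Z => ?_⟩
  · rw [area]; field_simp; linarith
  · rw [lorentz]; field_simp; rw [mul_comm]
    have : det3 Z X Y = Z 0 * (X 1 * Y 2 - X 2 * Y 1) + Z 1 * (X 2 * Y 0 - X 0 * Y 2)
      + Z 2 * (X 0 * Y 1 - X 1 * Y 0) := by simp only [det3]; ring
    rw [this]
    linear_combination Z 0 * h0 + Z 1 * h1 - Z 2 * h2

/-- Here E, F, G are the coefficients of I₀; 0, h, k those of the flat second form; a, b, c those of
the third form, t is the height and m is η₃. The hypotheses `ha`, `hb`, `hc` express the third form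
through the other two. With W = EG − F², A = W(2H − ρ/t) and B = W(K + ρm/t²), conformality becomes
A·(second form) = B·I₀. Failing to be umbilic forces A = B = 0, and eliminating ρ leaves the
equation. -/
lemma cayley_hamilton_consequence {E F G h k t m ρ a b c : ℝ} (ht : 0 < t)
    (hW : E * G - F ^ 2 ≠ 0)
    (ha : (E * G - F ^ 2) * a = E * h ^ 2)
    (hb : (E * G - F ^ 2) * b = E * h * k - F * h ^ 2)
    (hc : (E * G - F ^ 2) * c = G * h ^ 2 - 2 * F * h * k + E * k ^ 2)
    (ha' : a = ρ * (E * m / t ^ 2)) (hb' : b = ρ * (h / t + F * m / t ^ 2))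
    (hc' : c = ρ * (k / t + G * m / t ^ 2))
    (hn : ¬ ∃ l : ℝ, E * m / t ^ 2 = l * (E / t ^ 2) ∧ h / t + F * m / t ^ 2 = l * (F / t ^ 2) ∧
      k / t + G * m / t ^ 2 = l * (G / t ^ 2)) :
    t * h ^ 2 = m * (E * k - 2 * F * h) := by
  set W := E * G - F ^ 2 with hWdef
  set A := E * k - 2 * F * h - W * (ρ / t) with hA
  set B := -h ^ 2 + W * ρ * m / t ^ 2 with hB
  have e1 : B * E = 0 := by rw [ha'] at ha; rw [hB]; linear_combination ha
  have e2 : A * h = B * F := by rw [hb'] at hb; rw [hA, hB]; linear_combination -hb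
  have e3 : A * k = B * G := by
    rw [hc'] at hc; rw [hA, hB]; linear_combination -hc
  have hA0 : A = 0 := by
    by_contra hA0
    -- With A ≠ 0 the flat second form is B/A times I₀, so II is (t B/A + m) times the metric form
    -- I₀/t².
    refine hn ⟨B / A * t + m, ?_, ?_, ?_⟩
    · field_simp; linear_combination -t * e1
    · field_simp; linear_combination t * e2
    · field_simp; linear_combination t * e3
  have hB0 : B = 0 := by
    by_contra hB0
    rw [hA0, zero_mul] at e2 e3
    have hF : F = 0 := by simpa [hB0] using e2.symm
    have hE : E = 0 := by simpa [hB0] using e1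
    exact hW (by rw [hWdef, hE, hF]; ring)
  have h1 : t * h ^ 2 = W * ρ * m / t := by
    have : h ^ 2 = W * ρ * m / t ^ 2 := by linarith
    rw [this]; field_simp
  have h2 : E * k - 2 * F * h = W * (ρ / t) := by linarith
  rw [h1, h2]; ring

/-- At a point which is not an umbilic, conformality of the normal Gauss map gives the equation
of the ruled surface. -/
lemma defect_eq_zero_of_conformal {X Y P Q n nu nv A A₂ B B₂ : Vec3} {t ρ u : ℝ} (ht : 0 < t)
    (hn : lorentz n n = 1) (hX : lorentz n X = 0) (hY : lorentz n Y = 0) (hg : gram X Y < 0)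
    (hu : lorentz n nu = 0) (hv : lorentz n nv = 0) (huX : lorentz nu X = 0)
    (huY : lorentz nu Y = -lorentz P n) (hvX : lorentz nv X = -lorentz P n)
    (hvY : lorentz nv Y = -lorentz Q n)
    (huu : lorentz nu nu = ρ * (lorentz X X * n 2 / t ^ 2))
    (huv : lorentz nu nv = ρ * (lorentz P n / t + lorentz X Y * n 2 / t ^ 2))
    (hvv : lorentz nv nv = ρ * (lorentz Q n / t + lorentz Y Y * n 2 / t ^ 2))
    (hne : ¬ ∃ l : ℝ, lorentz X X * n 2 / t ^ 2 = l * (lorentz X X / t ^ 2) ∧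
      lorentz P n / t + lorentz X Y * n 2 / t ^ 2 = l * (lorentz X Y / t ^ 2) ∧
      lorentz Q n / t + lorentz Y Y * n 2 / t ^ 2 = l * (lorentz Y Y / t ^ 2))
    (hXB : X = B) (ht' : t = A 2 + u * B 2) (A₁ : Vec3) (hYA : Y = A₁ + u • P)
    (hQ : Q = A₂ + u • B₂) :
    defect A A₁ A₂ B P B₂ u = 0 := by
  have huX' : lorentz X nu = 0 := by rw [lorentz_comm, huX]
  have key := cayley_hamilton_consequence (E := lorentz X X) (F := lorentz X Y)
    (G := lorentz Y Y) (h := lorentz P n) (k := lorentz Q n) (t := t) (m := n 2) (ρ := ρ) ht hg.ne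
    (by have := tangent_decomposition hn hX hY hu hg.ne nu
        rw [gram] at this
        rw [this, huX, huY, lorentz_comm X nu, lorentz_comm Y nu, huX, huY]; ring)
    (by have := tangent_decomposition hn hX hY hu hg.ne nv
        rw [gram] at this
        rw [this, huX, huY, lorentz_comm X nv, lorentz_comm Y nv, hvX, hvY]; ring)
    (by have := tangent_decomposition hn hX hY hv hg.ne nv
        rw [gram] at this
        rw [this, hvX, hvY, lorentz_comm X nv, lorentz_comm Y nv, hvX, hvY]; ring)
    huu huv hvv hne
  obtain ⟨κ, hκ, h2, h3⟩ := exists_normal_factor hn hX hY hg.ne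
  rw [h2, h3, h3] at key
  have key2 : t * det3 P X Y ^ 2 = -area X Y * (lorentz X X * det3 Q X Y
      - 2 * lorentz X Y * det3 P X Y) := by
    -- Both sides of the equation are quadratic in the normal, so its unknown length factor κ
    -- cancels.
    have : κ ^ 2 * (t * det3 P X Y ^ 2) = κ ^ 2 * (-area X Y * (lorentz X X * det3 Q X Y
      - 2 * lorentz X Y * det3 P X Y)) := by linear_combination key
    exact mul_left_cancel₀ (pow_ne_zero 2 hκ) this
  have e1 : det3 P X Y = det3 P B A₁ := by
    rw [hXB, hYA]; simp only [det3, Pi.add_apply, Pi.smul_apply, smul_eq_mul]; ring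
  have e2 : det3 Q X Y = det3 B (A₁ + u • P) (A₂ + u • B₂) := by
    rw [hXB, hYA, hQ]; simp only [det3, Pi.add_apply, Pi.smul_apply, smul_eq_mul]; ring
  rw [e1, e2, hXB, hYA, ht'] at key2
  rw [defect]; linear_combination key2

/-- If the tangent plane and the second derivatives are parallel to a fixed plane, then the
equation of the ruled surface holds trivially. -/
lemma defect_eq_zero_of_planar {A A₁ A₂ B P B₂ m : Vec3} {u : ℝ} (hm : m ≠ 0)
    (hX : m 0 * B 0 + m 1 * B 1 + m 2 * B 2 = 0)
    (hY : m 0 * (A₁ + u • P) 0 + m 1 * (A₁ + u • P) 1 + m 2 * (A₁ + u • P) 2 = 0)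
    (hP : m 0 * P 0 + m 1 * P 1 + m 2 * P 2 = 0)
    (hQ : m 0 * (A₂ + u • B₂) 0 + m 1 * (A₂ + u • B₂) 1 + m 2 * (A₂ + u • B₂) 2 = 0) :
    defect A A₁ A₂ B P B₂ u = 0 := by
  have gen : ∀ X Y Z : Vec3, m 0 * X 0 + m 1 * X 1 + m 2 * X 2 = 0 →
      m 0 * Y 0 + m 1 * Y 1 + m 2 * Y 2 = 0 → m 0 * Z 0 + m 1 * Z 1 + m 2 * Z 2 = 0 →
      det3 X Y Z = 0 := by
    intro X Y Z h1 h2 h3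
    by_contra hd
    refine hm ?_
    have key : ∀ i, det3 X Y Z * m i = 0 := by
      intro i
      fin_cases i <;> simp only [det3, Fin.zero_eta, Fin.mk_one, Fin.reduceFinMk]
      · linear_combination (Y 1 * Z 2 - Y 2 * Z 1) * h1 + (Z 1 * X 2 - Z 2 * X 1) * h2
          + (X 1 * Y 2 - X 2 * Y 1) * h3
      · linear_combination (Y 2 * Z 0 - Y 0 * Z 2) * h1 + (Z 2 * X 0 - Z 0 * X 2) * h2
          + (X 2 * Y 0 - X 0 * Y 2) * h3
      · linear_combination (Y 0 * Z 1 - Y 1 * Z 0) * h1 + (Z 0 * X 1 - Z 1 * X 0) * h2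
          + (X 0 * Y 1 - X 1 * Y 0) * h3
    funext i
    simpa [hd] using key i
  have e1 : det3 P B A₁ = 0 := by
    have := gen P B _ hP hX hY
    rw [← this]; simp only [det3, Pi.add_apply, Pi.smul_apply, smul_eq_mul]; ring
  rw [defect, e1, gen _ _ _ hX hY hQ]; ring

/-! ### Derivatives of ruled surfaces -/

section Smooth

variable {E : Type*} [NormedAddCommGroup E] [NormedSpace ℝ E]

lemma hasDerivAt_of_smoothOn {f : ℝ → E} {s : Set ℝ} (hf : ContDiffOn ℝ ∞ f s) (hs : IsOpen s)
    {v : ℝ} (hv : v ∈ s) : HasDerivAt f (deriv f v) v :=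
  ((hf.contDiffAt (hs.mem_nhds hv)).differentiableAt (by simp)).hasDerivAt

lemma smoothOn_deriv {f : ℝ → E} {s : Set ℝ} (hf : ContDiffOn ℝ ∞ f s) (hs : IsOpen s) :
    ContDiffOn ℝ ∞ (deriv f) s :=
  hf.deriv_of_isOpen hs (by simp)

end Smooth

lemma hasDerivAt_coord {f : ℝ → Vec3} {f' : Vec3} {v : ℝ} (hf : HasDerivAt f f' v) (i : Fin 3) :
    HasDerivAt (fun t => f t i) (f' i) v :=
  hasDerivAt_pi.1 hf i

lemma hasDerivAt_lorentz {f g : ℝ → Vec3} {f' g' : Vec3} {v : ℝ} (hf : HasDerivAt f f' v)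
    (hg : HasDerivAt g g' v) :
    HasDerivAt (fun t => lorentz (f t) (g t)) (lorentz f' (g v) + lorentz (f v) g') v := by
  have h := (((hasDerivAt_coord hf 0).mul (hasDerivAt_coord hg 0)).add
    ((hasDerivAt_coord hf 1).mul (hasDerivAt_coord hg 1))).sub
    ((hasDerivAt_coord hf 2).mul (hasDerivAt_coord hg 2))
  refine h.congr_deriv ?_
  simp only [lorentz]; ring

/-- Differentiation of a scalar product that is constant on an open set. -/
lemma lorentz_fderiv_of_const {f g : ℝ × ℝ → Vec3} {D : Set (ℝ × ℝ)} (hD : IsOpen D) {c : ℝ}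
    (hc : ∀ r ∈ D, lorentz (f r) (g r) = c) {q : ℝ × ℝ} (hq : q ∈ D)
    (hf : DifferentiableAt ℝ f q) (hg : DifferentiableAt ℝ g q) (ξ : ℝ × ℝ) :
    lorentz (fderiv ℝ f q ξ) (g q) + lorentz (f q) (fderiv ℝ g q ξ) = 0 := by
  have hl : HasDerivAt (fun t : ℝ => q + t • ξ) ξ 0 := by
    simpa using ((hasDerivAt_id (0 : ℝ)).smul_const ξ).const_add q
  have h0 : q + (0 : ℝ) • ξ = q := by simp
  have hf' : HasDerivAt (fun t : ℝ => f (q + t • ξ)) (fderiv ℝ f q ξ) 0 :=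
    HasFDerivAt.comp_hasDerivAt (0 : ℝ) (by rw [h0]; exact hf.hasFDerivAt) hl
  have hg' : HasDerivAt (fun t : ℝ => g (q + t • ξ)) (fderiv ℝ g q ξ) 0 :=
    HasFDerivAt.comp_hasDerivAt (0 : ℝ) (by rw [h0]; exact hg.hasFDerivAt) hl
  have h := hasDerivAt_lorentz hf' hg'
  simp only [h0] at h
  have hev : (fun t : ℝ => lorentz (f (q + t • ξ)) (g (q + t • ξ))) =ᶠ[nhds 0] fun _ => c := by
    have : Filter.Tendsto (fun t : ℝ => q + t • ξ) (nhds 0) (nhds q) := by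
      simpa [h0] using hl.continuousAt.tendsto
    filter_upwards [this (hD.mem_nhds hq)] with t ht using hc _ ht
  exact h.unique ((hasDerivAt_const (0 : ℝ) c).congr_of_eventuallyEq hev)

section Ruled

variable {D : Set (ℝ × ℝ)} {x N : ℝ × ℝ → Vec3} {α β : ℝ → Vec3}

lemma isOpen_image_snd (hD : IsOpen D) : IsOpen (Prod.snd '' D) :=
  isOpenMap_snd D hD

lemma fderiv_ruled (hD : IsOpen D) (hα : ContDiffOn ℝ ∞ α (Prod.snd '' D))
    (hβ : ContDiffOn ℝ ∞ β (Prod.snd '' D)) (hx : ∀ q ∈ D, x q = α q.2 + q.1 • β q.2)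
    {q : ℝ × ℝ} (hq : q ∈ D) (ξ : ℝ × ℝ) :
    fderiv ℝ x q ξ = ξ.1 • β q.2 + ξ.2 • (deriv α q.2 + q.1 • deriv β q.2) := by
  have hJ := isOpen_image_snd hD
  have hv : q.2 ∈ Prod.snd '' D := ⟨q, hq, rfl⟩
  have h := hasFDerivAt_ruled (hasDerivAt_of_smoothOn hα hJ hv) (hasDerivAt_of_smoothOn hβ hJ hv)
  have hev : x =ᶠ[nhds q] fun r => α r.2 + r.1 • β r.2 := by
    filter_upwards [hD.mem_nhds hq] with r hr using hx r hr
  rw [(h.congr_of_eventuallyEq hev).fderiv]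
  simp

lemma hasFDerivAt_fderiv_ruled (hD : IsOpen D) (hα : ContDiffOn ℝ ∞ α (Prod.snd '' D))
    (hβ : ContDiffOn ℝ ∞ β (Prod.snd '' D)) (hx : ∀ q ∈ D, x q = α q.2 + q.1 • β q.2)
    {q : ℝ × ℝ} (hq : q ∈ D) (ζ : ℝ × ℝ) :
    DifferentiableAt ℝ (fun r => fderiv ℝ x r ζ) q ∧ ∀ ξ : ℝ × ℝ,
      fderiv ℝ (fun r => fderiv ℝ x r ζ) q ξ =
        (ξ.1 * ζ.2 + ξ.2 * ζ.1) • deriv β q.2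
          + (ξ.2 * ζ.2) • (deriv (deriv α) q.2 + q.1 • deriv (deriv β) q.2) := by
  have hJ := isOpen_image_snd hD
  have hv : q.2 ∈ Prod.snd '' D := ⟨q, hq, rfl⟩
  have h1 := hasDerivAt_of_smoothOn hβ hJ hv
  have h2 := hasDerivAt_of_smoothOn (smoothOn_deriv hα hJ) hJ hv
  have h3 := hasDerivAt_of_smoothOn (smoothOn_deriv hβ hJ) hJ hv
  have h := hasFDerivAt_ruled (q := q) ((h1.const_smul ζ.1).add (h2.const_smul ζ.2))
    (h3.const_smul ζ.2)
  have hev : (fun r => fderiv ℝ x r ζ) =ᶠ[nhds q] fun r =>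
      (ζ.1 • β + ζ.2 • deriv α) r.2 + r.1 • (ζ.2 • deriv β) r.2 := by
    filter_upwards [hD.mem_nhds hq] with r hr
    rw [fderiv_ruled hD hα hβ hx hr ζ]
    simp only [Pi.add_apply, Pi.smul_apply, smul_add, smul_smul, mul_comm ζ.2]
    abel
  have h' := h.congr_of_eventuallyEq hev
  refine ⟨h'.differentiableAt, fun ξ => ?_⟩
  rw [h'.fderiv]
  funext i
  simp
  ring

end Ruled

/-! ### The curvature equation on the whole surface -/

section Ruled

variable {D : Set (ℝ × ℝ)} {x N : ℝ × ℝ → Vec3} {α β : ℝ → Vec3}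

/-- The normal Gauss map is the unit normal of the surface in `L³`. -/
lemma normalGaussMap_unit_normal (hx : IsTimelikeSurface D x) (hN : IsUnitNormal D x N)
    {q : ℝ × ℝ} (hq : q ∈ D) :
    lorentz (normalGaussMap x N q) (normalGaussMap x N q) = 1 ∧
      ∀ ξ, lorentz (normalGaussMap x N q) (fderiv ℝ x q ξ) = 0 := by
  have hp : 0 < x q 2 := hx.2.2.1 q hq
  obtain ⟨h1, h2⟩ := hN.2 q hq
  rw [normalGaussMap_eq]
  constructor
  · rw [lorentz_smul_left, lorentz_comm, lorentz_smul_left, ← h1, metric_eq]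
    field_simp
  · intro ξ
    have := h2 ξ
    rw [metric_eq, div_eq_zero_iff] at this
    rw [lorentz_smul_left, this.resolve_right (by positivity), mul_zero]

lemma smooth_normalGaussMap (hx : IsTimelikeSurface D x) (hN : IsUnitNormal D x N) :
    ContDiffOn ℝ ∞ (normalGaussMap x N) D := by
  have : normalGaussMap x N = fun q => (x q 2)⁻¹ • N q := funext (normalGaussMap_eq x N)
  rw [this]
  exact ((contDiffOn_pi.1 hx.2.1 2).inv (fun q hq => (hx.2.2.1 q hq).ne')).smul hN.1

/-- The metric is conformal to the flat one. In the Christoffel term, the products of tangent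
vectors with N vanish, and only the one containing the vertical component of N remains. -/
lemma secondForm_eq (hx : IsTimelikeSurface D x) (hN : IsUnitNormal D x N)
    {q : ℝ × ℝ} (hq : q ∈ D) (ξ ζ : ℝ × ℝ) :
    secondForm x N q ξ ζ =
      lorentz (fderiv ℝ (fun r => fderiv ℝ x r ζ) q ξ) (normalGaussMap x N q) / x q 2
      + lorentz (fderiv ℝ x q ξ) (fderiv ℝ x q ζ) * normalGaussMap x N q 2 / x q 2 ^ 2 := by
  have hp : 0 < x q 2 := hx.2.2.1 q hq
  have hNn : N q = x q 2 • normalGaussMap x N q := by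
    rw [normalGaussMap_eq, smul_smul, mul_inv_cancel₀ hp.ne', one_smul]
  have h := (normalGaussMap_unit_normal hx hN hq).2
  rw [secondForm, christoffel_eq hp.ne', metric_eq, hNn]
  simp only [lorentz_comm _ (x q 2 • normalGaussMap x N q), lorentz_smul_left, h,
    Pi.smul_apply, smul_eq_mul, lorentz_comm _ (normalGaussMap x N q)]
  field_simp
  ring

lemma continuousOn_defect {X : Type*} [TopologicalSpace X] {s : Set X}
    {A A₁ A₂ B B₁ B₂ : X → Vec3} {u : X → ℝ} (hA : ContinuousOn A s) (hA₁ : ContinuousOn A₁ s)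
    (hA₂ : ContinuousOn A₂ s) (hB : ContinuousOn B s) (hB₁ : ContinuousOn B₁ s)
    (hB₂ : ContinuousOn B₂ s) (hu : ContinuousOn u s) :
    ContinuousOn (fun q => defect (A q) (A₁ q) (A₂ q) (B q) (B₁ q) (B₂ q) (u q)) s := by
  simp only [defect, det3, area, lorentz, Pi.add_apply, Pi.smul_apply, smul_eq_mul]
  fun_prop

lemma gram_partials_neg (hx : IsTimelikeSurface D x) {q : ℝ × ℝ} (hq : q ∈ D) :
    gram (fderiv ℝ x q (1, 0)) (fderiv ℝ x q (0, 1)) < 0 := by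
  have hp : 0 < x q 2 := hx.2.2.1 q hq
  have h := hx.2.2.2 q hq
  simp only [firstForm, metric_eq] at h
  generalize fderiv ℝ x q (1, 0) = X at *
  generalize fderiv ℝ x q (0, 1) = Y at *
  have e : lorentz X X / x q 2 ^ 2 * (lorentz Y Y / x q 2 ^ 2) - (lorentz X Y / x q 2 ^ 2) ^ 2
      = gram X Y / x q 2 ^ 4 := by rw [gram]; field_simp
  rw [e] at h
  by_contra hc
  exact absurd h (not_lt.2 (div_nonneg (not_lt.1 hc) (by positivity)))

lemma gram_ruled_neg (hx : IsTimelikeSurface D x) (hα : ContDiffOn ℝ ∞ α (Prod.snd '' D))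
    (hβ : ContDiffOn ℝ ∞ β (Prod.snd '' D)) (hr : ∀ q ∈ D, x q = α q.2 + q.1 • β q.2)
    {q : ℝ × ℝ} (hq : q ∈ D) :
    gram (β q.2) (deriv α q.2 + q.1 • deriv β q.2) < 0 := by
  have h := gram_partials_neg hx hq
  simpa only [fderiv_ruled hx.1 hα hβ hr hq, one_smul, zero_smul, add_zero, zero_add] using h

lemma defect_eq_zero_of_not_umbilic (hx : IsTimelikeSurface D x) (hN : IsUnitNormal D x N)
    (hc : HasConformalNormalGaussMap D x N) (hα : ContDiffOn ℝ ∞ α (Prod.snd '' D))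
    (hβ : ContDiffOn ℝ ∞ β (Prod.snd '' D)) (hr : ∀ q ∈ D, x q = α q.2 + q.1 • β q.2)
    {q : ℝ × ℝ} (hq : q ∈ D) (hu : ¬ IsUmbilic x N q) :
    defect (α q.2) (deriv α q.2) (deriv (deriv α) q.2) (β q.2) (deriv β q.2)
      (deriv (deriv β) q.2) q.1 = 0 := by
  obtain ⟨ρ, -, hρ⟩ := hc
  have hD := hx.1
  have hp : 0 < x q 2 := hx.2.2.1 q hq
  set η := normalGaussMap x N with hη
  have hηd : DifferentiableAt ℝ η q :=
    ((smooth_normalGaussMap hx hN).contDiffAt (hD.mem_nhds hq)).differentiableAt (by simp)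
  have hnn := (normalGaussMap_unit_normal hx hN hq).1
  have hnx := (normalGaussMap_unit_normal hx hN hq).2
  have hdn : ∀ ξ, lorentz (η q) (fderiv ℝ η q ξ) = 0 := fun ξ => by
    have := lorentz_fderiv_of_const hD
      (fun r hr => (normalGaussMap_unit_normal hx hN hr).1) hq hηd hηd ξ
    rw [lorentz_comm (fderiv ℝ _ q ξ)] at this
    rw [hη]; linarith
  have hdx : ∀ ξ ζ, lorentz (fderiv ℝ η q ξ) (fderiv ℝ x q ζ)
      = -lorentz (fderiv ℝ (fun r => fderiv ℝ x r ζ) q ξ) (η q) := fun ξ ζ => by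
    have := lorentz_fderiv_of_const hD
      (fun r hr => (normalGaussMap_unit_normal hx hN hr).2 ζ) hq hηd
      (hasFDerivAt_fderiv_ruled hD hα hβ hr hq ζ).1 ξ
    rw [lorentz_comm (η q)] at this
    rw [hη] at *; linarith
  have hsec := fun ζ => (hasFDerivAt_fderiv_ruled hD hα hβ hr hq ζ).2
  have hfst := fderiv_ruled hD hα hβ hr hq
  have h4 := hρ q hq
  simp only [fourthForm, secondForm_eq hx hN hq, ← hη] at h4
  have hum : ∀ l : ℝ, (lorentz (β q.2) (β q.2) * η q 2 / x q 2 ^ 2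
        = l * (lorentz (β q.2) (β q.2) / x q 2 ^ 2) ∧
      lorentz (deriv β q.2) (η q) / x q 2
        + lorentz (β q.2) (deriv α q.2 + q.1 • deriv β q.2) * η q 2 / x q 2 ^ 2
        = l * (lorentz (β q.2) (deriv α q.2 + q.1 • deriv β q.2) / x q 2 ^ 2) ∧
      lorentz (deriv (deriv α) q.2 + q.1 • deriv (deriv β) q.2) (η q) / x q 2
        + lorentz (deriv α q.2 + q.1 • deriv β q.2) (deriv α q.2 + q.1 • deriv β q.2)
          * η q 2 / x q 2 ^ 2
        = l * (lorentz (deriv α q.2 + q.1 • deriv β q.2)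
          (deriv α q.2 + q.1 • deriv β q.2) / x q 2 ^ 2)) → False := by
    -- Proportionality of the three coefficients extends to all pairs of tangent vectors by
    -- bilinearity.
    rintro l ⟨h1, h2, h3⟩
    refine hu ⟨l, fun ξ ζ => ?_⟩
    rw [secondForm_eq hx hN hq, firstForm, metric_eq, hsec, hfst, hfst, ← hη]
    generalize deriv α q.2 + q.1 • deriv β q.2 = Y at *
    generalize deriv (deriv α) q.2 + q.1 • deriv (deriv β) q.2 = Q at *
    have bil : lorentz (ξ.1 • β q.2 + ξ.2 • Y) (ζ.1 • β q.2 + ζ.2 • Y)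
        = ξ.1 * ζ.1 * lorentz (β q.2) (β q.2) + (ξ.1 * ζ.2 + ξ.2 * ζ.1) * lorentz (β q.2) Y
          + ξ.2 * ζ.2 * lorentz Y Y := by
      simp only [lorentz, Pi.add_apply, Pi.smul_apply, smul_eq_mul]; ring
    rw [bil, lorentz_add_left, lorentz_smul_left, lorentz_smul_left]
    linear_combination ξ.1 * ζ.1 * h1 + (ξ.1 * ζ.2 + ξ.2 * ζ.1) * h2 + ξ.2 * ζ.2 * h3
  have f1 : fderiv ℝ x q (1, 0) = β q.2 := by rw [hfst]; simp
  have f2 : fderiv ℝ x q (0, 1) = deriv α q.2 + q.1 • deriv β q.2 := by rw [hfst]; simp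
  have s11 : fderiv ℝ (fun r => fderiv ℝ x r (1, 0)) q (1, 0) = 0 := by rw [hsec]; simp
  have s12 : fderiv ℝ (fun r => fderiv ℝ x r (0, 1)) q (1, 0) = deriv β q.2 := by
    rw [hsec]; simp
  have s21 : fderiv ℝ (fun r => fderiv ℝ x r (1, 0)) q (0, 1) = deriv β q.2 := by
    rw [hsec]; simp
  have s22 : fderiv ℝ (fun r => fderiv ℝ x r (0, 1)) q (0, 1)
      = deriv (deriv α) q.2 + q.1 • deriv (deriv β) q.2 := by rw [hsec]; simp
  have h0 : lorentz 0 (η q) = 0 := by simp [lorentz]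
  refine defect_eq_zero_of_conformal (X := β q.2) (Y := deriv α q.2 + q.1 • deriv β q.2)
    (P := deriv β q.2) (Q := deriv (deriv α) q.2 + q.1 • deriv (deriv β) q.2) (n := η q)
    (nu := fderiv ℝ η q (1, 0)) (nv := fderiv ℝ η q (0, 1)) (ρ := ρ q) hp hnn
    (f1 ▸ hnx _) (f2 ▸ hnx _) (gram_ruled_neg hx hα hβ hr hq) (hdn _) (hdn _) ?_ ?_ ?_ ?_ ?_ ?_ ?_
    (fun ⟨l, hl⟩ => hum l hl) rfl ?_ _ rfl rfl
  · have := hdx (1, 0) (1, 0); rw [f1, s11, h0] at this; simpa using this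
  · have := hdx (1, 0) (0, 1); rwa [f2, s12] at this
  · have := hdx (0, 1) (1, 0); rwa [f1, s21] at this
  · have := hdx (0, 1) (0, 1); rwa [f2, s22] at this
  · have := h4 (1, 0) (1, 0); rw [f1, s11, h0] at this; simpa using this
  · have := h4 (1, 0) (0, 1); rwa [f1, f2, s12] at this
  · have := h4 (0, 1) (0, 1); rwa [f2, s22] at this
  · rw [hr q hq]; simp

lemma defect_eq_zero_of_image_planar (hx : IsTimelikeSurface D x)
    (hα : ContDiffOn ℝ ∞ α (Prod.snd '' D)) (hβ : ContDiffOn ℝ ∞ β (Prod.snd '' D))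
    (hr : ∀ q ∈ D, x q = α q.2 + q.1 • β q.2) {V : Set (ℝ × ℝ)} (hV : IsOpen V) (hVD : V ⊆ D)
    (hp : LiesInPlane (x '' V)) {q : ℝ × ℝ} (hq : q ∈ V) :
    defect (α q.2) (deriv α q.2) (deriv (deriv α) q.2) (β q.2) (deriv β q.2)
      (deriv (deriv β) q.2) q.1 = 0 := by
  obtain ⟨m, d, hm, hmd⟩ := hp
  have hD := hx.1
  have hxd : ∀ r ∈ V, DifferentiableAt ℝ x r := fun r hr' =>
    (hx.2.1.contDiffAt (hD.mem_nhds (hVD hr'))).differentiableAt (by simp)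
  set m' : Vec3 := ![m 0, m 1, -m 2] with hm'
  have hl : ∀ Z, lorentz m' Z = m 0 * Z 0 + m 1 * Z 1 + m 2 * Z 2 := fun Z => by
    simp [lorentz, hm']
  have h1 : ∀ r ∈ V, ∀ ξ, lorentz m' (fderiv ℝ x r ξ) = 0 := fun r hr' ξ => by
    have := lorentz_fderiv_of_const hV (f := fun _ => m') (g := x) (c := d)
      (fun s hs => by rw [hl]; exact hmd _ ⟨s, hs, rfl⟩) hr' (differentiableAt_const _)
      (hxd r hr') ξ
    simpa [lorentz] using this
  have h2 : ∀ ξ ζ, lorentz m' (fderiv ℝ (fun r => fderiv ℝ x r ζ) q ξ) = 0 := fun ξ ζ => by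
    have := lorentz_fderiv_of_const hV (f := fun _ => m') (g := fun r => fderiv ℝ x r ζ) (c := 0)
      (fun s hs => h1 s hs ζ) hq (differentiableAt_const _)
      (hasFDerivAt_fderiv_ruled hD hα hβ hr (hVD hq) ζ).1 ξ
    simpa [lorentz] using this
  have hsec := fun ζ => (hasFDerivAt_fderiv_ruled hD hα hβ hr (hVD hq) ζ).2
  have hfst := fderiv_ruled hD hα hβ hr (hVD hq)
  refine defect_eq_zero_of_planar hm ?_ ?_ ?_ ?_ <;> rw [← hl]
  · have := h1 q hq (1, 0); rw [hfst] at this; simpa using this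
  · have := h1 q hq (0, 1); rw [hfst] at this; simpa using this
  · have := h2 (1, 0) (0, 1); rw [hsec] at this; simpa using this
  · have := h2 (0, 1) (0, 1); rw [hsec] at this; simpa using this

/-- The equation `x₃ K + 2 H η₃ = 0` holds on the whole surface. -/
theorem defect_eq_zero_of_mem (hx : IsTimelikeSurface D x) (hN : IsUnitNormal D x N)
    (hc : HasConformalNormalGaussMap D x N) (hu : UmbilicPiecesPlanar D x N)
    (hα : ContDiffOn ℝ ∞ α (Prod.snd '' D)) (hβ : ContDiffOn ℝ ∞ β (Prod.snd '' D))
    (hr : ∀ q ∈ D, x q = α q.2 + q.1 • β q.2) {q : ℝ × ℝ} (hq : q ∈ D) :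
    defect (α q.2) (deriv α q.2) (deriv (deriv α) q.2) (β q.2) (deriv β q.2)
      (deriv (deriv β) q.2) q.1 = 0 := by
  have hD := hx.1
  have hJ := isOpen_image_snd hD
  set f : ℝ × ℝ → ℝ := fun q => defect (α q.2) (deriv α q.2) (deriv (deriv α) q.2) (β q.2)
    (deriv β q.2) (deriv (deriv β) q.2) q.1 with hf
  have hfc : ContinuousOn f D := by
    have comp : ∀ {g : ℝ → Vec3}, ContDiffOn ℝ ∞ g (Prod.snd '' D) →
        ContinuousOn (fun q : ℝ × ℝ => g q.2) D := fun hg =>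
      hg.continuousOn.comp continuousOn_snd (fun q hq => ⟨q, hq, rfl⟩)
    exact continuousOn_defect (comp hα) (comp (smoothOn_deriv hα hJ))
      (comp (smoothOn_deriv (smoothOn_deriv hα hJ) hJ)) (comp hβ) (comp (smoothOn_deriv hβ hJ))
      (comp (smoothOn_deriv (smoothOn_deriv hβ hJ) hJ)) continuousOn_fst
  by_contra hne
  -- Where the defect is non-zero every point is an umbilic. A ball of such points lies in a plane
  -- by hypothesis, and on a planar piece the defect vanishes.
  have hopen : IsOpen (D ∩ f ⁻¹' {0}ᶜ) := hfc.isOpen_inter_preimage hD isOpen_compl_singleton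
  obtain ⟨ε, hε, hball⟩ := Metric.isOpen_iff.1 hopen q ⟨hq, hne⟩
  have hpl := hu (Metric.ball q ε) (fun r hr' => (hball hr').1) Metric.isOpen_ball
    ((convex_ball q ε).isConnected (Metric.nonempty_ball.2 hε))
    (fun r hr' => by
      by_contra hnu
      exact (hball hr').2 (defect_eq_zero_of_not_umbilic hx hN hc hα hβ hr (hball hr').1 hnu))
  exact hne (defect_eq_zero_of_image_planar hx hα hβ hr Metric.isOpen_ball
    (fun r hr' => (hball hr').1) hpl (Metric.mem_ball_self hε))

end Ruled

/-! ### Polynomial dependence along the rulings and invariance of the equation -/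

section

lemma defect_eq_cubic (A A₁ A₂ B B₁ B₂ : Vec3) (u : ℝ) :
    defect A A₁ A₂ B B₁ B₂ u =
      (A 2 * det3 B₁ B A₁ ^ 2 + area B A₁ * (lorentz B B * det3 B A₁ A₂
        - 2 * lorentz B A₁ * det3 B₁ B A₁))
      + (B 2 * det3 B₁ B A₁ ^ 2 + area B A₁ * (lorentz B B * (det3 B A₁ B₂ + det3 B B₁ A₂)
          - 2 * lorentz B B₁ * det3 B₁ B A₁)
        + area B B₁ * (lorentz B B * det3 B A₁ A₂ - 2 * lorentz B A₁ * det3 B₁ B A₁)) * u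
      + (area B A₁ * (lorentz B B * det3 B B₁ B₂)
        + area B B₁ * (lorentz B B * (det3 B A₁ B₂ + det3 B B₁ A₂)
          - 2 * lorentz B B₁ * det3 B₁ B A₁)) * u ^ 2
      + area B B₁ * (lorentz B B * det3 B B₁ B₂) * u ^ 3 := by
  have e1 : area B (A₁ + u • B₁) = area B A₁ + u * area B B₁ := by
    simp only [area, Pi.add_apply, Pi.smul_apply, smul_eq_mul]; ring
  have e2 : lorentz B (A₁ + u • B₁) = lorentz B A₁ + u * lorentz B B₁ := by
    simp only [lorentz, Pi.add_apply, Pi.smul_apply, smul_eq_mul]; ring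
  have e3 : det3 B (A₁ + u • B₁) (A₂ + u • B₂) = det3 B A₁ A₂
      + u * (det3 B A₁ B₂ + det3 B B₁ A₂) + u ^ 2 * det3 B B₁ B₂ := by
    simp only [det3, Pi.add_apply, Pi.smul_apply, smul_eq_mul]; ring
  rw [defect, e1, e2, e3]; ring

lemma cubic_eq_zero_of_eventually {a b c d u₀ : ℝ}
    (h : ∀ᶠ u in nhds u₀, a + b * u + c * u ^ 2 + d * u ^ 3 = 0) :
    a = 0 ∧ b = 0 ∧ c = 0 ∧ d = 0 := by
  obtain ⟨ε, hε, hb⟩ := Metric.eventually_nhds_iff.1 h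
  -- Four equally spaced zeros: their finite differences of order three, two and one isolate d, c
  -- and b in turn.
  have pt : ∀ k : ℝ, 0 ≤ k → k ≤ 3 → a + b * (u₀ + k * (ε / 4)) + c * (u₀ + k * (ε / 4)) ^ 2
      + d * (u₀ + k * (ε / 4)) ^ 3 = 0 := by
    intro k hk hk'
    apply hb
    rw [Real.dist_eq, add_sub_cancel_left, abs_of_nonneg (by positivity)]
    nlinarith
  set e := ε / 4 with he
  have he0 : e ≠ 0 := by positivity
  have p0 := pt 0 (by norm_num) (by norm_num)
  have p1 := pt 1 (by norm_num) (by norm_num)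
  have p2 := pt 2 (by norm_num) (by norm_num)
  have p3 := pt 3 (by norm_num) (by norm_num)
  have hd : d = 0 := by
    have : 6 * e ^ 3 * d = 0 := by linear_combination p3 - 3 * p2 + 3 * p1 - p0
    simpa [he0] using this
  subst hd
  have hc : c = 0 := by
    have : 2 * e ^ 2 * c = 0 := by linear_combination p2 - 2 * p1 + p0
    simpa [he0] using this
  subst hc
  have hb : b = 0 := by
    have : e * b = 0 := by linear_combination p1 - p0
    simpa [he0] using this
  subst hb
  exact ⟨by linarith, rfl, rfl, rfl⟩

/-- This frees the equation from D: it may be evaluated at any point of the line, in particular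
where the line meets the plane at height zero. -/
lemma defect_eq_zero_of_eventually {A A₁ A₂ B B₁ B₂ : Vec3} {u₀ : ℝ}
    (h : ∀ᶠ t in nhds u₀, defect A A₁ A₂ B B₁ B₂ t = 0) (u : ℝ) :
    defect A A₁ A₂ B B₁ B₂ u = 0 := by
  simp only [defect_eq_cubic] at h ⊢
  obtain ⟨h0, h1, h2, h3⟩ := cubic_eq_zero_of_eventually h
  rw [h0, h1, h2, h3]; ring

/-- A smooth family of lines `α(v) + u β(v)`, `v ∈ J`, satisfying the equation of ruled surfaces
with conformal normal Gauss map, each line having a point in the upper half-space at which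
the surface is time-like. -/
structure RuledData (J : Set ℝ) (α β : ℝ → Vec3) : Prop where
  isOpen : IsOpen J
  smooth_base : ContDiffOn ℝ ∞ α J
  smooth_dir : ContDiffOn ℝ ∞ β J
  eq_zero : ∀ v ∈ J, ∀ u, defect (α v) (deriv α v) (deriv (deriv α) v) (β v) (deriv β v)
    (deriv (deriv β) v) u = 0
  regular : ∀ v ∈ J, ∃ u, 0 < α v 2 + u * β v 2 ∧ gram (β v) (deriv α v + u • deriv β v) < 0

/-- The function whose zeros are the rulings along which the tangent plane is constant. -/
def twist (α β : ℝ → Vec3) (v : ℝ) : ℝ := det3 (deriv β v) (β v) (deriv α v)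

theorem ruledData_of_conformal {D : Set (ℝ × ℝ)} {x N : ℝ × ℝ → Vec3} {α β : ℝ → Vec3}
    (hx : IsTimelikeSurface D x) (hN : IsUnitNormal D x N)
    (hc : HasConformalNormalGaussMap D x N) (hu : UmbilicPiecesPlanar D x N)
    (hα : ContDiffOn ℝ ∞ α (Prod.snd '' D)) (hβ : ContDiffOn ℝ ∞ β (Prod.snd '' D))
    (hr : ∀ q ∈ D, x q = α q.2 + q.1 • β q.2) : RuledData (Prod.snd '' D) α β where
  isOpen := isOpen_image_snd hx.1
  smooth_base := hα
  smooth_dir := hβ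
  eq_zero := by
    rintro _ ⟨⟨u₀, v⟩, hq, rfl⟩ u
    have hev : ∀ᶠ t in nhds u₀, (t, v) ∈ D :=
      (Continuous.prodMk_left v).continuousAt.preimage_mem_nhds (hx.1.mem_nhds hq)
    exact defect_eq_zero_of_eventually (u₀ := u₀)
      (hev.mono fun t ht => defect_eq_zero_of_mem hx hN hc hu hα hβ hr ht) u
  regular := by
    rintro _ ⟨q, hq, rfl⟩
    refine ⟨q.1, ?_, gram_ruled_neg hx hα hβ hr hq⟩
    have := hx.2.2.1 q hq
    rw [hr q hq] at this
    simpa [upperHalfSpace] using this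

/-- Rotation about the vertical axis by the angle with cosine `c` and sine `s`. -/
def rot (c s : ℝ) (p : Vec3) : Vec3 := ![p 0 * c - p 1 * s, p 0 * s + p 1 * c, p 2]

@[simp] lemma rot_zero (c s : ℝ) (p : Vec3) : rot c s p 0 = p 0 * c - p 1 * s := rfl
@[simp] lemma rot_one (c s : ℝ) (p : Vec3) : rot c s p 1 = p 0 * s + p 1 * c := rfl
@[simp] lemma rot_two (c s : ℝ) (p : Vec3) : rot c s p 2 = p 2 := rfl

lemma rot_add_smul (c s u : ℝ) (p q : Vec3) : rot c s (p + u • q) = rot c s p + u • rot c s q := by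
  funext i
  fin_cases i <;> simp <;> ring

lemma hasDerivAt_rot (c s : ℝ) {f : ℝ → Vec3} {f' : Vec3} {v : ℝ} (hf : HasDerivAt f f' v) :
    HasDerivAt (fun t => rot c s (f t)) (rot c s f') v := by
  rw [hasDerivAt_pi]
  intro i
  fin_cases i
  · exact ((hasDerivAt_coord hf 0).mul_const c).sub ((hasDerivAt_coord hf 1).mul_const s)
  · exact ((hasDerivAt_coord hf 0).mul_const s).add ((hasDerivAt_coord hf 1).mul_const c)
  · exact hasDerivAt_coord hf 2

lemma contDiffOn_rot (c s : ℝ) {f : ℝ → Vec3} {J : Set ℝ} (hf : ContDiffOn ℝ ∞ f J) :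
    ContDiffOn ℝ ∞ (fun t => rot c s (f t)) J := by
  have h := contDiffOn_pi.1 hf
  rw [contDiffOn_pi]
  intro i
  fin_cases i
  · exact ((h 0).mul contDiffOn_const).sub ((h 1).mul contDiffOn_const)
  · exact ((h 0).mul contDiffOn_const).add ((h 1).mul contDiffOn_const)
  · exact h 2

variable {c s : ℝ}

lemma lorentz_rot (h : c ^ 2 + s ^ 2 = 1) (p q : Vec3) :
    lorentz (rot c s p) (rot c s q) = lorentz p q := by
  simp only [lorentz, rot_zero, rot_one, rot_two]
  linear_combination (p 0 * q 0 + p 1 * q 1) * h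

lemma area_rot (h : c ^ 2 + s ^ 2 = 1) (p q : Vec3) :
    area (rot c s p) (rot c s q) = area p q := by
  simp only [area, rot_zero, rot_one]
  linear_combination (p 0 * q 1 - p 1 * q 0) * h

lemma det3_eq_area (p q r : Vec3) :
    det3 p q r = p 2 * area q r - q 2 * area p r + r 2 * area p q := by
  simp only [det3, area]; ring

lemma det3_rot (h : c ^ 2 + s ^ 2 = 1) (p q r : Vec3) :
    det3 (rot c s p) (rot c s q) (rot c s r) = det3 p q r := by
  simp only [det3_eq_area, area_rot h, rot_two]

lemma defect_rot (h : c ^ 2 + s ^ 2 = 1) (A A₁ A₂ B B₁ B₂ : Vec3) (u : ℝ) :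
    defect (rot c s A) (rot c s A₁) (rot c s A₂) (rot c s B) (rot c s B₁) (rot c s B₂) u
      = defect A A₁ A₂ B B₁ B₂ u := by
  simp only [defect, ← rot_add_smul, det3_rot h, area_rot h, lorentz_rot h, rot_two]

lemma deriv_eqOn {E : Type*} [NormedAddCommGroup E] [NormedSpace ℝ E] {J : Set ℝ} (hJ : IsOpen J)
    {f g g' : ℝ → E} (hfg : ∀ v ∈ J, f v = g v) (hg : ∀ v ∈ J, HasDerivAt g (g' v) v) :
    ∀ v ∈ J, deriv f v = g' v := fun v hv =>
  ((hg v hv).congr_of_eventuallyEq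
    (by filter_upwards [hJ.mem_nhds hv] with t ht using hfg t ht)).deriv

namespace RuledData

variable {J : Set ℝ} {α β : ℝ → Vec3}

lemma mono (h : RuledData J α β) {J' : Set ℝ} (hJ' : IsOpen J') (hs : J' ⊆ J) :
    RuledData J' α β :=
  ⟨hJ', h.smooth_base.mono hs, h.smooth_dir.mono hs, fun v hv => h.eq_zero v (hs hv),
    fun v hv => h.regular v (hs hv)⟩

lemma base_deriv (h : RuledData J α β) {v : ℝ} (hv : v ∈ J) : HasDerivAt α (deriv α v) v :=
  hasDerivAt_of_smoothOn h.smooth_base h.isOpen hv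

lemma dir_deriv (h : RuledData J α β) {v : ℝ} (hv : v ∈ J) : HasDerivAt β (deriv β v) v :=
  hasDerivAt_of_smoothOn h.smooth_dir h.isOpen hv

lemma base_deriv2 (h : RuledData J α β) {v : ℝ} (hv : v ∈ J) :
    HasDerivAt (deriv α) (deriv (deriv α) v) v :=
  hasDerivAt_of_smoothOn (smoothOn_deriv h.smooth_base h.isOpen) h.isOpen hv

lemma dir_deriv2 (h : RuledData J α β) {v : ℝ} (hv : v ∈ J) :
    HasDerivAt (deriv β) (deriv (deriv β) v) v :=
  hasDerivAt_of_smoothOn (smoothOn_deriv h.smooth_dir h.isOpen) h.isOpen hv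

lemma continuousOn_twist (h : RuledData J α β) : ContinuousOn (twist α β) J := by
  have h1 := h.smooth_dir.continuousOn
  have h2 := (smoothOn_deriv h.smooth_dir h.isOpen).continuousOn
  have h3 := (smoothOn_deriv h.smooth_base h.isOpen).continuousOn
  unfold twist det3
  rw [continuousOn_pi] at h1 h2 h3
  have a0 := h1 0
  have a1 := h1 1
  have a2 := h1 2
  have b0 := h2 0
  have b1 := h2 1
  have b2 := h2 2
  have c0 := h3 0
  have c1 := h3 1
  have c2 := h3 2
  fun_prop

/-- The equation is invariant under rotations about the vertical axis. -/
lemma rotate (h : RuledData J α β) (hcs : c ^ 2 + s ^ 2 = 1) :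
    RuledData J (fun v => rot c s (α v)) (fun v => rot c s (β v)) ∧
      ∀ v ∈ J, twist (fun v => rot c s (α v)) (fun v => rot c s (β v)) v = twist α β v := by
  have hα : ∀ v ∈ J, deriv (fun v => rot c s (α v)) v = rot c s (deriv α v) := fun v hv =>
    (hasDerivAt_rot c s (h.base_deriv hv)).deriv
  have hβ : ∀ v ∈ J, deriv (fun v => rot c s (β v)) v = rot c s (deriv β v) := fun v hv =>
    (hasDerivAt_rot c s (h.dir_deriv hv)).deriv
  have hα' : ∀ v ∈ J, deriv (deriv fun v => rot c s (α v)) v = rot c s (deriv (deriv α) v) :=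
    deriv_eqOn h.isOpen hα fun v hv => hasDerivAt_rot c s (h.base_deriv2 hv)
  have hβ' : ∀ v ∈ J, deriv (deriv fun v => rot c s (β v)) v = rot c s (deriv (deriv β) v) :=
    deriv_eqOn h.isOpen hβ fun v hv => hasDerivAt_rot c s (h.dir_deriv2 hv)
  refine ⟨⟨h.isOpen, contDiffOn_rot c s h.smooth_base, contDiffOn_rot c s h.smooth_dir,
    fun v hv u => ?_, fun v hv => ?_⟩, fun v hv => ?_⟩
  · rw [hα v hv, hβ v hv, hα' v hv, hβ' v hv, defect_rot hcs, h.eq_zero v hv]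
  · obtain ⟨u, h1, h2⟩ := h.regular v hv
    refine ⟨u, h1, ?_⟩
    rw [hα v hv, hβ v hv, ← rot_add_smul]
    simpa only [gram, lorentz_rot hcs] using h2
  · simp only [twist]
    rw [hα v hv, hβ v hv, det3_rot hcs]

end RuledData

/-- The arguments are the 2-jets of α + sβ and kβ. The new line is the old one with u replaced by s
+ ku; the terms with s₁ and k₁ produced by the determinant and by the scalar product cancel each
other. -/
lemma defect_reparam (A A₁ A₂ B B₁ B₂ : Vec3) (s s₁ s₂ k k₁ k₂ u : ℝ) :
    defect (A + s • B) (A₁ + (s₁ • B + s • B₁)) (A₂ + (s₂ • B + (2 * s₁) • B₁ + s • B₂))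
      (k • B) (k₁ • B + k • B₁) (k₂ • B + (2 * k₁) • B₁ + k • B₂) u
      = k ^ 4 * defect A A₁ A₂ B B₁ B₂ (s + k * u) := by
  have e1 : det3 (k₁ • B + k • B₁) (k • B) (A₁ + (s₁ • B + s • B₁)) = k ^ 2 * det3 B₁ B A₁ := by
    simp only [det3, Pi.add_apply, Pi.smul_apply, smul_eq_mul]; ring
  have e2 : area (k • B) ((A₁ + (s₁ • B + s • B₁)) + u • (k₁ • B + k • B₁))
      = k * area B (A₁ + (s + k * u) • B₁) := by
    simp only [area, Pi.add_apply, Pi.smul_apply, smul_eq_mul]; ring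
  have e3 : lorentz (k • B) (k • B) = k ^ 2 * lorentz B B := by
    simp only [lorentz, Pi.smul_apply, smul_eq_mul]; ring
  have e4 : lorentz (k • B) ((A₁ + (s₁ • B + s • B₁)) + u • (k₁ • B + k • B₁))
      = k * (lorentz B (A₁ + (s + k * u) • B₁) + (s₁ + u * k₁) * lorentz B B) := by
    simp only [lorentz, Pi.add_apply, Pi.smul_apply, smul_eq_mul]; ring
  have e5 : det3 (k • B) ((A₁ + (s₁ • B + s • B₁)) + u • (k₁ • B + k • B₁))
      ((A₂ + (s₂ • B + (2 * s₁) • B₁ + s • B₂)) + u • (k₂ • B + (2 * k₁) • B₁ + k • B₂))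
      = k * (det3 B (A₁ + (s + k * u) • B₁) (A₂ + (s + k * u) • B₂)
        + 2 * (s₁ + u * k₁) * det3 B₁ B A₁) := by
    simp only [det3, Pi.add_apply, Pi.smul_apply, smul_eq_mul]; ring
  have e6 : (A + s • B) 2 + u * (k • B) 2 = A 2 + (s + k * u) * B 2 := by
    simp only [Pi.add_apply, Pi.smul_apply, smul_eq_mul]; ring
  rw [defect, e1, e2, e3, e4, e5, e6, defect]
  ring

/-- The equation is invariant under changes of the base curve and of the scale of the rulings. -/
lemma RuledData.reparam {J : Set ℝ} {α β a b : ℝ → Vec3} (h : RuledData J α β) {s k : ℝ → ℝ}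
    (ha : ContDiffOn ℝ ∞ a J) (hb : ContDiffOn ℝ ∞ b J) (hs : ContDiffOn ℝ ∞ s J)
    (hk : ContDiffOn ℝ ∞ k J) (hk0 : ∀ v ∈ J, k v ≠ 0) (hα : ∀ v ∈ J, α v = a v + s v • b v)
    (hβ : ∀ v ∈ J, β v = k v • b v) :
    RuledData J a b ∧ ∀ v ∈ J, twist α β v = k v ^ 2 * twist a b v := by
  have hJ := h.isOpen
  have d1 := fun v hv => hasDerivAt_of_smoothOn ha hJ (v := v) hv
  have d2 := fun v hv => hasDerivAt_of_smoothOn hb hJ (v := v) hv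
  have d3 := fun v hv => hasDerivAt_of_smoothOn hs hJ (v := v) hv
  have d4 := fun v hv => hasDerivAt_of_smoothOn hk hJ (v := v) hv
  have d1' := fun v hv => hasDerivAt_of_smoothOn (smoothOn_deriv ha hJ) hJ (v := v) hv
  have d2' := fun v hv => hasDerivAt_of_smoothOn (smoothOn_deriv hb hJ) hJ (v := v) hv
  have d3' := fun v hv => hasDerivAt_of_smoothOn (smoothOn_deriv hs hJ) hJ (v := v) hv
  have d4' := fun v hv => hasDerivAt_of_smoothOn (smoothOn_deriv hk hJ) hJ (v := v) hv
  have eα : ∀ v ∈ J, deriv α v = deriv a v + (deriv s v • b v + s v • deriv b v) :=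
    deriv_eqOn hJ hα fun v hv => ((d1 v hv).add ((d3 v hv).smul (d2 v hv))).congr_deriv
      (by abel)
  have eβ : ∀ v ∈ J, deriv β v = deriv k v • b v + k v • deriv b v :=
    deriv_eqOn hJ hβ fun v hv => ((d4 v hv).smul (d2 v hv)).congr_deriv (by abel)
  have eα' : ∀ v ∈ J, deriv (deriv α) v = deriv (deriv a) v
      + (deriv (deriv s) v • b v + (2 * deriv s v) • deriv b v + s v • deriv (deriv b) v) :=
    deriv_eqOn hJ eα fun v hv => ((d1' v hv).add (((d3' v hv).smul (d2 v hv)).add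
      ((d3 v hv).smul (d2' v hv)))).congr_deriv (by rw [two_mul, add_smul]; abel)
  have eβ' : ∀ v ∈ J, deriv (deriv β) v =
      deriv (deriv k) v • b v + (2 * deriv k v) • deriv b v + k v • deriv (deriv b) v :=
    deriv_eqOn hJ eβ fun v hv => (((d4' v hv).smul (d2 v hv)).add
      ((d4 v hv).smul (d2' v hv))).congr_deriv (by rw [two_mul, add_smul]; abel)
  refine ⟨⟨hJ, ha, hb, fun v hv u => ?_, fun v hv => ?_⟩, fun v hv => ?_⟩
  · have := h.eq_zero v hv ((u - s v) / k v)
    rw [eα v hv, eβ v hv, eα' v hv, eβ' v hv, hα v hv, hβ v hv, defect_reparam,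
      mul_div_cancel₀ _ (hk0 v hv), add_sub_cancel] at this
    exact (mul_eq_zero.1 this).resolve_left (pow_ne_zero 4 (hk0 v hv))
  · obtain ⟨u, h1, h2⟩ := h.regular v hv
    refine ⟨s v + k v * u, ?_, ?_⟩
    · rw [hα v hv, hβ v hv] at h1
      simp only [Pi.add_apply, Pi.smul_apply, smul_eq_mul] at h1
      linarith
    · rw [eα v hv, eβ v hv, hβ v hv] at h2
      have e : gram (k v • b v) (deriv a v + (deriv s v • b v + s v • deriv b v)
          + u • (deriv k v • b v + k v • deriv b v))
          = k v ^ 2 * gram (b v) (deriv a v + (s v + k v * u) • deriv b v) := by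
        simp only [gram, lorentz, Pi.add_apply, Pi.smul_apply, smul_eq_mul]; ring
      rw [e] at h2
      exact neg_of_mul_neg_right h2 (sq_nonneg _)
  · simp only [twist]
    rw [eα v hv, eβ v hv, hβ v hv]
    simp only [det3, Pi.add_apply, Pi.smul_apply, smul_eq_mul]; ring

end

open Set

/-! ### Twisted rulings have a stationary horizontal direction -/

section

lemma defect_coeffs {A A₁ A₂ B B₁ B₂ : Vec3} (h : ∀ u, defect A A₁ A₂ B B₁ B₂ u = 0) :
    (A 2 * det3 B₁ B A₁ ^ 2 + area B A₁ * (lorentz B B * det3 B A₁ A₂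
        - 2 * lorentz B A₁ * det3 B₁ B A₁) = 0) ∧
      B 2 * det3 B₁ B A₁ ^ 2 + area B A₁ * (lorentz B B * (det3 B A₁ B₂ + det3 B B₁ A₂)
          - 2 * lorentz B B₁ * det3 B₁ B A₁)
        + area B B₁ * (lorentz B B * det3 B A₁ A₂ - 2 * lorentz B A₁ * det3 B₁ B A₁) = 0 := by
  simp only [defect_eq_cubic] at h
  obtain ⟨h0, h1, -, -⟩ := cubic_eq_zero_of_eventually (u₀ := 0) (Filter.Eventually.of_forall h)
  exact ⟨h0, h1⟩

/-- Base curve, moved along the rulings into the plane where the `i`-th coordinate vanishes. -/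
def slide (i : Fin 3) (α β : ℝ → Vec3) (v : ℝ) : Vec3 := α v - (α v i / β v i) • β v

/-- Direction of the rulings, scaled to have `i`-th coordinate one. -/
def scale (i : Fin 3) (β : ℝ → Vec3) (v : ℝ) : Vec3 := (β v i)⁻¹ • β v

lemma slide_self {i : Fin 3} {α β : ℝ → Vec3} {v : ℝ} (h : β v i ≠ 0) : slide i α β v i = 0 := by
  simp [slide, h]

lemma scale_self {i : Fin 3} {β : ℝ → Vec3} {v : ℝ} (h : β v i ≠ 0) : scale i β v i = 1 := by
  simp [scale, h]

lemma slide_add_smul {i : Fin 3} {α β : ℝ → Vec3} {v : ℝ} :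
    α v = slide i α β v + α v i • scale i β v := by
  rw [slide, scale, smul_smul, div_eq_mul_inv, sub_add_cancel]

lemma smul_scale {i : Fin 3} {β : ℝ → Vec3} {v : ℝ} (h : β v i ≠ 0) :
    β v = β v i • scale i β v := by
  rw [scale, smul_smul, mul_inv_cancel₀ h, one_smul]

namespace RuledData

variable {J : Set ℝ} {α β : ℝ → Vec3}

lemma coord_base (h : RuledData J α β) (i : Fin 3) : ContDiffOn ℝ ∞ (fun v => α v i) J :=
  contDiffOn_pi.1 h.smooth_base i

lemma coord_dir (h : RuledData J α β) (i : Fin 3) : ContDiffOn ℝ ∞ (fun v => β v i) J :=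
  contDiffOn_pi.1 h.smooth_dir i

lemma slide_scale (h : RuledData J α β) (i : Fin 3) (hi : ∀ v ∈ J, β v i ≠ 0) :
    RuledData J (slide i α β) (scale i β) ∧
      ∀ v ∈ J, twist α β v = β v i ^ 2 * twist (slide i α β) (scale i β) v :=
  h.reparam (h.smooth_base.sub (((h.coord_base i).div (h.coord_dir i) hi).smul h.smooth_dir))
    (((h.coord_dir i).inv hi).smul h.smooth_dir) (h.coord_base i) (h.coord_dir i) hi
    (fun _ _ => slide_add_smul) (fun v hv => smul_scale (hi v hv))

lemma isOpen_dir_ne (h : RuledData J α β) (i : Fin 3) : IsOpen {v ∈ J | β v i ≠ 0} :=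
  (h.coord_dir i).continuousOn.isOpen_inter_preimage h.isOpen isOpen_compl_singleton

lemma isOpen_twist_ne (h : RuledData J α β) : IsOpen {v ∈ J | twist α β v ≠ 0} :=
  h.continuousOn_twist.isOpen_inter_preimage h.isOpen isOpen_compl_singleton

lemma deriv_base_const (h : RuledData J α β) {i : Fin 3} {r : ℝ} {J' : Set ℝ} (hJ' : IsOpen J')
    (hs : J' ⊆ J) (hr : ∀ v ∈ J', α v i = r) {v : ℝ} (hv : v ∈ J') : deriv α v i = 0 :=
  (hasDerivAt_coord (h.base_deriv (hs hv)) i).unique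
    ((hasDerivAt_const v r).congr_of_eventuallyEq
      (by filter_upwards [hJ'.mem_nhds hv] with t ht using hr t ht))

lemma deriv_dir_const (h : RuledData J α β) {i : Fin 3} {r : ℝ} {J' : Set ℝ} (hJ' : IsOpen J')
    (hs : J' ⊆ J) (hr : ∀ v ∈ J', β v i = r) {v : ℝ} (hv : v ∈ J') : deriv β v i = 0 :=
  (hasDerivAt_coord (h.dir_deriv (hs hv)) i).unique
    ((hasDerivAt_const v r).congr_of_eventuallyEq
      (by filter_upwards [hJ'.mem_nhds hv] with t ht using hr t ht))

lemma deriv2_base_const (h : RuledData J α β) {i : Fin 3} {r : ℝ} (hr : ∀ v ∈ J, α v i = r)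
    {v : ℝ} (hv : v ∈ J) : deriv (deriv α) v i = 0 :=
  (hasDerivAt_coord (h.base_deriv2 hv) i).unique
    ((hasDerivAt_const v (0 : ℝ)).congr_of_eventuallyEq
      (by filter_upwards [h.isOpen.mem_nhds hv] with t ht using
        h.deriv_base_const h.isOpen subset_rfl hr ht))

lemma deriv2_dir_const (h : RuledData J α β) {i : Fin 3} {r : ℝ} (hr : ∀ v ∈ J, β v i = r)
    {v : ℝ} (hv : v ∈ J) : deriv (deriv β) v i = 0 :=
  (hasDerivAt_coord (h.dir_deriv2 hv) i).unique
    ((hasDerivAt_const v (0 : ℝ)).congr_of_eventuallyEq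
      (by filter_upwards [h.isOpen.mem_nhds hv] with t ht using
        h.deriv_dir_const h.isOpen subset_rfl hr ht))

/-- On a ruling along which the tangent plane turns, a horizontal point of the spherical image
forces the height to vanish there. -/
lemma height_mul_area (h : RuledData J α β) {v : ℝ} (hv : v ∈ J) (ht : twist α β v ≠ 0)
    (hd : area (β v) (deriv β v) ≠ 0) :
    α v 2 * area (β v) (deriv β v) = β v 2 * area (β v) (deriv α v) := by
  -- The parameter at which the tangent plane is vertical. There the equation reduces to x₃ · twist²
  -- = 0.
  set u := -area (β v) (deriv α v) / area (β v) (deriv β v) with hu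
  have h0 := h.eq_zero v hv u
  have e : area (β v) (deriv α v + u • deriv β v) = 0 := by
    have : area (β v) (deriv α v + u • deriv β v)
        = area (β v) (deriv α v) + u * area (β v) (deriv β v) := by
      simp only [area, Pi.add_apply, Pi.smul_apply, smul_eq_mul]; ring
    rw [this, hu, div_mul_cancel₀ _ hd]; ring
  rw [defect, e, zero_mul, add_zero] at h0
  have h1 : α v 2 + u * β v 2 = 0 := (mul_eq_zero.1 h0).resolve_right (pow_ne_zero 2 ht)
  rw [hu] at h1
  field_simp at h1
  linarith

/-- On a vertical ruling the horizontal area vanishes identically, so the equation is x₃ · twist² =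
0, which is impossible at a point of positive height. -/
lemma dir_horizontal_ne (h : RuledData J α β) {v : ℝ} (hv : v ∈ J) (ht : twist α β v ≠ 0) :
    β v 0 ^ 2 + β v 1 ^ 2 ≠ 0 := by
  intro h0
  have h00 : β v 0 = 0 := by nlinarith [sq_nonneg (β v 0), sq_nonneg (β v 1)]
  have h01 : β v 1 = 0 := by nlinarith [sq_nonneg (β v 0), sq_nonneg (β v 1)]
  obtain ⟨u, hu, -⟩ := h.regular v hv
  have := h.eq_zero v hv u
  rw [defect, area, h00, h01] at this
  have h1 : (α v 2 + u * β v 2) * twist α β v ^ 2 = 0 := by rw [twist]; linarith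
  rcases mul_eq_zero.1 h1 with h2 | h2
  · exact hu.ne' h2
  · exact ht (pow_eq_zero_iff two_ne_zero |>.1 h2)

/-- Where the tangent plane turns along the rulings, the horizontal direction of the rulings
is stationary. -/
lemma area_dir_eq_zero (h : RuledData J α β) {v : ℝ} (hv : v ∈ J) (ht : twist α β v ≠ 0) :
    area (β v) (deriv β v) = 0 := by
  by_contra hd
  have hcont : ContinuousOn (fun v => area (β v) (deriv β v)) J := by
    have h1 := h.smooth_dir.continuousOn
    have h2 := (smoothOn_deriv h.smooth_dir h.isOpen).continuousOn
    simp only [area]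
    fun_prop
  set J₁ := {v ∈ J | twist α β v ≠ 0} ∩ {v ∈ J | area (β v) (deriv β v) ≠ 0} with hJ₁
  have hJ₁o : IsOpen J₁ := h.isOpen_twist_ne.inter
    (hcont.isOpen_inter_preimage h.isOpen isOpen_compl_singleton)
  have h1 := h.mono hJ₁o (fun w hw => hw.1.1)
  have hv1 : v ∈ J₁ := ⟨⟨hv, ht⟩, hv, hd⟩
  -- For a horizontal ruling, `height_mul_area` would put the whole line at height zero.
  have hβ2 : ∀ w ∈ J₁, β w 2 ≠ 0 := by
    intro w hw h2
    have := h1.height_mul_area hw hw.1.2 hw.2.2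
    rw [h2, zero_mul] at this
    have hα2 : α w 2 = 0 := (mul_eq_zero.1 this).resolve_right hw.2.2
    obtain ⟨u, hu, -⟩ := h1.regular w hw
    rw [h2, hα2] at hu
    simp at hu
  obtain ⟨h2, htw⟩ := h1.slide_scale 2 hβ2
  have hz : ∀ w ∈ J₁, slide 2 α β w 2 = 0 := fun w hw => slide_self (hβ2 w hw)
  have ho : ∀ w ∈ J₁, scale 2 β w 2 = 1 := fun w hw => scale_self (hβ2 w hw)
  have hk := fun w (hw : w ∈ J₁) => hasDerivAt_of_smoothOn (h1.coord_dir 2) hJ₁o hw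
  set a := slide 2 α β
  set b := scale 2 β with hb
  have hta : ∀ w ∈ J₁, twist a b w ≠ 0 := fun w hw h0 => hw.1.2 (by rw [htw w hw, h0, mul_zero])
  have hbd : ∀ w ∈ J₁, area (b w) (deriv b w) ≠ 0 := by
    intro w hw h0
    refine hw.2.2 ?_
    have e : deriv β w = deriv (fun v => β v 2) w • b w + β w 2 • deriv b w :=
      deriv_eqOn (g' := fun w => deriv (fun v => β v 2) w • b w + β w 2 • deriv b w) hJ₁o
        (fun t ht => smul_scale (hβ2 t ht)) (fun t ht => ((hk t ht).smul (h2.dir_deriv ht)).congr_deriv (by abel)) w hw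
    have e2 : area (β w) (deriv β w) = β w 2 ^ 2 * area (b w) (deriv b w) := by
      rw [e, smul_scale (hβ2 w hw), ← hb]
      simp only [area, Pi.add_apply, Pi.smul_apply, smul_eq_mul, ho w hw]
      ring
    rw [e2, h0, mul_zero]
  -- With the base curve at height zero and b₂ = 1, `height_mul_area` says that a' is horizontally
  -- parallel to b; differentiating this on the open set gives the next relation.
  have hba : ∀ w ∈ J₁, area (b w) (deriv a w) = 0 := by
    intro w hw
    have := h2.height_mul_area hw (hta w hw) (hbd w hw)
    rw [hz w hw, ho w hw] at this
    linarith
  have hba' : area (deriv b v) (deriv a v) + area (b v) (deriv (deriv a) v) = 0 := by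
    have d1 := hasDerivAt_coord (h2.dir_deriv hv1)
    have d2 := hasDerivAt_coord (h2.base_deriv2 hv1)
    have := ((d1 0).mul (d2 1)).sub ((d1 1).mul (d2 0))
    have h0 := this.unique ((hasDerivAt_const v (0 : ℝ)).congr_of_eventuallyEq
      (by filter_upwards [hJ₁o.mem_nhds hv1] with t ht using hba t ht))
    simp only [area]
    linarith
  have hc := (defect_coeffs (h2.eq_zero v hv1)).2
  have ha1 : deriv a v 2 = 0 := h2.deriv_base_const hJ₁o subset_rfl hz hv1
  have ha2 : deriv (deriv a) v 2 = 0 := h2.deriv2_base_const hz hv1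
  have hb1 : deriv b v 2 = 0 := h2.deriv_dir_const hJ₁o subset_rfl ho hv1
  have hT := hta v hv1
  have hB := hbd v hv1
  have hA := hba v hv1
  rw [hA, ho v hv1] at hc
  rw [twist] at hT
  simp only [det3_eq_area, ha1, ha2, hb1, ho v hv1, lorentz] at hc hT
  have hδ : area (deriv b v) (deriv a v) ≠ 0 := fun h0 => hT (by rw [h0]; ring)
  have hδ' : area (b v) (deriv (deriv a) v) = -area (deriv b v) (deriv a v) := by linarith
  set n := b v 0 ^ 2 + b v 1 ^ 2 with hn
  set p := b v 0 * deriv a v 0 + b v 1 * deriv a v 1 with hp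
  have e0 : n * deriv a v 0 = p * b v 0 := by
    rw [hn, hp]; simp only [area] at hA; linear_combination -b v 1 * hA
  have e1 : n * deriv a v 1 = p * b v 1 := by
    rw [hn, hp]; simp only [area] at hA; linear_combination b v 0 * hA
  have e2 : n * area (deriv b v) (deriv a v) = -p * area (b v) (deriv b v) := by
    simp only [area]; linear_combination deriv b v 0 * e1 - deriv b v 1 * e0
  have e3 : n * area (deriv a v) (deriv (deriv a) v)
      = -p * area (deriv b v) (deriv a v) := by
    rw [← mul_neg_one, mul_assoc, neg_one_mul, ← hδ']
    simp only [area]; linear_combination deriv (deriv a) v 1 * e0 - deriv (deriv a) v 0 * e1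
  have hn0 : n ≠ 0 := h2.dir_horizontal_ne hv1 (hta v hv1)
  -- With d = area(b, b') and δ = area(b', a'), the parallelism gives nδ = −pd and n² area(a', a'')
  -- = p²d. Substituted into the linear coefficient of the cubic, these leave −p²d²/n = 0.
  have fin : p ^ 2 * area (b v) (deriv b v) ^ 2 * n = 0 := by
    have e4 : n ^ 2 * area (deriv a v) (deriv (deriv a) v) = p ^ 2 * area (b v) (deriv b v) := by
      linear_combination n * e3 - p * e2
    have hc' : area (deriv b v) (deriv a v) ^ 2 + area (b v) (deriv b v) *
        ((n - 1) * area (deriv a v) (deriv (deriv a) v)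
          + 2 * p * area (deriv b v) (deriv a v)) = 0 := by
      rw [hn, hp]; linear_combination hc
    set δ := area (deriv b v) (deriv a v)
    set d := area (b v) (deriv b v)
    linear_combination -n ^ 2 * hc' + d * (n - 1) * e4 + (n * δ - p * d + 2 * p * d * n) * e2
  have hp0 : p = 0 := by
    rcases mul_eq_zero.1 fin with h3 | h3
    · rcases mul_eq_zero.1 h3 with h4 | h4
      · exact pow_eq_zero_iff two_ne_zero |>.1 h4
      · exact absurd (pow_eq_zero_iff two_ne_zero |>.1 h4) hB
    · exact absurd h3 hn0
  -- Now p = 0 gives δ = 0; but δ is the twist up to sign.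
  rw [hp0, neg_zero, zero_mul] at e2
  exact hδ ((mul_eq_zero.1 e2).resolve_left hn0)

end RuledData

end

/-! ### First integrals of the differential equations -/

section

section RealFunctions

variable {c d : ℝ}

lemma exists_const_of_hasDerivAt_zero {f : ℝ → ℝ} (hf : ∀ v ∈ Ioo c d, HasDerivAt f 0 v) :
    ∃ C, ∀ v ∈ Ioo c d, f v = C := by
  rcases (Ioo c d).eq_empty_or_nonempty with h | ⟨w, hw⟩
  · exact ⟨0, by simp [h]⟩
  · exact ⟨f w, fun v hv => isOpen_Ioo.is_const_of_deriv_eq_zero isPreconnected_Ioo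
      (fun t ht => (hf t ht).differentiableAt.differentiableWithinAt)
      (fun t ht => (hf t ht).deriv) hv hw⟩

lemma pos_or_neg_of_ne_zero {f : ℝ → ℝ} (hf : ContinuousOn f (Ioo c d))
    (h0 : ∀ v ∈ Ioo c d, f v ≠ 0) : (∀ v ∈ Ioo c d, 0 < f v) ∨ ∀ v ∈ Ioo c d, f v < 0 := by
  by_contra hcon
  push Not at hcon
  obtain ⟨⟨v, hv, hv'⟩, w, hw, hw'⟩ := hcon
  obtain ⟨t, ht, ht'⟩ := isPreconnected_Ioo.intermediate_value hv hw hf ⟨hv', hw'⟩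
  exact h0 t ht ht'

lemma eq_of_eqOn_Ioo {f g : ℝ → ℝ} {v : ℝ} (hcd : c < d) (hv : v ∈ Icc c d)
    (hf : ContinuousAt f v) (hg : ContinuousAt g v) (h : ∀ w ∈ Ioo c d, f w = g w) :
    f v = g v := by
  have hcl : v ∈ closure (Ioo c d) := by rwa [closure_Ioo hcd.ne]
  have : (nhdsWithin v (Ioo c d)).NeBot := mem_closure_iff_nhdsWithin_neBot.1 hcl
  refine tendsto_nhds_unique (l := nhdsWithin v (Ioo c d)) (hf.tendsto.mono_left nhdsWithin_le_nhds)
    ((hg.tendsto.mono_left nhdsWithin_le_nhds).congr' ?_)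
  filter_upwards [self_mem_nhdsWithin] with w hw using (h w hw).symm

lemma deriv_eq_of_eqOn_Ioo {f g : ℝ → ℝ} {f' g' v : ℝ} (hcd : c < d) (hv : v ∈ Icc c d)
    (hf : HasDerivAt f f' v) (hg : HasDerivAt g g' v) (h : ∀ w ∈ Ioo c d, f w = g w) :
    f' = g' := by
  have hcl : v ∈ closure (Ioo c d) := by rwa [closure_Ioo hcd.ne]
  have hu : UniqueDiffWithinAt ℝ (Ioo c d) v :=
    uniqueDiffWithinAt_convex (convex_Ioo c d) (by simpa using hcd) hcl
  refine hu.eq_deriv _ (hf.hasDerivWithinAt) (hg.hasDerivWithinAt.congr h ?_)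
  exact eq_of_eqOn_Ioo hcd hv hf.continuousAt hg.continuousAt h

/-- A set meeting an open interval, and containing the end points of the intervals
it contains, contains the whole interval. -/
lemma Ioo_subset_of_closed_under_endpoints {O : Set ℝ} (hO : IsOpen O)
    (hne : (Ioo c d ∩ O).Nonempty)
    (h : ∀ a b, a < b → Ioo a b ⊆ O → Ioo a b ⊆ Ioo c d → ∀ v ∈ Icc a b, v ∈ Ioo c d → v ∈ O) :
    Ioo c d ⊆ O := by
  obtain ⟨w, hw, hwO⟩ := hne
  have right : ∀ v ∈ Ioo c d, w ≤ v → v ∈ O := by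
    intro v hv hwv
    by_contra hvO
    set S := {t | w ≤ t ∧ t ≤ v ∧ t ∉ O} with hS
    have hSne : S.Nonempty := ⟨v, hwv, le_rfl, hvO⟩
    have hSb : BddBelow S := ⟨w, fun t ht => ht.1⟩
    have hScl : IsClosed S := by
      have : S = Icc w v ∩ Oᶜ := by ext t; simp [hS, and_assoc]
      rw [this]; exact isClosed_Icc.inter hO.isClosed_compl
    have hmem := hScl.csInf_mem hSne hSb
    set e := sInf S
    have hwe : w < e := lt_of_le_of_ne hmem.1 (fun h' => hmem.2.2 (h' ▸ hwO))
    refine hmem.2.2 (h w e hwe (fun t ht => ?_) (fun t ht => ?_) e ⟨hwe.le, le_rfl⟩ ?_)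
    · by_contra htO
      exact absurd (csInf_le hSb ⟨ht.1.le, ht.2.le.trans hmem.2.1, htO⟩) (not_le.2 ht.2)
    · exact ⟨hw.1.trans ht.1, ht.2.trans_le (hmem.2.1.trans hv.2.le)⟩
    · exact ⟨hw.1.trans hwe, hmem.2.1.trans_lt hv.2⟩
  have left : ∀ v ∈ Ioo c d, v ≤ w → v ∈ O := by
    intro v hv hwv
    by_contra hvO
    set S := {t | v ≤ t ∧ t ≤ w ∧ t ∉ O} with hS
    have hSne : S.Nonempty := ⟨v, le_rfl, hwv, hvO⟩
    have hSb : BddAbove S := ⟨w, fun t ht => ht.2.1⟩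
    have hScl : IsClosed S := by
      have : S = Icc v w ∩ Oᶜ := by ext t; simp [hS, and_assoc]
      rw [this]; exact isClosed_Icc.inter hO.isClosed_compl
    have hmem := hScl.csSup_mem hSne hSb
    set e := sSup S
    have hwe : e < w := lt_of_le_of_ne hmem.2.1 (fun h' => hmem.2.2 (h' ▸ hwO))
    refine hmem.2.2 (h e w hwe (fun t ht => ?_) (fun t ht => ?_) e ⟨le_rfl, hwe.le⟩ ?_)
    · by_contra htO
      exact absurd (le_csSup hSb ⟨hmem.1.trans ht.1.le, ht.2.le, htO⟩) (not_le.2 ht.1)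
    · exact ⟨hv.1.trans_le (hmem.1.trans ht.1.le), ht.2.trans hw.2⟩
    · exact ⟨hv.1.trans_le hmem.1, hwe.trans hw.2⟩
  exact fun v hv => (le_total w v).elim (right v hv) (left v hv)

end RealFunctions

namespace RuledData

variable {J : Set ℝ} {α β : ℝ → Vec3} {c d : ℝ}

/-- On an interval where the tangent plane turns along the rulings, the rulings project to
parallel horizontal lines. -/
lemma exists_rot_dir_eq_zero (h : RuledData J α β) (hI : Ioo c d ⊆ J)
    (ht : ∀ v ∈ Ioo c d, twist α β v ≠ 0) :
    ∃ m n : ℝ, m ^ 2 + n ^ 2 = 1 ∧ ∀ v ∈ Ioo c d, rot m n (β v) 1 = 0 := by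
  rcases (Ioo c d).eq_empty_or_nonempty with he | ⟨w, hw⟩
  · exact ⟨1, 0, by norm_num, by simp [he]⟩
  set r : ℝ → ℝ := fun v => √(β v 0 ^ 2 + β v 1 ^ 2) with hr
  have hpos : ∀ v ∈ Ioo c d, 0 < β v 0 ^ 2 + β v 1 ^ 2 := fun v hv =>
    lt_of_le_of_ne (by positivity) (h.dir_horizontal_ne (hI hv) (ht v hv)).symm
  have hr0 : ∀ v ∈ Ioo c d, 0 < r v := fun v hv => Real.sqrt_pos.2 (hpos v hv)
  have hr2 : ∀ v ∈ Ioo c d, r v ^ 2 = β v 0 ^ 2 + β v 1 ^ 2 := fun v hv =>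
    Real.sq_sqrt (hpos v hv).le
  have hdr : ∀ v ∈ Ioo c d,
      HasDerivAt r ((β v 0 * deriv β v 0 + β v 1 * deriv β v 1) / r v) v := fun v hv => by
    have d0 := hasDerivAt_coord (h.dir_deriv (hI hv)) 0
    have d1 := hasDerivAt_coord (h.dir_deriv (hI hv)) 1
    have := ((d0.pow 2).add (d1.pow 2)).sqrt (hpos v hv).ne'
    refine this.congr_deriv ?_
    have := hr0 v hv
    simp only [hr] at this ⊢
    simp only [Pi.add_apply, Pi.pow_apply]
    field_simp
    simp
    ring
  -- The horizontal unit vector of β has derivative proportional to area(β, β'), which vanishes on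
  -- twisted rulings.
  have key : ∀ i : Fin 3, (i = 0 ∨ i = 1) → ∀ v ∈ Ioo c d, HasDerivAt (fun v => β v i / r v) 0 v := by
    intro i hi v hv
    have := (hasDerivAt_coord (h.dir_deriv (hI hv)) i).div (hdr v hv) (hr0 v hv).ne'
    refine this.congr_deriv ?_
    have ha := h.area_dir_eq_zero (hI hv) (ht v hv)
    have h1 := hr0 v hv
    have h2 := hr2 v hv
    rw [area] at ha
    have : deriv β v i * r v ^ 2 - β v i * (β v 0 * deriv β v 0 + β v 1 * deriv β v 1) = 0 := by
      rw [h2]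
      rcases hi with rfl | rfl
      · linear_combination -β v 1 * ha
      · linear_combination β v 0 * ha
    field_simp
    linear_combination this
  obtain ⟨e0, h0⟩ := exists_const_of_hasDerivAt_zero (key 0 (Or.inl rfl))
  obtain ⟨e1, h1⟩ := exists_const_of_hasDerivAt_zero (key 1 (Or.inr rfl))
  refine ⟨e0, -e1, ?_, fun v hv => ?_⟩
  · rw [← h0 w hw, ← h1 w hw]
    have := hr0 w hw
    have h2 := hr2 w hw
    field_simp
    linarith
  · have h0' := h0 v hv
    have h1' := h1 v hv
    have := hr0 v hv
    rw [div_eq_iff this.ne'] at h0' h1'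
    rw [rot_one, h0', h1']; ring

end RuledData

/-- First integrals of the equation of ruled surfaces for `x = (u, y(v), z(v) + u τ(v))`. -/
lemma first_integrals_horizontal {c d : ℝ} {τ τ₁ τ₂ y y₁ y₂ z z₁ z₂ : ℝ → ℝ} (hcd : c < d)
    (hτ : ∀ v ∈ Ioo c d, HasDerivAt τ (τ₁ v) v) (hτ₁ : ∀ v ∈ Ioo c d, HasDerivAt τ₁ (τ₂ v) v)
    (hy : ∀ v ∈ Ioo c d, HasDerivAt y (y₁ v) v) (hy₁ : ∀ v ∈ Ioo c d, HasDerivAt y₁ (y₂ v) v)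
    (hz : ∀ v ∈ Ioo c d, HasDerivAt z (z₁ v) v) (hz₁ : ∀ v ∈ Ioo c d, HasDerivAt z₁ (z₂ v) v)
    (h1 : ∀ v ∈ Ioo c d, τ₁ v ≠ 0) (h2 : ∀ v ∈ Ioo c d, y₁ v ≠ 0)
    (e0 : ∀ v ∈ Ioo c d, z v * τ₁ v ^ 2 * y₁ v + ((1 - τ v ^ 2) * (y₁ v * z₂ v - z₁ v * y₂ v)
      + 2 * τ v * z₁ v * τ₁ v * y₁ v) = 0)
    (e1 : ∀ v ∈ Ioo c d,
      3 * τ v * τ₁ v ^ 2 * y₁ v = (1 - τ v ^ 2) * (τ₁ v * y₂ v - y₁ v * τ₂ v)) :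
    ∃ ε C A B y₀ : ℝ, (ε = 1 ∨ ε = -1) ∧ C ≠ 0 ∧ ∀ v ∈ Ioo c d, 0 < ε * (1 - τ v ^ 2) ∧
      y₁ v * √(ε * (1 - τ v ^ 2)) ^ 3 = C * τ₁ v ∧
      y v = ε * C * τ v / √(ε * (1 - τ v ^ 2)) + y₀ ∧
      z v = A * √(ε * (1 - τ v ^ 2)) + B * τ v ∧
      z₁ v = (-A * ε * τ v / √(ε * (1 - τ v ^ 2)) + B) * τ₁ v := by
  -- If τ² = 1, then `e1` leaves 3ττ₁²y₁ = 0 with three non-zero factors. So no twisted ruling is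
  -- null, and the sign ε of 1 − τ² is constant on the interval.
  have hne : ∀ v ∈ Ioo c d, 1 - τ v ^ 2 ≠ 0 := by
    intro v hv h0
    have := e1 v hv
    rw [h0, zero_mul] at this
    have hτ0 : τ v ≠ 0 := by rintro h; rw [h] at h0; norm_num at h0
    have : τ v * τ₁ v ^ 2 * y₁ v = 0 := by linarith
    exact (mul_ne_zero (mul_ne_zero hτ0 (pow_ne_zero 2 (h1 v hv))) (h2 v hv)) this
  have hcont : ContinuousOn (fun v => 1 - τ v ^ 2) (Ioo c d) := fun v hv =>
    (continuousAt_const.sub ((hτ v hv).continuousAt.pow 2)).continuousWithinAt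
  obtain ⟨ε, hε, hpos⟩ : ∃ ε : ℝ, (ε = 1 ∨ ε = -1) ∧ ∀ v ∈ Ioo c d, 0 < ε * (1 - τ v ^ 2) := by
    rcases pos_or_neg_of_ne_zero hcont hne with h | h
    · exact ⟨1, Or.inl rfl, fun v hv => by linarith [h v hv]⟩
    · exact ⟨-1, Or.inr rfl, fun v hv => by linarith [h v hv]⟩
  have hε2 : ε ^ 2 = 1 := by rcases hε with rfl | rfl <;> norm_num
  set r : ℝ → ℝ := fun v => √(ε * (1 - τ v ^ 2)) with hr
  have hr0 : ∀ v ∈ Ioo c d, 0 < r v := fun v hv => Real.sqrt_pos.2 (hpos v hv)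
  have hr2 : ∀ v ∈ Ioo c d, r v ^ 2 = ε * (1 - τ v ^ 2) := fun v hv =>
    Real.sq_sqrt (hpos v hv).le
  have hdr : ∀ v ∈ Ioo c d, HasDerivAt r (-ε * τ v * τ₁ v / r v) v := fun v hv => by
    have := ((((hτ v hv).pow 2).const_sub 1).const_mul ε).sqrt (hpos v hv).ne'
    refine this.congr_deriv ?_
    have := hr0 v hv
    simp only [hr] at this ⊢
    simp only [Pi.pow_apply]
    field_simp
    simp
    ring
  have h1' : ∀ v ∈ Ioo c d, (1 - τ v ^ 2) = ε * r v ^ 2 := fun v hv => by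
    rw [hr2 v hv, ← mul_assoc, ← pow_two, hε2, one_mul]
  obtain ⟨C, hC⟩ := exists_const_of_hasDerivAt_zero (c := c) (d := d)
    (f := fun v => y₁ v * r v ^ 3 / τ₁ v) (fun v hv => by
      have := ((hy₁ v hv).mul ((hdr v hv).pow 3)).div (hτ₁ v hv) (h1 v hv)
      refine this.congr_deriv ?_
      have a1 := hr0 v hv
      have a2 := h1 v hv
      have a3 := e1 v hv
      rw [h1' v hv] at a3
      simp only [Pi.pow_apply, Pi.mul_apply]
      push_cast
      field_simp
      have a4 : r v ^ 2 * (τ₁ v * y₂ v - y₁ v * τ₂ v) = ε * (3 * τ v * τ₁ v ^ 2 * y₁ v) := by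
        rw [a3]; linear_combination -(r v ^ 2 * (τ₁ v * y₂ v - y₁ v * τ₂ v)) * hε2
      linear_combination r v * a4)
  have hC' : ∀ v ∈ Ioo c d, y₁ v * r v ^ 3 = C * τ₁ v := fun v hv => by
    have := hC v hv
    rwa [div_eq_iff (h1 v hv)] at this
  obtain ⟨y₀, hy₀⟩ := exists_const_of_hasDerivAt_zero (c := c) (d := d)
    (f := fun v => y v - ε * C * (τ v / r v)) (fun v hv => by
      have := (hy v hv).sub (((hτ v hv).div (hdr v hv) (hr0 v hv).ne').const_mul (ε * C))
      refine this.congr_deriv ?_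
      have a1 := hr0 v hv
      have a2 := hC' v hv
      have a3 := hr2 v hv
      field_simp
      linear_combination a2 - ε * C * τ₁ v * a3
        + (-C * τ₁ v + C * τ₁ v * τ v ^ 2 - C * τ₁ v * τ v ^ 2) * hε2)
  -- Eliminating y₂ between the two equations. With τ as independent variable this is the Chebyshev
  -- equation (1 − τ²)z'' − τz' + z = 0, with solutions τ and √|1 − τ²|; the constants A and B below
  -- are obtained by variation of constants.
  have key : ∀ v ∈ Ioo c d, z v * τ₁ v ^ 3 + (1 - τ v ^ 2) * (z₂ v * τ₁ v - z₁ v * τ₂ v)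
      - τ v * z₁ v * τ₁ v ^ 2 = 0 := fun v hv => by
    have : y₁ v * (z v * τ₁ v ^ 3 + (1 - τ v ^ 2) * (z₂ v * τ₁ v - z₁ v * τ₂ v)
      - τ v * z₁ v * τ₁ v ^ 2) = 0 := by
      linear_combination τ₁ v * e0 v hv - z₁ v * e1 v hv
    exact (mul_eq_zero.1 this).resolve_left (h2 v hv)
  have hζ : ∀ v ∈ Ioo c d, HasDerivAt (fun v => z₁ v / τ₁ v)
      ((z₂ v * τ₁ v - z₁ v * τ₂ v) / τ₁ v ^ 2) v := fun v hv =>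
    (hz₁ v hv).div (hτ₁ v hv) (h1 v hv)
  obtain ⟨A, hA⟩ := exists_const_of_hasDerivAt_zero (c := c) (d := d)
    (f := fun v => r v * (z v - z₁ v / τ₁ v * τ v)) (fun v hv => by
      have := (hdr v hv).mul ((hz v hv).sub ((hζ v hv).mul (hτ v hv)))
      refine this.congr_deriv ?_
      have a1 := hr0 v hv
      have a2 := h1 v hv
      have a3 := key v hv
      rw [h1' v hv] at a3
      simp only [Pi.sub_apply, Pi.mul_apply]
      field_simp
      linear_combination -ε * τ v * a3 + τ v * r v ^ 2 * (z₂ v * τ₁ v - z₁ v * τ₂ v) * hε2)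
  obtain ⟨B, hB⟩ := exists_const_of_hasDerivAt_zero (c := c) (d := d)
    (f := fun v => z₁ v / τ₁ v * (1 - τ v ^ 2) + τ v * z v) (fun v hv => by
      have := ((hζ v hv).mul (((hτ v hv).pow 2).const_sub 1)).add ((hτ v hv).mul (hz v hv))
      refine this.congr_deriv ?_
      have a2 := h1 v hv
      have a3 := key v hv
      simp only [Pi.pow_apply]
      field_simp
      push_cast
      linear_combination a3)
  -- The integral A found above is r(z − τ z₁/τ₁). Since r² = ε(1 − τ²), solving for z introduces
  -- the factor ε.
  refine ⟨ε, C, ε * A, B, y₀, hε, ?_, fun v hv => ⟨hpos v hv, hC' v hv, ?_, ?_, ?_⟩⟩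
  · rintro rfl
    obtain ⟨w, hw⟩ := nonempty_Ioo.2 hcd
    have := hC' w hw
    rw [zero_mul] at this
    exact (mul_ne_zero (h2 w hw) (pow_ne_zero 3 (hr0 w hw).ne')) this
  · have := hy₀ v hv
    simp only [hr] at this
    rw [mul_div_assoc]; linarith
  · have a1 := hr0 v hv
    change z v = ε * A * r v + B * τ v
    rw [← hA v hv, ← hB v hv]
    have a2 := hr2 v hv
    linear_combination -ε * (z v - z₁ v / τ₁ v * τ v) * a2
      - (1 - τ v ^ 2) * (z v - z₁ v / τ₁ v * τ v) * hε2
  · have a1 := hr0 v hv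
    have a2 := h1 v hv
    change z₁ v = (-(ε * A) * ε * τ v / r v + B) * τ₁ v
    rw [← hA v hv, ← hB v hv]
    field_simp
    linear_combination (z v * τ₁ v - z₁ v * τ v) * τ v * hε2

/-- First integrals of the equation of ruled surfaces for `x = (p(v) + u t(v), y(v), u)`. -/
lemma first_integrals_vertical {c d : ℝ} {t t₁ t₂ p₁ p₂ y₁ y₂ : ℝ → ℝ} (hcd : c < d)
    (ht : ∀ v ∈ Ioo c d, HasDerivAt t (t₁ v) v) (ht₁ : ∀ v ∈ Ioo c d, HasDerivAt t₁ (t₂ v) v)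
    (hy₁ : ∀ v ∈ Ioo c d, HasDerivAt y₁ (y₂ v) v) (hp₁ : ∀ v ∈ Ioo c d, HasDerivAt p₁ (p₂ v) v)
    (h1 : ∀ v ∈ Ioo c d, t₁ v ≠ 0) (h2 : ∀ v ∈ Ioo c d, y₁ v ≠ 0)
    (h3 : ∀ v ∈ Ioo c d, t v ^ 2 < 1)
    (e0 : ∀ v ∈ Ioo c d, t v * ((t v ^ 2 - 1) * (p₁ v * y₂ v - y₁ v * p₂ v)
      + 2 * t v * p₁ v * t₁ v * y₁ v) = 0)
    (e1 : ∀ v ∈ Ioo c d, t₁ v ^ 2 * y₁ v + t v * ((t v ^ 2 - 1) * (t₁ v * y₂ v - y₁ v * t₂ v)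
      + 2 * t v * t₁ v ^ 2 * y₁ v) = 0) :
    ∃ C A : ℝ, C ≠ 0 ∧ ∀ v ∈ Ioo c d,
      y₁ v * √(1 - t v ^ 2) ^ 3 = C * (t v * t₁ v) ∧ p₁ v * √(1 - t v ^ 2) = A * (t v * t₁ v) := by
  -- At t = 0 the linear coefficient is t₁²y₁ ≠ 0: vertical rulings are never twisted. This permits
  -- dividing by t.
  have h0 : ∀ v ∈ Ioo c d, t v ≠ 0 := fun v hv h => by
    have := e1 v hv
    rw [h, zero_mul, add_zero] at this
    exact mul_ne_zero (pow_ne_zero 2 (h1 v hv)) (h2 v hv) this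
  set r : ℝ → ℝ := fun v => √(1 - t v ^ 2) with hr
  have hpos : ∀ v ∈ Ioo c d, 0 < 1 - t v ^ 2 := fun v hv => by linarith [h3 v hv]
  have hr0 : ∀ v ∈ Ioo c d, 0 < r v := fun v hv => Real.sqrt_pos.2 (hpos v hv)
  have hr2 : ∀ v ∈ Ioo c d, r v ^ 2 = 1 - t v ^ 2 := fun v hv => Real.sq_sqrt (hpos v hv).le
  have hdr : ∀ v ∈ Ioo c d, HasDerivAt r (-t v * t₁ v / r v) v := fun v hv => by
    have := (((ht v hv).pow 2).const_sub 1).sqrt (hpos v hv).ne'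
    refine this.congr_deriv ?_
    have := hr0 v hv
    simp only [hr] at this ⊢
    simp only [Pi.pow_apply]
    field_simp
    simp
    ring
  have e1' : ∀ v ∈ Ioo c d, t v * r v ^ 2 * (t₁ v * y₂ v - y₁ v * t₂ v)
      = t₁ v ^ 2 * y₁ v * (1 + 2 * t v ^ 2) := fun v hv => by
    rw [hr2 v hv]; linear_combination -e1 v hv
  have e0' : ∀ v ∈ Ioo c d, r v ^ 2 * (p₂ v * y₁ v - y₂ v * p₁ v)
      + 2 * t v * p₁ v * t₁ v * y₁ v = 0 := fun v hv => by
    rw [hr2 v hv]; linear_combination (mul_eq_zero.1 (e0 v hv)).resolve_left (h0 v hv)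
  have e2 : ∀ v ∈ Ioo c d, t v * r v ^ 2 * (t₁ v * p₂ v - p₁ v * t₂ v) = p₁ v * t₁ v ^ 2 := by
    intro v hv
    refine mul_left_cancel₀ (h2 v hv) ?_
    linear_combination t v * t₁ v * e0' v hv + p₁ v * e1' v hv
  obtain ⟨C, hC⟩ := exists_const_of_hasDerivAt_zero (c := c) (d := d)
    (f := fun v => y₁ v * r v ^ 3 / (t v * t₁ v)) (fun v hv => by
      have := ((hy₁ v hv).mul ((hdr v hv).pow 3)).div ((ht v hv).mul (ht₁ v hv))
        (mul_ne_zero (h0 v hv) (h1 v hv))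
      refine this.congr_deriv ?_
      have a0 := hr0 v hv
      have a1 := h0 v hv
      have a2 := h1 v hv
      simp only [Pi.pow_apply, Pi.mul_apply]
      push_cast
      field_simp
      linear_combination r v * (e1' v hv - y₁ v * t₁ v ^ 2 * hr2 v hv))
  obtain ⟨A, hA⟩ := exists_const_of_hasDerivAt_zero (c := c) (d := d)
    (f := fun v => p₁ v * r v / (t v * t₁ v)) (fun v hv => by
      have := ((hp₁ v hv).mul (hdr v hv)).div ((ht v hv).mul (ht₁ v hv))
        (mul_ne_zero (h0 v hv) (h1 v hv))
      refine this.congr_deriv ?_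
      have a0 := hr0 v hv
      have a1 := h0 v hv
      have a2 := h1 v hv
      simp only [Pi.mul_apply]
      field_simp
      linear_combination e2 v hv - p₁ v * t₁ v ^ 2 * hr2 v hv)
  have hC' : ∀ v ∈ Ioo c d, y₁ v * r v ^ 3 = C * (t v * t₁ v) := fun v hv => by
    have := hC v hv
    rwa [div_eq_iff (mul_ne_zero (h0 v hv) (h1 v hv))] at this
  refine ⟨C, A, ?_, fun v hv => ⟨hC' v hv, ?_⟩⟩
  · rintro rfl
    obtain ⟨w, hw⟩ := nonempty_Ioo.2 hcd
    have := hC' w hw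
    rw [zero_mul] at this
    exact mul_ne_zero (h2 w hw) (pow_ne_zero 3 (hr0 w hw).ne') this
  · have := hA v hv
    rwa [div_eq_iff (mul_ne_zero (h0 v hv) (h1 v hv))] at this

end

/-! ### Normal forms on twisted intervals and their limits -/

section

namespace RuledData

variable {J : Set ℝ} {α β a b : ℝ → Vec3} {c d : ℝ}

/-- In the chart b = (1, 0, τ), a = (0, y, z) the twist is τ'y' up to sign, and the two lowest
coefficients of the cubic, divided by y', are the equations of `first_integrals_horizontal`. -/
lemma horizontal_form (h : RuledData J a b) (hcd : c < d) (hI : Ioo c d ⊆ J)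
    (ha0 : ∀ v ∈ J, a v 0 = 0) (hb0 : ∀ v ∈ J, b v 0 = 1) (hb1 : ∀ v ∈ Ioo c d, b v 1 = 0)
    (ht : ∀ v ∈ Ioo c d, twist a b v ≠ 0) :
    ∃ ε C A B y₀ : ℝ, (ε = 1 ∨ ε = -1) ∧ C ≠ 0 ∧ ∀ v ∈ Ioo c d, deriv b v 2 ≠ 0 ∧
      0 < ε * (1 - b v 2 ^ 2) ∧
      deriv a v 1 * √(ε * (1 - b v 2 ^ 2)) ^ 3 = C * deriv b v 2 ∧
      a v 1 = ε * C * b v 2 / √(ε * (1 - b v 2 ^ 2)) + y₀ ∧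
      a v 2 = A * √(ε * (1 - b v 2 ^ 2)) + B * b v 2 ∧
      deriv a v 2 = (-A * ε * b v 2 / √(ε * (1 - b v 2 ^ 2)) + B) * deriv b v 2 := by
  have h' := h.mono isOpen_Ioo hI
  have ha0' : ∀ v ∈ Ioo c d, a v 0 = 0 := fun v hv => ha0 v (hI hv)
  have hb0' : ∀ v ∈ Ioo c d, b v 0 = 1 := fun v hv => hb0 v (hI hv)
  have da := fun v (hv : v ∈ Ioo c d) => h'.deriv_base_const isOpen_Ioo subset_rfl ha0' hv
  have db0 := fun v (hv : v ∈ Ioo c d) => h'.deriv_dir_const isOpen_Ioo subset_rfl hb0' hv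
  have db1 := fun v (hv : v ∈ Ioo c d) => h'.deriv_dir_const isOpen_Ioo subset_rfl hb1 hv
  have da2 := fun v (hv : v ∈ Ioo c d) => h'.deriv2_base_const ha0' hv
  have db02 := fun v (hv : v ∈ Ioo c d) => h'.deriv2_dir_const hb0' hv
  have db12 := fun v (hv : v ∈ Ioo c d) => h'.deriv2_dir_const hb1 hv
  have htw : ∀ v ∈ Ioo c d, deriv b v 2 * deriv a v 1 ≠ 0 := fun v hv h0 => ht v hv (by
    rw [twist, det3, da v hv, db0 v hv, db1 v hv, hb1 v hv, hb0' v hv]; linear_combination h0)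
  have n1 := fun v hv => left_ne_zero_of_mul (htw v hv)
  have n2 := fun v hv => right_ne_zero_of_mul (htw v hv)
  have hc : ∀ v ∈ Ioo c d, _ := fun v hv => defect_coeffs (h'.eq_zero v hv)
  simp only [det3, area, lorentz] at hc
  obtain ⟨ε, C, A, B, y₀, hε, hC, H⟩ := first_integrals_horizontal (τ := fun v => b v 2)
    (τ₁ := fun v => deriv b v 2) (τ₂ := fun v => deriv (deriv b) v 2) (y := fun v => a v 1)
    (y₁ := fun v => deriv a v 1) (y₂ := fun v => deriv (deriv a) v 1) (z := fun v => a v 2)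
    (z₁ := fun v => deriv a v 2) (z₂ := fun v => deriv (deriv a) v 2) hcd
    (fun v hv => hasDerivAt_coord (h'.dir_deriv hv) 2)
    (fun v hv => hasDerivAt_coord (h'.dir_deriv2 hv) 2)
    (fun v hv => hasDerivAt_coord (h'.base_deriv hv) 1)
    (fun v hv => hasDerivAt_coord (h'.base_deriv2 hv) 1)
    (fun v hv => hasDerivAt_coord (h'.base_deriv hv) 2)
    (fun v hv => hasDerivAt_coord (h'.base_deriv2 hv) 2) n1 n2
    (fun v hv => by
      have := (hc v hv).1
      rw [da v hv, db0 v hv, db1 v hv, hb1 v hv, hb0' v hv, da2 v hv] at this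
      refine mul_left_cancel₀ (n2 v hv) ?_
      linear_combination this)
    (fun v hv => by
      have := (hc v hv).2
      rw [da v hv, db0 v hv, db1 v hv, hb1 v hv, hb0' v hv, da2 v hv, db02 v hv, db12 v hv] at this
      refine mul_left_cancel₀ (n2 v hv) ?_
      linear_combination this)
  exact ⟨ε, C, A, B, y₀, hε, hC, fun v hv => ⟨n1 v hv, H v hv⟩⟩

/-- The chart b = (t, 0, 1), a = (p, y, 0) is used for time-like rulings, since it extends smoothly
through a vertical ruling t = 0. The integrals are kept in derivative form so that they can be
compared there. -/
lemma vertical_form (h : RuledData J a b) (hcd : c < d) (hI : Ioo c d ⊆ J)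
    (ha2 : ∀ v ∈ J, a v 2 = 0) (hb2 : ∀ v ∈ J, b v 2 = 1) (hb1 : ∀ v ∈ Ioo c d, b v 1 = 0)
    (hb0 : ∀ v ∈ Ioo c d, b v 0 ^ 2 < 1) (ht : ∀ v ∈ Ioo c d, twist a b v ≠ 0) :
    ∃ C A : ℝ, C ≠ 0 ∧ ∀ v ∈ Ioo c d, twist a b v = -deriv b v 0 * deriv a v 1 ∧
      deriv b v 0 ≠ 0 ∧
      deriv a v 1 * √(1 - b v 0 ^ 2) ^ 3 = C * (b v 0 * deriv b v 0) ∧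
      deriv a v 0 * √(1 - b v 0 ^ 2) = A * (b v 0 * deriv b v 0) := by
  have h' := h.mono isOpen_Ioo hI
  have ha2' : ∀ v ∈ Ioo c d, a v 2 = 0 := fun v hv => ha2 v (hI hv)
  have hb2' : ∀ v ∈ Ioo c d, b v 2 = 1 := fun v hv => hb2 v (hI hv)
  have da := fun v (hv : v ∈ Ioo c d) => h'.deriv_base_const isOpen_Ioo subset_rfl ha2' hv
  have db2 := fun v (hv : v ∈ Ioo c d) => h'.deriv_dir_const isOpen_Ioo subset_rfl hb2' hv
  have db1 := fun v (hv : v ∈ Ioo c d) => h'.deriv_dir_const isOpen_Ioo subset_rfl hb1 hv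
  have da2 := fun v (hv : v ∈ Ioo c d) => h'.deriv2_base_const ha2' hv
  have db22 := fun v (hv : v ∈ Ioo c d) => h'.deriv2_dir_const hb2' hv
  have db12 := fun v (hv : v ∈ Ioo c d) => h'.deriv2_dir_const hb1 hv
  have htw' : ∀ v ∈ Ioo c d, twist a b v = -deriv b v 0 * deriv a v 1 := fun v hv => by
    rw [twist, det3, da v hv, db2 v hv, db1 v hv, hb1 v hv, hb2' v hv]; ring
  have htw : ∀ v ∈ Ioo c d, deriv b v 0 * deriv a v 1 ≠ 0 := fun v hv h0 => ht v hv (by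
    rw [htw' v hv]; linear_combination -h0)
  have n1 := fun v hv => left_ne_zero_of_mul (htw v hv)
  have n2 := fun v hv => right_ne_zero_of_mul (htw v hv)
  have hc : ∀ v ∈ Ioo c d, _ := fun v hv => defect_coeffs (h'.eq_zero v hv)
  simp only [det3, area, lorentz] at hc
  obtain ⟨C, A, hC, H⟩ := first_integrals_vertical (t := fun v => b v 0)
    (t₁ := fun v => deriv b v 0) (t₂ := fun v => deriv (deriv b) v 0)
    (y₁ := fun v => deriv a v 1) (y₂ := fun v => deriv (deriv a) v 1)
    (p₁ := fun v => deriv a v 0) (p₂ := fun v => deriv (deriv a) v 0) hcd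
    (fun v hv => hasDerivAt_coord (h'.dir_deriv hv) 0)
    (fun v hv => hasDerivAt_coord (h'.dir_deriv2 hv) 0)
    (fun v hv => hasDerivAt_coord (h'.base_deriv2 hv) 1)
    (fun v hv => hasDerivAt_coord (h'.base_deriv2 hv) 0) n1 n2 hb0
    (fun v hv => by
      have := (hc v hv).1
      rw [da v hv, db2 v hv, db1 v hv, hb1 v hv, hb2' v hv, da2 v hv, ha2' v hv] at this
      refine mul_left_cancel₀ (n2 v hv) ?_
      linear_combination this)
    (fun v hv => by
      have := (hc v hv).2
      rw [da v hv, db2 v hv, db1 v hv, hb1 v hv, hb2' v hv, da2 v hv, db22 v hv, db12 v hv] at this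
      refine mul_left_cancel₀ (n2 v hv) ?_
      linear_combination this)
  exact ⟨C, A, hC, fun v hv => ⟨htw' v hv, n1 v hv, H v hv⟩⟩

/-- The set of rulings with turning tangent plane is closed among those which are not
vertical. -/
lemma twist_ne_zero_of_mem_Icc (h : RuledData J α β) (hcd : c < d) (hI : Ioo c d ⊆ J)
    (ht : ∀ v ∈ Ioo c d, twist α β v ≠ 0) {v : ℝ} (hv : v ∈ Icc c d) (hvJ : v ∈ J)
    (hβ : β v 0 ^ 2 + β v 1 ^ 2 ≠ 0) : twist α β v ≠ 0 := by
  obtain ⟨m, n, hmn, hrot⟩ := h.exists_rot_dir_eq_zero hI ht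
  obtain ⟨h1, htw⟩ := h.rotate hmn
  have ht1 := fun w hw => (htw w (hI hw)).symm ▸ ht w hw
  have hβ' : rot m n (β v) 0 ^ 2 + rot m n (β v) 1 ^ 2 ≠ 0 := by
    have : rot m n (β v) 0 ^ 2 + rot m n (β v) 1 ^ 2 = β v 0 ^ 2 + β v 1 ^ 2 := by
      simp only [rot_zero, rot_one]; linear_combination (β v 0 ^ 2 + β v 1 ^ 2) * hmn
    rwa [this]
  rw [← htw v hvJ]
  set α' := fun v => rot m n (α v)
  set β' := fun v => rot m n (β v)
  have hv1 : β' v 1 = 0 := eq_of_eqOn_Ioo hcd hv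
    (hasDerivAt_coord (h1.dir_deriv hvJ) 1).continuousAt continuousAt_const hrot
  have hv0 : β' v 0 ≠ 0 := fun h0 => hβ' (by
    change β' v 0 ^ 2 + β' v 1 ^ 2 = 0; rw [h0, hv1]; norm_num)
  set J' := {w ∈ J | β' w 0 ≠ 0}
  have hJ'o : IsOpen J' := h1.isOpen_dir_ne 0
  have hI' : Ioo c d ⊆ J' := fun w hw => ⟨hI hw, fun h0 =>
    h1.dir_horizontal_ne (hI hw) (ht1 w hw) (by
      rw [h0, show β' w 1 = 0 from hrot w hw]; norm_num)⟩
  have hvJ' : v ∈ J' := ⟨hvJ, hv0⟩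
  obtain ⟨h2, htw2⟩ := (h1.mono hJ'o (fun w hw => hw.1)).slide_scale 0 (fun w hw => hw.2)
  have ha0 : ∀ w ∈ J', slide 0 α' β' w 0 = 0 := fun w hw => slide_self hw.2
  have hb0 : ∀ w ∈ J', scale 0 β' w 0 = 1 := fun w hw => scale_self hw.2
  have hb1 : ∀ w, β' w 1 = 0 → scale 0 β' w 1 = 0 := fun w hw => by simp [scale, hw]
  rw [htw2 v hvJ']
  refine mul_ne_zero (pow_ne_zero 2 hv0) ?_
  have ht2 : ∀ w ∈ Ioo c d, twist (slide 0 α' β') (scale 0 β') w ≠ 0 := fun w hw h0 =>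
    ht1 w hw (by rw [htw2 w (hI' hw), h0, mul_zero])
  set a := slide 0 α' β'
  set b := scale 0 β'
  obtain ⟨ε, C, A, B, y₀, hε, hC, H⟩ := h2.horizontal_form hcd hI' ha0 hb0
    (fun w hw => hb1 w (hrot w hw)) ht2
  have ca := fun i => (hasDerivAt_coord (h2.base_deriv hvJ') i).continuousAt
  have cb := fun i => (hasDerivAt_coord (h2.dir_deriv hvJ') i).continuousAt
  have ca1 := fun i => (hasDerivAt_coord (h2.base_deriv2 hvJ') i).continuousAt
  have cb1 := fun i => (hasDerivAt_coord (h2.dir_deriv2 hvJ') i).continuousAt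
  have cr : ContinuousAt (fun w => √(ε * (1 - b w 2 ^ 2))) v :=
    (continuousAt_const.mul (continuousAt_const.sub ((cb 2).pow 2))).sqrt
  -- The first integrals, cleared of denominators, pass to the end point by continuity.
  have s0 : √(ε * (1 - b v 2 ^ 2)) ^ 2 = ε * (1 - b v 2 ^ 2) :=
    eq_of_eqOn_Ioo hcd hv (cr.pow 2) (continuousAt_const.mul
      (continuousAt_const.sub ((cb 2).pow 2))) (fun w hw => Real.sq_sqrt (H w hw).2.1.le)
  have s1 : deriv a v 1 * √(ε * (1 - b v 2 ^ 2)) ^ 3 = C * deriv b v 2 :=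
    eq_of_eqOn_Ioo hcd hv ((ca1 1).mul (cr.pow 3)) (continuousAt_const.mul (cb1 2))
      (fun w hw => (H w hw).2.2.1)
  have s2 : a v 1 * √(ε * (1 - b v 2 ^ 2))
      = ε * C * b v 2 + y₀ * √(ε * (1 - b v 2 ^ 2)) :=
    eq_of_eqOn_Ioo hcd hv ((ca 1).mul cr)
      ((continuousAt_const.mul (cb 2)).add (continuousAt_const.mul cr)) (fun w hw => by
        have hr0 := Real.sqrt_pos.2 (H w hw).2.1
        change a w 1 * _ = _
        rw [(H w hw).2.2.2.1]; field_simp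
        simp only [Pi.add_apply, Pi.mul_apply]; ring)
  have s3 : deriv a v 2 * √(ε * (1 - b v 2 ^ 2))
      = (-A * ε * b v 2 + B * √(ε * (1 - b v 2 ^ 2))) * deriv b v 2 :=
    eq_of_eqOn_Ioo hcd hv ((ca1 2).mul cr)
      (((continuousAt_const.mul (cb 2)).add (continuousAt_const.mul cr)).mul (cb1 2))
      (fun w hw => by
        have hr0 := Real.sqrt_pos.2 (H w hw).2.1
        change deriv a w 2 * _ = _
        rw [(H w hw).2.2.2.2.2]; field_simp
        simp only [Pi.add_apply, Pi.mul_apply]; ring)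
  have hb1v : deriv b v 1 = 0 := eq_of_eqOn_Ioo hcd hv (cb1 1) continuousAt_const (fun w hw =>
    h2.deriv_dir_const isOpen_Ioo hI' (fun t ht => hb1 t (hrot t ht)) hw)
  have ha0v : deriv a v 0 = 0 := h2.deriv_base_const hJ'o subset_rfl ha0 hvJ'
  have hb0v : deriv b v 0 = 0 := h2.deriv_dir_const hJ'o subset_rfl hb0 hvJ'
  have hε0 : ε ≠ 0 := by rcases hε with rfl | rfl <;> norm_num
  -- At a null limit τ² = 1 the integral for y would become εCτ = 0, but y stays finite and C ≠ 0.
  have hr0 : √(ε * (1 - b v 2 ^ 2)) ≠ 0 := by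
    intro h0
    rw [h0] at s0 s2
    have : b v 2 ≠ 0 := by
      intro h3; rw [h3] at s0
      apply hε0; linarith
    have h3 : ε * C * b v 2 = 0 := by linarith
    exact mul_ne_zero (mul_ne_zero hε0 hC) this h3
  -- If τ' vanished in the limit, so would y' and z'; then a' = b' = 0 and the surface would be
  -- singular along the ruling.
  have hτ : deriv b v 2 ≠ 0 := by
    intro h0
    rw [h0, mul_zero] at s1 s3
    have e1 : deriv a v 1 = 0 := (mul_eq_zero.1 s1).resolve_right (pow_ne_zero 3 hr0)
    have e2 : deriv a v 2 = 0 := (mul_eq_zero.1 s3).resolve_right hr0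
    obtain ⟨u, -, hg⟩ := h2.regular v hvJ'
    simp [gram, lorentz, e1, e2, h0, hb1v, ha0v, hb0v] at hg
  have hy : deriv a v 1 ≠ 0 := fun h0 => by
    rw [h0, zero_mul] at s1
    exact mul_ne_zero hC hτ s1.symm
  rw [twist, det3, hb1v, ha0v, hb0v, hb0 v hvJ', hb1 v hv1]
  intro h0
  exact mul_ne_zero hτ hy (by linear_combination h0)

/-- At a vertical limit of rulings with turning tangent plane, the base curve in the plane at
infinity is singular. -/
lemma deriv_base_eq_zero_of_mem_Icc (h : RuledData J a b) (hcd : c < d) (hI : Ioo c d ⊆ J)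
    (ha2 : ∀ v ∈ J, a v 2 = 0) (hb2 : ∀ v ∈ J, b v 2 = 1)
    (hb : ∀ v ∈ J, b v 0 ^ 2 + b v 1 ^ 2 < 1)
    (ht : ∀ v ∈ Ioo c d, twist a b v ≠ 0) {v : ℝ} (hv : v ∈ Icc c d) (hvJ : v ∈ J)
    (hβ : b v 0 ^ 2 + b v 1 ^ 2 = 0) : deriv a v = 0 := by
  obtain ⟨m, n, hmn, hrot⟩ := h.exists_rot_dir_eq_zero hI ht
  obtain ⟨h1, htw⟩ := h.rotate hmn
  have ht1 := fun w hw => (htw w (hI hw)).symm ▸ ht w hw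
  have hnorm : ∀ w, rot m n (b w) 0 ^ 2 + rot m n (b w) 1 ^ 2 = b w 0 ^ 2 + b w 1 ^ 2 := by
    intro w
    simp only [rot_zero, rot_one]; linear_combination (b w 0 ^ 2 + b w 1 ^ 2) * hmn
  have hder : deriv (fun v => rot m n (a v)) v = rot m n (deriv a v) :=
    (hasDerivAt_rot m n (h.base_deriv hvJ)).deriv
  obtain ⟨C, A, hC, H⟩ := h1.vertical_form hcd hI ha2 hb2 hrot (fun w hw => by
    have := hb w (hI hw)
    rw [← hnorm, hrot w hw] at this
    linarith) ht1
  have hv0 : rot m n (b v) 0 = 0 := by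
    have := hnorm v
    rw [hβ] at this
    nlinarith [sq_nonneg (rot m n (b v) 0), sq_nonneg (rot m n (b v) 1)]
  have cb := fun i => (hasDerivAt_coord (h1.dir_deriv hvJ) i).continuousAt
  have ca1 := fun i => (hasDerivAt_coord (h1.base_deriv2 hvJ) i).continuousAt
  have cb1 := fun i => (hasDerivAt_coord (h1.dir_deriv2 hvJ) i).continuousAt
  have cr : ContinuousAt (fun w => √(1 - rot m n (b w) 0 ^ 2)) v :=
    (continuousAt_const.sub ((cb 0).pow 2)).sqrt
  have s1 : deriv (fun v => rot m n (a v)) v 1 * √(1 - rot m n (b v) 0 ^ 2) ^ 3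
      = C * (rot m n (b v) 0 * deriv (fun v => rot m n (b v)) v 0) :=
    eq_of_eqOn_Ioo hcd hv ((ca1 1).mul (cr.pow 3))
      (continuousAt_const.mul ((cb 0).mul (cb1 0))) (fun w hw => (H w hw).2.2.1)
  have s2 : deriv (fun v => rot m n (a v)) v 0 * √(1 - rot m n (b v) 0 ^ 2)
      = A * (rot m n (b v) 0 * deriv (fun v => rot m n (b v)) v 0) :=
    eq_of_eqOn_Ioo hcd hv ((ca1 0).mul cr)
      (continuousAt_const.mul ((cb 0).mul (cb1 0))) (fun w hw => (H w hw).2.2.2)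
  -- At a vertical limit t = 0, so both right-hand sides vanish and the square roots are 1.
  rw [hv0, hder] at s1 s2
  norm_num at s1 s2
  have e2 : deriv a v 2 = 0 := h.deriv_base_const h.isOpen subset_rfl ha2 hvJ
  funext i
  fin_cases i
  · change deriv a v 0 = 0
    linear_combination m * s2 + n * s1 - deriv a v 0 * hmn
  · change deriv a v 1 = 0
    linear_combination m * s1 - n * s2 - deriv a v 1 * hmn
  · exact e2

end RuledData

end

/-! ### Passage through a vertical ruling -/

section

/-- Near `v₀`, the surface `a(v) + u b(v)` with `b = (b₀, b₁, 1)` is a rotated copy of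
`(A √(1 - t²) + p₀ + u t, C / √(1 - t²) + y₀, u)`, with `t` a regular function of `v`. -/
def HasVerticalForm (J : Set ℝ) (a b : ℝ → Vec3) (v₀ : ℝ) : Prop :=
  ∃ c d m n C A y₀ p₀ : ℝ, v₀ ∈ Ioo c d ∧ Ioo c d ⊆ J ∧ m ^ 2 + n ^ 2 = 1 ∧ C ≠ 0 ∧
    ∀ v ∈ Ioo c d, rot m n (b v) 1 = 0 ∧ rot m n (b v) 0 ^ 2 < 1 ∧ rot m n (deriv b v) 0 ≠ 0 ∧
      rot m n (a v) 1 = C / √(1 - rot m n (b v) 0 ^ 2) + y₀ ∧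
      rot m n (a v) 0 = A * √(1 - rot m n (b v) 0 ^ 2) + p₀

lemma exists_Ioo_subset {s : Set ℝ} (hs : IsOpen s) {v : ℝ} (hv : v ∈ s) :
    ∃ c d, v ∈ Ioo c d ∧ Ioo c d ⊆ s :=
  mem_nhds_iff_exists_Ioo_subset.1 (hs.mem_nhds hv)

/-- Both integrands are exact: with r = √(1 − t²) one has r' = −tt'/r, so that tt'/r³ = (1/r)' and
tt'/r = −r'. -/
lemma integrate_vertical_form {c d C A : ℝ} {t t₁ p p₁ y y₁ : ℝ → ℝ}
    (ht : ∀ v ∈ Ioo c d, HasDerivAt t (t₁ v) v) (hp : ∀ v ∈ Ioo c d, HasDerivAt p (p₁ v) v)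
    (hy : ∀ v ∈ Ioo c d, HasDerivAt y (y₁ v) v) (h : ∀ v ∈ Ioo c d, t v ^ 2 < 1)
    (h1 : ∀ v ∈ Ioo c d, y₁ v * √(1 - t v ^ 2) ^ 3 = C * (t v * t₁ v))
    (h2 : ∀ v ∈ Ioo c d, p₁ v * √(1 - t v ^ 2) = A * (t v * t₁ v)) :
    ∃ y₀ p₀, ∀ v ∈ Ioo c d, y v = C / √(1 - t v ^ 2) + y₀ ∧ p v = -A * √(1 - t v ^ 2) + p₀ := by
  set r : ℝ → ℝ := fun v => √(1 - t v ^ 2) with hr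
  have hpos : ∀ v ∈ Ioo c d, 0 < 1 - t v ^ 2 := fun v hv => by linarith [h v hv]
  have hr0 : ∀ v ∈ Ioo c d, 0 < r v := fun v hv => Real.sqrt_pos.2 (hpos v hv)
  have hdr : ∀ v ∈ Ioo c d, HasDerivAt r (-t v * t₁ v / r v) v := fun v hv => by
    have := (((ht v hv).pow 2).const_sub 1).sqrt (hpos v hv).ne'
    refine this.congr_deriv ?_
    have := hr0 v hv
    simp only [hr] at this ⊢
    simp only [Pi.pow_apply]
    field_simp
    simp
    ring
  obtain ⟨y₀, hy₀⟩ := exists_const_of_hasDerivAt_zero (c := c) (d := d)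
    (f := fun v => y v - C / r v) (fun v hv => by
      have := (hy v hv).sub ((hasDerivAt_const v C).div (hdr v hv) (hr0 v hv).ne')
      refine this.congr_deriv ?_
      have a1 := hr0 v hv
      field_simp
      linear_combination h1 v hv)
  obtain ⟨p₀, hp₀⟩ := exists_const_of_hasDerivAt_zero (c := c) (d := d)
    (f := fun v => p v + A * r v) (fun v hv => by
      have := (hp v hv).add ((hdr v hv).const_mul A)
      refine this.congr_deriv ?_
      have a1 := hr0 v hv
      field_simp
      linear_combination h2 v hv)
  exact ⟨y₀, p₀, fun v hv => ⟨by linarith [hy₀ v hv], by linarith [hp₀ v hv]⟩⟩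

namespace RuledData

variable {J : Set ℝ} {α β a b : ℝ → Vec3} {c d : ℝ}

lemma differentiableAt_twist (h : RuledData J α β) {v : ℝ} (hv : v ∈ J) :
    DifferentiableAt ℝ (twist α β) v := by
  have h1 := fun i => (hasDerivAt_coord (h.dir_deriv hv) i).differentiableAt
  have h2 := fun i => (hasDerivAt_coord (h.dir_deriv2 hv) i).differentiableAt
  have h3 := fun i => (hasDerivAt_coord (h.base_deriv2 hv) i).differentiableAt
  have a0 := h1 0
  have a1 := h1 1
  have a2 := h1 2
  have b0 := h2 0
  have b1 := h2 1
  have b2 := h2 2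
  have c0 := h3 0
  have c1 := h3 1
  have c2 := h3 2
  unfold twist det3
  fun_prop

lemma hasVerticalForm_of_twist_ne_zero (h : RuledData J a b)
    (ha2 : ∀ v ∈ J, a v 2 = 0) (hb2 : ∀ v ∈ J, b v 2 = 1)
    (hb : ∀ v ∈ J, b v 0 ^ 2 + b v 1 ^ 2 < 1) {v₀ : ℝ} (hv : v₀ ∈ J) (ht : twist a b v₀ ≠ 0) :
    HasVerticalForm J a b v₀ := by
  obtain ⟨c, d, hv₀, hI⟩ := exists_Ioo_subset h.isOpen_twist_ne ⟨hv, ht⟩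
  have hIJ : Ioo c d ⊆ J := fun w hw => (hI hw).1
  obtain ⟨m, n, hmn, hrot⟩ := h.exists_rot_dir_eq_zero hIJ (fun w hw => (hI hw).2)
  obtain ⟨h1, htw⟩ := h.rotate hmn
  have ht1 := fun w hw => (htw w (hIJ hw)).symm ▸ (hI hw).2
  have hlt : ∀ w ∈ Ioo c d, rot m n (b w) 0 ^ 2 < 1 := fun w hw => by
    have hnorm : rot m n (b w) 0 ^ 2 + rot m n (b w) 1 ^ 2 = b w 0 ^ 2 + b w 1 ^ 2 := by
      simp only [rot_zero, rot_one]; linear_combination (b w 0 ^ 2 + b w 1 ^ 2) * hmn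
    have := hb w (hIJ hw)
    rw [← hnorm, hrot w hw] at this
    linarith
  obtain ⟨C, A, hC, H⟩ := h1.vertical_form (hv₀.1.trans hv₀.2) hIJ ha2 hb2 hrot hlt ht1
  obtain ⟨y₀, p₀, H2⟩ := integrate_vertical_form (t := fun v => rot m n (b v) 0)
    (p := fun v => rot m n (a v) 0) (y := fun v => rot m n (a v) 1)
    (fun v hv => hasDerivAt_coord (h1.dir_deriv (hIJ hv)) 0)
    (fun v hv => hasDerivAt_coord (h1.base_deriv (hIJ hv)) 0)
    (fun v hv => hasDerivAt_coord (h1.base_deriv (hIJ hv)) 1) hlt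
    (fun v hv => (H v hv).2.2.1) (fun v hv => (H v hv).2.2.2)
  refine ⟨c, d, m, n, C, -A, y₀, p₀, hv₀, hIJ, hmn, hC, fun v hv => ⟨hrot v hv, hlt v hv, ?_, H2 v hv⟩⟩
  have := (H v hv).2.1
  rwa [(hasDerivAt_rot m n (h.dir_deriv (hIJ hv))).deriv] at this

/-- One side of a vertical ruling: if the tangent plane turns along the rulings there, then
these are parallel to a fixed plane, and the surface has a normal form. -/
lemma vertical_side (h : RuledData J a b)
    (ha2 : ∀ v ∈ J, a v 2 = 0) (hb2 : ∀ v ∈ J, b v 2 = 1)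
    (hb : ∀ v ∈ J, b v 0 ^ 2 + b v 1 ^ 2 < 1) {v₀ : ℝ} (hv : v₀ ∈ J) (hb00 : b v₀ 0 = 0)
    (hd0 : deriv b v₀ 0 ≠ 0) (hd1 : deriv b v₀ 1 = 0)
    (hcd : c < d) (hI : Ioo c d ⊆ J) (hvI : v₀ ∈ Icc c d) (hne : ∀ w ∈ Ioo c d, b w 0 ≠ 0)
    (ht : ∃ w ∈ Ioo c d, twist a b w ≠ 0) :
    deriv (twist a b) v₀ ≠ 0 ∧ ∃ C A : ℝ, C ≠ 0 ∧ deriv (deriv a) v₀ 1 = C * deriv b v₀ 0 ^ 2 ∧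
      deriv (deriv a) v₀ 0 = A * deriv b v₀ 0 ^ 2 ∧ deriv a v₀ 0 = 0 ∧ deriv a v₀ 1 = 0 ∧
      ∀ v ∈ Ioo c d, b v 1 = 0 ∧
        deriv a v 1 * √(1 - b v 0 ^ 2) ^ 3 = C * (b v 0 * deriv b v 0) ∧
        deriv a v 0 * √(1 - b v 0 ^ 2) = A * (b v 0 * deriv b v 0) := by
  obtain ⟨w, hw, hwt⟩ := ht
  -- No ruling in the open interval is vertical, so the twisted set is relatively closed there as
  -- well as open.
  have hall : ∀ v ∈ Ioo c d, twist a b v ≠ 0 := fun v hv =>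
    (Ioo_subset_of_closed_under_endpoints h.isOpen_twist_ne ⟨w, hw, hI hw, hwt⟩
      (fun l r hlr hlr1 hlr2 v hv hv' => ⟨hI hv', h.twist_ne_zero_of_mem_Icc hlr
        (hlr2.trans hI) (fun t ht => (hlr1 ht).2) hv (hI hv') (by
          have := hne v hv'
          positivity)⟩) hv).2
  obtain ⟨m, n, hmn, hrot⟩ := h.exists_rot_dir_eq_zero hI hall
  have db := hasDerivAt_coord (h.dir_deriv hv)
  have db' := hasDerivAt_coord (h.dir_deriv2 hv)
  have da' := hasDerivAt_coord (h.base_deriv2 hv)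
  -- Differentiating the fixed direction of the rulings at v₀, where b' points along the first axis,
  -- identifies that direction.
  have hn : n = 0 := by
    have := deriv_eq_of_eqOn_Ioo hcd hvI (((db 0).mul_const n).add ((db 1).mul_const m))
      (hasDerivAt_const v₀ (0 : ℝ)) hrot
    rw [hd1, zero_mul, add_zero] at this
    exact (mul_eq_zero.1 this).resolve_left hd0
  have hm : m ≠ 0 := by rintro rfl; rw [hn] at hmn; norm_num at hmn
  have hb1 : ∀ v ∈ Ioo c d, b v 1 = 0 := fun v hv => by
    have := hrot v hv
    rw [rot_one, hn, mul_zero, zero_add] at this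
    exact (mul_eq_zero.1 this).resolve_right hm
  obtain ⟨C, A, hC, H⟩ := h.vertical_form hcd hI ha2 hb2 hb1 (fun w hw => by
    have := hb w (hI hw)
    rw [hb1 w hw] at this
    linarith) hall
  have dq : HasDerivAt (fun v => √(1 - b v 0 ^ 2)) 0 v₀ := by
    have := (((db 0).pow 2).const_sub 1).sqrt (by simp [hb00])
    refine this.congr_deriv ?_
    simp [hb00]
  have q0 : √(1 - b v₀ 0 ^ 2) = 1 := by simp [hb00]
  have dtt := (db 0).mul (db' 0)
  -- One-sided differentiation of the first integrals at v₀ reads C and A off the second derivative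
  -- of a, so they depend only on the jets at v₀ and not on the side.
  have e1 := deriv_eq_of_eqOn_Ioo hcd hvI ((da' 1).mul (dq.pow 3)) (dtt.const_mul C)
    (fun v hv => (H v hv).2.2.1)
  have e0 := deriv_eq_of_eqOn_Ioo hcd hvI ((da' 0).mul dq) (dtt.const_mul A)
    (fun v hv => (H v hv).2.2.2)
  have z1 : deriv a v₀ 1 * √(1 - b v₀ 0 ^ 2) ^ 3 = C * (b v₀ 0 * deriv b v₀ 0) :=
    eq_of_eqOn_Ioo hcd hvI ((da' 1).mul (dq.pow 3)).continuousAt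
      (dtt.const_mul C).continuousAt (fun v hv => (H v hv).2.2.1)
  have z0 : deriv a v₀ 0 * √(1 - b v₀ 0 ^ 2) = A * (b v₀ 0 * deriv b v₀ 0) :=
    eq_of_eqOn_Ioo hcd hvI ((da' 0).mul dq).continuousAt
      (dtt.const_mul A).continuousAt (fun v hv => (H v hv).2.2.2)
  simp only [Pi.pow_apply, hb00] at e1 e0 z1 z0
  norm_num at e1 e0 z1 z0
  have dt := (h.differentiableAt_twist hv).hasDerivAt
  -- From twist = −t'y', y'(v₀) = 0 and y''(v₀) = Ct'², the derivative of the twist at v₀ is −Ct'³.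
  have et := deriv_eq_of_eqOn_Ioo hcd hvI dt ((db' 0).neg.mul (da' 1)) (fun v hv => (H v hv).1)
  refine ⟨?_, C, A, hC, ?_, ?_, z0, z1, fun v hv => ⟨hb1 v hv, (H v hv).2.2⟩⟩
  · rw [et, z1, e1]
    simp only [Pi.neg_apply]
    intro h0
    have : C * deriv b v₀ 0 ^ 3 = 0 := by linear_combination -h0
    exact mul_ne_zero hC (pow_ne_zero 3 hd0) this
  · rw [e1]; ring
  · rw [e0]; ring

/-- A vertical ruling which is a limit of rulings with turning tangent plane. -/
lemma hasVerticalForm_of_vertical (h : RuledData J a b)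
    (ha2 : ∀ v ∈ J, a v 2 = 0) (hb2 : ∀ v ∈ J, b v 2 = 1)
    (hb : ∀ v ∈ J, b v 0 ^ 2 + b v 1 ^ 2 < 1) {v₀ : ℝ} (hv : v₀ ∈ J) (hb00 : b v₀ 0 = 0)
    (hb01 : b v₀ 1 = 0) (hcl : v₀ ∈ closure {v ∈ J | twist a b v ≠ 0}) :
    HasVerticalForm J a b v₀ := by
  have hbv : b v₀ 0 ^ 2 + b v₀ 1 ^ 2 = 0 := by rw [hb00, hb01]; norm_num
  have htv : twist a b v₀ = 0 := by
    by_contra h0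
    exact h.dir_horizontal_ne hv h0 hbv
  have hdb2 : deriv b v₀ 2 = 0 := h.deriv_dir_const h.isOpen subset_rfl hb2 hv
  -- the direction is regular
  have hdb : deriv b v₀ ≠ 0 := by
    intro hd
    have hda : deriv a v₀ ≠ 0 := by
      intro h0
      obtain ⟨u, -, hg⟩ := h.regular v₀ hv
      simp [gram, lorentz, h0, hd] at hg
    have hopen : IsOpen (J ∩ deriv a ⁻¹' {0}ᶜ) :=
      (smoothOn_deriv h.smooth_base h.isOpen).continuousOn.isOpen_inter_preimage h.isOpen
        isOpen_compl_singleton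
    obtain ⟨c, d, hcd, hI⟩ := exists_Ioo_subset hopen ⟨hv, hda⟩
    have hIJ : Ioo c d ⊆ J := fun w hw => (hI hw).1
    -- Since a' ≠ 0 nearby, `deriv_base_eq_zero_of_mem_Icc` excludes vertical end points of twisted
    -- intervals. The twisted set is then closed near v₀ and contains v₀, against `htv`.
    have := Ioo_subset_of_closed_under_endpoints h.isOpen_twist_ne
      (mem_closure_iff.1 hcl (Ioo c d) isOpen_Ioo hcd)
      (fun l r hlr hlr1 hlr2 v hv hv' => by
        refine ⟨hIJ hv', ?_⟩
        by_cases hβ : b v 0 ^ 2 + b v 1 ^ 2 = 0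
        · exact absurd (h.deriv_base_eq_zero_of_mem_Icc hlr (hlr2.trans hIJ) ha2 hb2 hb
            (fun t ht => (hlr1 ht).2) hv (hIJ hv') hβ) (hI hv').2
        · exact h.twist_ne_zero_of_mem_Icc hlr (hlr2.trans hIJ) (fun t ht => (hlr1 ht).2) hv
            (hIJ hv') hβ)
    exact (this hcd).2 htv
  set ρ := √(deriv b v₀ 0 ^ 2 + deriv b v₀ 1 ^ 2) with hρ
  have hpos : 0 < deriv b v₀ 0 ^ 2 + deriv b v₀ 1 ^ 2 := by
    refine lt_of_le_of_ne (by positivity) (fun h0 => hdb ?_)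
    funext i
    fin_cases i
    · change deriv b v₀ 0 = 0
      nlinarith [sq_nonneg (deriv b v₀ 0), sq_nonneg (deriv b v₀ 1)]
    · change deriv b v₀ 1 = 0
      nlinarith [sq_nonneg (deriv b v₀ 0), sq_nonneg (deriv b v₀ 1)]
    · exact hdb2
  have hρ0 : 0 < ρ := Real.sqrt_pos.2 hpos
  have hρ2 : ρ ^ 2 = deriv b v₀ 0 ^ 2 + deriv b v₀ 1 ^ 2 := Real.sq_sqrt hpos.le
  -- The rotation that takes b'(v₀) to the positive first axis.
  set m := deriv b v₀ 0 / ρ with hm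
  set n := -deriv b v₀ 1 / ρ with hn
  have hmn : m ^ 2 + n ^ 2 = 1 := by
    rw [hm, hn]; field_simp; linarith
  obtain ⟨h1, htw⟩ := h.rotate hmn
  have hdr := fun w (hw : w ∈ J) => (hasDerivAt_rot m n (h.dir_deriv hw)).deriv
  have hdρ : rot m n (deriv b v₀) 0 = ρ := by
    rw [rot_zero, hm, hn]; field_simp; linarith
  have hd1 : rot m n (deriv b v₀) 1 = 0 := by
    rw [rot_one, hm, hn]; field_simp; ring
  set a' := fun v => rot m n (a v) with ha'
  set b' := fun v => rot m n (b v) with hb'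
  have hnorm : ∀ w ∈ J, b' w 0 ^ 2 + b' w 1 ^ 2 < 1 := fun w hw => by
    have : b' w 0 ^ 2 + b' w 1 ^ 2 = b w 0 ^ 2 + b w 1 ^ 2 := by
      simp only [hb', rot_zero, rot_one]; linear_combination (b w 0 ^ 2 + b w 1 ^ 2) * hmn
    rw [this]; exact hb w hw
  have hopen : IsOpen (J ∩ (fun v => deriv b' v 0) ⁻¹' Ioi 0) :=
    ((contDiffOn_pi.1 (smoothOn_deriv h1.smooth_dir h.isOpen) 0).continuousOn).isOpen_inter_preimage
      h.isOpen isOpen_Ioi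
  obtain ⟨c, d, hcd, hI⟩ := exists_Ioo_subset hopen ⟨hv, by
    change 0 < deriv b' v₀ 0
    rw [hdr v₀ hv, hdρ]; exact hρ0⟩
  have hIJ : Ioo c d ⊆ J := fun w hw => (hI hw).1
  -- Monotonicity of the first coordinate isolates v₀: the neighbouring rulings are not vertical.
  have hmono : StrictMonoOn (fun v => b' v 0) (Ioo c d) := by
    refine strictMonoOn_of_deriv_pos (convex_Ioo c d)
      ((h1.coord_dir 0).continuousOn.mono hIJ) (fun w hw => ?_)
    rw [interior_Ioo] at hw
    rw [(hasDerivAt_coord (h1.dir_deriv (hIJ hw)) 0).deriv]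
    exact (hI hw).2
  have hb'0 : b' v₀ 0 = 0 := by simp [hb', hb00, hb01]
  have hb'1 : b' v₀ 1 = 0 := by simp [hb', hb00, hb01]
  have hne : ∀ w ∈ Ioo c d, w ≠ v₀ → b' w 0 ≠ 0 := fun w hw hwv h0 =>
    hwv (hmono.injOn hw hcd (by rw [h0, hb'0]))
  have hd0' : deriv b' v₀ 0 ≠ 0 := by rw [hdr v₀ hv, hdρ]; exact hρ0.ne'
  have hd1' : deriv b' v₀ 1 = 0 := by rw [hdr v₀ hv, hd1]
  have hR : Ioo v₀ d ⊆ Ioo c d := Ioo_subset_Ioo_left hcd.1.le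
  have hL : Ioo c v₀ ⊆ Ioo c d := Ioo_subset_Ioo_right hcd.2.le
  have sideR := h1.vertical_side ha2 hb2 hnorm hv hb'0 hd0' hd1' hcd.2 (hR.trans hIJ)
    ⟨le_rfl, hcd.2.le⟩ (fun w hw => hne w (hR hw) hw.1.ne')
  have sideL := h1.vertical_side ha2 hb2 hnorm hv hb'0 hd0' hd1' hcd.1 (hL.trans hIJ)
    ⟨hcd.1.le, le_rfl⟩ (fun w hw => hne w (hL hw) hw.2.ne)
  have dt := (h1.differentiableAt_twist hv).hasDerivAt
  have some : (∃ w ∈ Ioo v₀ d, twist a' b' w ≠ 0) ∨ ∃ w ∈ Ioo c v₀, twist a' b' w ≠ 0 := by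
    obtain ⟨w, hw, hwJ, hwt⟩ := mem_closure_iff.1 hcl (Ioo c d) isOpen_Ioo hcd
    rw [← htw w hwJ] at hwt
    rcases lt_trichotomy w v₀ with h0 | h0 | h0
    · exact Or.inr ⟨w, ⟨hw.1, h0⟩, hwt⟩
    · rw [h0, htw v₀ hv] at hwt; exact absurd htv hwt
    · exact Or.inl ⟨w, ⟨h0, hw.2⟩, hwt⟩
  -- Twist on one side gives a non-zero derivative of the twist at v₀; were the twist identically
  -- zero on the other side, this derivative would vanish.
  have hboth : (∃ w ∈ Ioo v₀ d, twist a' b' w ≠ 0) ∧ ∃ w ∈ Ioo c v₀, twist a' b' w ≠ 0 := by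
    have hdt : deriv (twist a' b') v₀ ≠ 0 := some.elim (fun h0 => (sideR h0).1)
      (fun h0 => (sideL h0).1)
    constructor
    · by_contra hcon
      push Not at hcon
      exact hdt (deriv_eq_of_eqOn_Ioo hcd.2 ⟨le_rfl, hcd.2.le⟩ dt
        (hasDerivAt_const v₀ (0 : ℝ)) hcon)
    · by_contra hcon
      push Not at hcon
      exact hdt (deriv_eq_of_eqOn_Ioo hcd.1 ⟨hcd.1.le, le_rfl⟩ dt
        (hasDerivAt_const v₀ (0 : ℝ)) hcon)
  obtain ⟨-, C, A, hC, c1, a1, z0, z1, HR⟩ := sideR hboth.1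
  obtain ⟨-, C', A', -, c2, a2, -, -, HL⟩ := sideL hboth.2
  -- The constants of the two sides agree because both are determined by a''(v₀) and b'(v₀).
  have hCC : C' = C := mul_right_cancel₀ (pow_ne_zero 2 hd0') (c2.symm.trans c1)
  have hAA : A' = A := mul_right_cancel₀ (pow_ne_zero 2 hd0') (a2.symm.trans a1)
  rw [hCC, hAA] at HL
  have H : ∀ v ∈ Ioo c d, b' v 1 = 0 ∧
      deriv a' v 1 * √(1 - b' v 0 ^ 2) ^ 3 = C * (b' v 0 * deriv b' v 0) ∧
      deriv a' v 0 * √(1 - b' v 0 ^ 2) = A * (b' v 0 * deriv b' v 0) := by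
    intro v hv'
    rcases lt_trichotomy v v₀ with h0 | h0 | h0
    · exact HL v ⟨hv'.1, h0⟩
    · rw [h0]; refine ⟨hb'1, ?_, ?_⟩
      · rw [z1, hb'0]; ring
      · rw [z0, hb'0]; ring
    · exact HR v ⟨h0, hv'.2⟩
  have hlt : ∀ v ∈ Ioo c d, b' v 0 ^ 2 < 1 := fun v hv => by
    have := hnorm v (hIJ hv)
    rw [(H v hv).1] at this
    linarith
  obtain ⟨y₀, p₀, H2⟩ := integrate_vertical_form (t := fun v => b' v 0)
    (p := fun v => a' v 0) (y := fun v => a' v 1)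
    (fun v hv => hasDerivAt_coord (h1.dir_deriv (hIJ hv)) 0)
    (fun v hv => hasDerivAt_coord (h1.base_deriv (hIJ hv)) 0)
    (fun v hv => hasDerivAt_coord (h1.base_deriv (hIJ hv)) 1)
    hlt (fun v hv => (H v hv).2.1) (fun v hv => (H v hv).2.2)
  refine ⟨c, d, m, n, C, -A, y₀, p₀, hcd, hIJ, hmn, hC,
    fun v hv' => ⟨(H v hv').1, hlt v hv', ?_, H2 v hv'⟩⟩
  rw [← hdr v (hIJ hv')]
  exact (hI hv').2.ne'

end RuledData

end

/-! ### Identification with types 3 to 6 -/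

section

lemma exists_angle {m n : ℝ} (h : m ^ 2 + n ^ 2 = 1) : ∃ θ, Real.cos θ = m ∧ Real.sin θ = n := by
  have hnorm : ‖(⟨m, n⟩ : ℂ)‖ = 1 := by
    rw [← sq_eq_sq₀ (norm_nonneg _) zero_le_one, Complex.sq_norm, Complex.normSq_mk]
    linarith
  have h0 : (⟨m, n⟩ : ℂ) ≠ 0 := norm_ne_zero_iff.1 (by rw [hnorm]; norm_num)
  exact ⟨Complex.arg ⟨m, n⟩, by rw [Complex.cos_arg h0, hnorm, div_one],
    by rw [Complex.sin_arg, hnorm, div_one]⟩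

lemma isom_eq_rot {θ m n : ℝ} (hm : Real.cos θ = m) (hn : Real.sin θ = n) (a b : ℝ) (p : Vec3) :
    isom θ a b p = ![rot m n p 0 + a, rot m n p 1 + b, rot m n p 2] := by
  rw [isom, hm, hn]; rfl

lemma injOn_of_hasDerivAt_ne_zero {c d : ℝ} {f f' : ℝ → ℝ}
    (hf : ∀ v ∈ Ioo c d, HasDerivAt f (f' v) v) (h0 : ∀ v ∈ Ioo c d, f' v ≠ 0) :
    InjOn f (Ioo c d) := by
  have key : ∀ a ∈ Ioo c d, ∀ b ∈ Ioo c d, a < b → f a ≠ f b := by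
    intro a ha b hb hab h
    obtain ⟨t, ht, ht'⟩ := exists_hasDerivAt_eq_zero hab
      (fun w hw => (hf w ⟨ha.1.trans_le hw.1, hw.2.trans_lt hb.2⟩).continuousAt.continuousWithinAt)
      h (fun w hw => hf w ⟨ha.1.trans hw.1, hw.2.trans hb.2⟩)
    exact h0 t ⟨ha.1.trans ht.1, ht.2.trans hb.2⟩ ht'
  intro a ha b hb h
  rcases lt_trichotomy a b with h1 | h1 | h1
  · exact absurd h (key a ha b hb h1)
  · exact h1
  · exact absurd h.symm (key b hb a ha h1)

/-- The change of parameters with hyperbolic angle `arsinh (t / √(1 - t²))`. -/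
lemma hyperbolic_parameters {D : Set (ℝ × ℝ)} {c d : ℝ} {t f g : ℝ → ℝ}
    (ht : ContDiffOn ℝ ∞ t (Ioo c d)) (hf : ContDiffOn ℝ ∞ f (Ioo c d))
    (hg : ContDiffOn ℝ ∞ g (Ioo c d)) (ht1 : ∀ v ∈ Ioo c d, t v ^ 2 < 1)
    (hinj : InjOn t (Ioo c d)) (hg0 : ∀ v ∈ Ioo c d, g v ≠ 0) (A : ℝ) :
    ∃ φ : ℝ × ℝ → ℝ × ℝ, ContDiffOn ℝ ∞ φ (D ∩ Prod.snd ⁻¹' Ioo c d) ∧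
      InjOn φ (D ∩ Prod.snd ⁻¹' Ioo c d) ∧ ∀ q ∈ D ∩ Prod.snd ⁻¹' Ioo c d,
        0 < √(1 - t q.2 ^ 2) ∧ √(1 - t q.2 ^ 2) ^ 2 = 1 - t q.2 ^ 2 ∧
        Real.sinh (φ q).2 = t q.2 / √(1 - t q.2 ^ 2) ∧
        Real.cosh (φ q).2 = 1 / √(1 - t q.2 ^ 2) ∧
        (φ q).1 = (f q.2 + q.1 * g q.2) * √(1 - t q.2 ^ 2) - A * t q.2 := by
  set U := D ∩ Prod.snd ⁻¹' Ioo c d with hU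
  have hpos : ∀ v ∈ Ioo c d, 0 < 1 - t v ^ 2 := fun v hv => by linarith [ht1 v hv]
  have hr0 : ∀ v ∈ Ioo c d, 0 < √(1 - t v ^ 2) := fun v hv => Real.sqrt_pos.2 (hpos v hv)
  have hr2 : ∀ v ∈ Ioo c d, √(1 - t v ^ 2) ^ 2 = 1 - t v ^ 2 := fun v hv =>
    Real.sq_sqrt (hpos v hv).le
  have hcosh : ∀ v ∈ Ioo c d,
      Real.cosh (Real.arsinh (t v / √(1 - t v ^ 2))) = 1 / √(1 - t v ^ 2) := fun v hv => by
    have h1 := hr0 v hv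
    have h2 := hr2 v hv
    have h3 : 1 + (t v / √(1 - t v ^ 2)) ^ 2 = (1 / √(1 - t v ^ 2)) ^ 2 := by
      field_simp; linarith
    rw [Real.cosh_arsinh, h3, Real.sqrt_sq (by positivity)]
  have hrs : ContDiffOn ℝ ∞ (fun v => √(1 - t v ^ 2)) (Ioo c d) :=
    (contDiffOn_const.sub (ht.pow 2)).sqrt (fun v hv => (hpos v hv).ne')
  have hmaps : MapsTo (Prod.snd : ℝ × ℝ → ℝ) U (Ioo c d) := fun q hq => hq.2
  have comp : ∀ {k : ℝ → ℝ}, ContDiffOn ℝ ∞ k (Ioo c d) →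
      ContDiffOn ℝ ∞ (fun q : ℝ × ℝ => k q.2) U := fun hk =>
    hk.comp contDiff_snd.contDiffOn hmaps
  refine ⟨fun q => ((f q.2 + q.1 * g q.2) * √(1 - t q.2 ^ 2) - A * t q.2,
    Real.arsinh (t q.2 / √(1 - t q.2 ^ 2))), ?_, ?_, fun q hq => ⟨hr0 _ hq.2, hr2 _ hq.2,
      Real.sinh_arsinh _, hcosh _ hq.2, rfl⟩⟩
  · exact ((((comp hf).add (contDiff_fst.contDiffOn.mul (comp hg))).mul (comp hrs)).sub
      (contDiffOn_const.mul (comp ht))).prodMk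
      (comp (ht.div hrs (fun v hv => (hr0 v hv).ne')).arsinh)
  · rintro ⟨u, v⟩ hq ⟨u', v'⟩ hq' heq
    simp only [Prod.mk.injEq] at heq
    obtain ⟨h1, h2⟩ := heq
    have hv : v ∈ Ioo c d := hq.2
    have hv' : v' ∈ Ioo c d := hq'.2
    have e1 : 1 / √(1 - t v ^ 2) = 1 / √(1 - t v' ^ 2) := by
      rw [← hcosh v hv, ← hcosh v' hv', h2]
    have e2 : √(1 - t v ^ 2) = √(1 - t v' ^ 2) := by simpa using e1
    have e3 : t v = t v' := by
      have := Real.arsinh_injective h2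
      rw [e2] at this
      exact (div_left_inj' (hr0 v' hv').ne').1 this
    have e4 : v = v' := hinj hv hv' e3
    subst e4
    have e5 : (u - u') * (g v * √(1 - t v ^ 2)) = 0 := by linear_combination h1
    have e6 : u - u' = 0 :=
      (mul_eq_zero.1 e5).resolve_right (mul_ne_zero (hg0 v hv) (hr0 v hv).ne')
    rw [sub_eq_zero.1 e6]

variable {D : Set (ℝ × ℝ)} {x : ℝ × ℝ → Vec3} {α β : ℝ → Vec3}

/-- With t = tanh w one has 1/√(1 − t²) = cosh w, so the normal form becomes type 6; A is the
constant c₂ there, and A = 0 gives type 5. The new ruling parameter is s√(1 − t²) − At, where s is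
the height of the point. -/
lemma isLocallyListedAt_of_verticalForm {J : Set ℝ} (hD : IsOpen D)
    (hr : ∀ q ∈ D, x q = α q.2 + q.1 • β q.2) (h : RuledData J α β)
    (hβ : ∀ v ∈ J, β v 2 ≠ 0) {q₀ : ℝ × ℝ} (hq₀ : q₀ ∈ D)
    (hf : HasVerticalForm J (slide 2 α β) (scale 2 β) q₀.2) : IsLocallyListedAt D x q₀ := by
  obtain ⟨h2, -⟩ := h.slide_scale 2 hβ
  obtain ⟨c, d, m, n, C, A, y₀, p₀, hv₀, hI, hmn, hC, H⟩ := hf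
  obtain ⟨θ, hm, hn⟩ := exists_angle hmn
  obtain ⟨h3, -⟩ := h2.rotate hmn
  obtain ⟨φ, hφ, hinj, hφ'⟩ := hyperbolic_parameters (D := D)
    (t := fun v => rot m n (scale 2 β v) 0) ((h3.coord_dir 0).mono hI)
    ((h.coord_base 2).mono hI) ((h.coord_dir 2).mono hI) (fun v hv => (H v hv).2.1)
    (injOn_of_hasDerivAt_ne_zero
      (fun v hv => hasDerivAt_coord (hasDerivAt_rot m n (h2.dir_deriv (hI hv))) 0)
      (fun v hv => (H v hv).2.2.1)) (fun v hv => hβ v (hI hv)) A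
  have hU : IsOpen (D ∩ Prod.snd ⁻¹' Ioo c d) := hD.inter (isOpen_Ioo.preimage continuous_snd)
  have main : ∀ q ∈ D ∩ Prod.snd ⁻¹' Ioo c d, isom θ (-p₀) (-y₀) (x q) =
      ![A * Real.cosh (φ q).2 + (φ q).1 * Real.sinh (φ q).2, C * Real.cosh (φ q).2,
        A * Real.sinh (φ q).2 + (φ q).1 * Real.cosh (φ q).2] := by
    intro q hq
    obtain ⟨r0, r2, es, ec, e1⟩ := hφ' q hq
    obtain ⟨b1, -, -, a1, a0⟩ := H q.2 hq.2
    have hx : x q = slide 2 α β q.2 + (α q.2 2 + q.1 * β q.2 2) • scale 2 β q.2 := by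
      rw [hr q hq.1]
      nth_rewrite 1 [slide_add_smul (i := 2) (α := α) (β := β) (v := q.2)]
      nth_rewrite 1 [smul_scale (hβ q.2 (hI hq.2))]
      rw [smul_smul, add_smul, add_assoc]
    have hs0 : rot m n (slide 2 α β q.2) 2 = 0 := slide_self (hβ q.2 (hI hq.2))
    have hs1 : rot m n (scale 2 β q.2) 2 = 1 := scale_self (hβ q.2 (hI hq.2))
    rw [isom_eq_rot hm hn, hx, rot_add_smul, es, ec, e1]
    simp only [Pi.add_apply, Pi.smul_apply, smul_eq_mul]
    rw [hs0, hs1, b1, a1, a0]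
    set t := rot m n (scale 2 β q.2) 0
    set r := √(1 - t ^ 2)
    funext i
    fin_cases i <;> simp
    · field_simp
      linear_combination A * r2
    · field_simp
    · field_simp
      ring
  by_cases hA : A = 0
  · exact ⟨θ, -p₀, -y₀, _, _, _, φ, Listed.five C hC, hU, ⟨hq₀, hv₀⟩, inter_subset_left, hφ, hinj,
      fun _ _ => mem_univ _, fun q hq => by rw [main q hq, hA]; simp⟩
  · exact ⟨θ, -p₀, -y₀, _, _, _, φ, Listed.six C A hC hA, hU, ⟨hq₀, hv₀⟩, inter_subset_left, hφ,
      hinj, fun _ _ => mem_univ _, main⟩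

lemma isLocallyListedAt_of_twist_ne_zero {J : Set ℝ} (hD : IsOpen D)
    (hr : ∀ q ∈ D, x q = α q.2 + q.1 • β q.2) (h : RuledData J α β)
    {q₀ : ℝ × ℝ} (hq₀ : q₀ ∈ D) (hv₀ : q₀.2 ∈ J) (ht : twist α β q₀.2 ≠ 0)
    (hβ : β q₀.2 2 ^ 2 ≤ β q₀.2 0 ^ 2 + β q₀.2 1 ^ 2) : IsLocallyListedAt D x q₀ := by
  obtain ⟨c, d, hcd, hI⟩ := exists_Ioo_subset h.isOpen_twist_ne ⟨hv₀, ht⟩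
  have hlt := hcd.1.trans hcd.2
  have h0 := h.mono isOpen_Ioo (fun w hw => (hI hw).1)
  have ht0 : ∀ v ∈ Ioo c d, twist α β v ≠ 0 := fun w hw => (hI hw).2
  obtain ⟨m, n, hmn, hrot⟩ := h0.exists_rot_dir_eq_zero subset_rfl ht0
  obtain ⟨h1, htw⟩ := h0.rotate hmn
  have hnorm : ∀ w, rot m n (β w) 0 ^ 2 + rot m n (β w) 1 ^ 2 = β w 0 ^ 2 + β w 1 ^ 2 := by
    intro w
    simp only [rot_zero, rot_one]; linear_combination (β w 0 ^ 2 + β w 1 ^ 2) * hmn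
  have hb0 : ∀ v ∈ Ioo c d, rot m n (β v) 0 ≠ 0 := fun v hv hz =>
    h0.dir_horizontal_ne hv (ht0 v hv) (by rw [← hnorm, hz, hrot v hv]; norm_num)
  set α' := fun v => rot m n (α v) with hα'
  set β' := fun v => rot m n (β v) with hβ'
  obtain ⟨h2, htw2⟩ := h1.slide_scale 0 hb0
  have hs1 : ∀ v ∈ Ioo c d, scale 0 β' v 1 = 0 := fun v hv => by
    have : β' v 1 = 0 := hrot v hv
    simp [scale, this]
  obtain ⟨ε, C, A, B, y₀, hε, hC, H⟩ := h2.horizontal_form hlt subset_rfl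
    (fun v hv => slide_self (hb0 v hv)) (fun v hv => scale_self (hb0 v hv)) hs1
    (fun v hv hz => ht0 v hv (by rw [← htw v hv, htw2 v hv, hz, mul_zero]))
  -- The case ε = −1 means time-like rulings, excluded by `hβ`.
  have hε1 : ε = 1 := by
    refine hε.resolve_right (fun hε => ?_)
    have h3 := (H q₀.2 hcd).2.1
    have h4 : scale 0 β' q₀.2 2 ^ 2 * β' q₀.2 0 ^ 2 = β q₀.2 2 ^ 2 := by
      have h5 := hb0 q₀.2 hcd
      have h6 : scale 0 β' q₀.2 2 = (β' q₀.2 0)⁻¹ * β q₀.2 2 := rfl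
      rw [h6]
      change β' q₀.2 0 ≠ 0 at h5
      field_simp
    have h7 := hnorm q₀.2
    rw [hrot q₀.2 hcd] at h7
    rw [hε] at h3
    have h8 : 0 < β' q₀.2 0 ^ 2 := by have := hb0 q₀.2 hcd; positivity
    have h9 : β' q₀.2 0 ^ 2 + 0 ^ 2 = β q₀.2 0 ^ 2 + β q₀.2 1 ^ 2 := h7
    nlinarith
  subst hε1
  simp only [one_mul] at H
  obtain ⟨θ, hm, hn⟩ := exists_angle hmn
  -- The term Bτ in the height is absorbed by shifting the ruling coordinate by B, which is the
  -- translation of the first coordinate used below.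
  obtain ⟨φ, hφ, hinj, hφ'⟩ := hyperbolic_parameters (D := D)
    (t := fun v => scale 0 β' v 2) (h2.coord_dir 2)
    ((h1.coord_base 0).add contDiffOn_const) (h1.coord_dir 0)
    (fun v hv => by linarith [(H v hv).2.1])
    (injOn_of_hasDerivAt_ne_zero (fun v hv => hasDerivAt_coord (h2.dir_deriv hv) 2)
      (fun v hv => (H v hv).1)) hb0 A (f := fun v => α' v 0 + B)
  have hU : IsOpen (D ∩ Prod.snd ⁻¹' Ioo c d) := hD.inter (isOpen_Ioo.preimage continuous_snd)
  have main : ∀ q ∈ D ∩ Prod.snd ⁻¹' Ioo c d, isom θ B (-y₀) (x q) =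
      ![A * Real.sinh (φ q).2 + (φ q).1 * Real.cosh (φ q).2, C * Real.sinh (φ q).2,
        A * Real.cosh (φ q).2 + (φ q).1 * Real.sinh (φ q).2] := by
    intro q hq
    obtain ⟨r0, r2, es, ec, e1⟩ := hφ' q hq
    obtain ⟨-, -, -, a1, a2, -⟩ := H q.2 hq.2
    have hx : rot m n (x q) = slide 0 α' β' q.2 + (α' q.2 0 + q.1 * β' q.2 0) • scale 0 β' q.2 := by
      rw [hr q hq.1, rot_add_smul]
      change α' q.2 + q.1 • β' q.2 = _
      nth_rewrite 1 [slide_add_smul (i := 0) (α := α') (β := β') (v := q.2)]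
      nth_rewrite 1 [smul_scale (i := 0) (β := β') (v := q.2) (hb0 q.2 hq.2)]
      rw [smul_smul, add_smul, add_assoc]
    have hs0 : slide 0 α' β' q.2 0 = 0 := slide_self (hb0 q.2 hq.2)
    have hs1' : scale 0 β' q.2 0 = 1 := scale_self (hb0 q.2 hq.2)
    rw [isom_eq_rot hm hn, hx, es, ec, e1]
    simp only [Pi.add_apply, Pi.smul_apply, smul_eq_mul]
    rw [hs0, hs1', hs1 q.2 hq.2, a1, a2]
    set t := scale 0 β' q.2 2
    set r := √(1 - t ^ 2)
    funext i
    fin_cases i <;> simp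
    · field_simp
      ring
    · field_simp
    · field_simp
      linear_combination A * r2
  by_cases hA : A = 0
  · exact ⟨θ, B, -y₀, _, _, _, φ, Listed.three C hC, hU, ⟨hq₀, hcd⟩, inter_subset_left, hφ, hinj,
      fun _ _ => mem_univ _, fun q hq => by rw [main q hq, hA]; simp⟩
  · exact ⟨θ, B, -y₀, _, _, _, φ, Listed.four C A hC hA, hU, ⟨hq₀, hcd⟩, inter_subset_left, hφ,
      hinj, fun _ _ => mem_univ _, main⟩

/-- Among non-vertical rulings the twisted set is both open and closed. -/
lemma RuledData.twist_ne_zero_of_mem_closure {J : Set ℝ} (h : RuledData J α β) {v : ℝ}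
    (hv : v ∈ J) (hcl : v ∈ closure {v ∈ J | twist α β v ≠ 0})
    (hβ : β v 0 ^ 2 + β v 1 ^ 2 ≠ 0) : twist α β v ≠ 0 := by
  have hopen : IsOpen (J ∩ (fun v => β v 0 ^ 2 + β v 1 ^ 2) ⁻¹' {0}ᶜ) :=
    (((h.coord_dir 0).continuousOn.pow 2).add
      ((h.coord_dir 1).continuousOn.pow 2)).isOpen_inter_preimage h.isOpen isOpen_compl_singleton
  obtain ⟨c, d, hcd, hI⟩ := exists_Ioo_subset hopen ⟨hv, hβ⟩
  exact (Ioo_subset_of_closed_under_endpoints h.isOpen_twist_ne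
    (mem_closure_iff.1 hcl _ isOpen_Ioo hcd) (fun l r hlr hlr1 hlr2 v hv hv' =>
      ⟨(hI hv').1, h.twist_ne_zero_of_mem_Icc hlr (fun t ht => (hlr1 ht).1)
        (fun t ht => (hlr1 ht).2) hv (hI hv').1 (hI hv').2⟩) hcd).2

/-- The classification near a limit of rulings along which the tangent plane turns. -/
theorem isLocallyListedAt_of_mem_closure {J : Set ℝ} (hD : IsOpen D)
    (hr : ∀ q ∈ D, x q = α q.2 + q.1 • β q.2) (h : RuledData J α β)
    {q₀ : ℝ × ℝ} (hq₀ : q₀ ∈ D) (hv₀ : q₀.2 ∈ J)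
    (hcl : q₀.2 ∈ closure {v ∈ J | twist α β v ≠ 0}) : IsLocallyListedAt D x q₀ := by
  -- The horizontal chart serves rulings that are not time-like, the vertical chart time-like ones;
  -- only the latter can be vertical, where the twist may vanish in the limit.
  by_cases hcase : β q₀.2 2 ^ 2 ≤ β q₀.2 0 ^ 2 + β q₀.2 1 ^ 2
  · refine isLocallyListedAt_of_twist_ne_zero hD hr h hq₀ hv₀ ?_ hcase
    have hβ0 : β q₀.2 0 ^ 2 + β q₀.2 1 ^ 2 ≠ 0 := by
      intro h0
      have h1 : β q₀.2 = 0 := by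
        funext i
        fin_cases i
        · change β q₀.2 0 = 0
          nlinarith [sq_nonneg (β q₀.2 0), sq_nonneg (β q₀.2 1)]
        · change β q₀.2 1 = 0
          nlinarith [sq_nonneg (β q₀.2 0), sq_nonneg (β q₀.2 1)]
        · change β q₀.2 2 = 0
          nlinarith [sq_nonneg (β q₀.2 2)]
      obtain ⟨u, -, hg⟩ := h.regular _ hv₀
      simp [gram, lorentz, h1] at hg
    exact h.twist_ne_zero_of_mem_closure hv₀ hcl hβ0
  · push Not at hcase
    set J' := J ∩ (fun v => β v 2 ^ 2 - (β v 0 ^ 2 + β v 1 ^ 2)) ⁻¹' Ioi 0 with hJ'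
    have hopen : IsOpen J' :=
      (((h.coord_dir 2).continuousOn.pow 2).sub (((h.coord_dir 0).continuousOn.pow 2).add
        ((h.coord_dir 1).continuousOn.pow 2))).isOpen_inter_preimage h.isOpen isOpen_Ioi
    have hv' : q₀.2 ∈ J' := ⟨hv₀, by simpa using hcase⟩
    have h' := h.mono hopen inter_subset_left
    have hpos : ∀ v ∈ J', β v 0 ^ 2 + β v 1 ^ 2 < β v 2 ^ 2 := fun v hv => by
      have : 0 < β v 2 ^ 2 - (β v 0 ^ 2 + β v 1 ^ 2) := hv.2
      linarith
    have hβ2 : ∀ v ∈ J', β v 2 ≠ 0 := fun v hv h0 => by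
      have := hpos v hv
      rw [h0] at this
      nlinarith [sq_nonneg (β v 0), sq_nonneg (β v 1)]
    obtain ⟨h2, htw⟩ := h'.slide_scale 2 hβ2
    have hb : ∀ v ∈ J', scale 2 β v 0 ^ 2 + scale 2 β v 1 ^ 2 < 1 := fun v hv => by
      have h3 := hpos v hv
      have h4 := hβ2 v hv
      have e : scale 2 β v 0 ^ 2 + scale 2 β v 1 ^ 2
          = (β v 0 ^ 2 + β v 1 ^ 2) / β v 2 ^ 2 := by
        simp only [scale, Pi.smul_apply, smul_eq_mul]; field_simp
      rw [e, div_lt_one (by positivity)]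
      exact h3
    have ha2 : ∀ v ∈ J', slide 2 α β v 2 = 0 := fun v hv => slide_self (hβ2 v hv)
    have hb2 : ∀ v ∈ J', scale 2 β v 2 = 1 := fun v hv => scale_self (hβ2 v hv)
    refine isLocallyListedAt_of_verticalForm hD hr h' hβ2 hq₀ ?_
    by_cases htv : twist α β q₀.2 = 0
    · have hβ0 : β q₀.2 0 ^ 2 + β q₀.2 1 ^ 2 = 0 := by
        by_contra hβ0
        exact h.twist_ne_zero_of_mem_closure hv₀ hcl hβ0 htv
      have h00 : β q₀.2 0 = 0 := by nlinarith [sq_nonneg (β q₀.2 0), sq_nonneg (β q₀.2 1)]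
      have h01 : β q₀.2 1 = 0 := by nlinarith [sq_nonneg (β q₀.2 0), sq_nonneg (β q₀.2 1)]
      refine h2.hasVerticalForm_of_vertical ha2 hb2 hb hv' (by simp [scale, h00])
        (by simp [scale, h01]) (mem_closure_iff.2 fun o ho hvo => ?_)
      obtain ⟨w, ⟨hwo, hwJ'⟩, hwJ, hwt⟩ := mem_closure_iff.1 hcl (o ∩ J') (ho.inter hopen) ⟨hvo, hv'⟩
      exact ⟨w, hwo, hwJ', fun h0 => hwt (by rw [htw w hwJ', h0, mul_zero])⟩
    · exact h2.hasVerticalForm_of_twist_ne_zero ha2 hb2 hb hv'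
        (fun h0 => htv (by rw [htw _ hv', h0, mul_zero]))

end

/-! ### Surfaces whose tangent planes share a vector -/

lemma exists_equiv_of_injective (L : ℝ × ℝ →L[ℝ] ℝ × ℝ) (h : ∀ ξ, L ξ = 0 → ξ = 0) :
    ∃ e : (ℝ × ℝ) ≃L[ℝ] ℝ × ℝ, (e : ℝ × ℝ →L[ℝ] ℝ × ℝ) = L := by
  have hinj : Function.Injective (L : ℝ × ℝ →ₗ[ℝ] ℝ × ℝ) :=
    (injective_iff_map_eq_zero _).2 h
  refine ⟨(LinearEquiv.ofInjectiveEndo _ hinj).toContinuousLinearEquiv, ?_⟩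
  ext <;> simp

/-- A surface whose tangent planes contain a fixed vector is locally a cylinder. -/
lemma exists_cylinder {D : Set (ℝ × ℝ)} {x : ℝ × ℝ → Vec3} (hx : IsTimelikeSurface D x) {p : Vec3}
    (hp : p 2 = 1) {q₀ : ℝ × ℝ} (hq₀ : q₀ ∈ D)
    (h : ∀ᶠ q in nhds q₀, ∃ ξ, fderiv ℝ x q ξ = p) :
    ∃ (U : Set (ℝ × ℝ)) (c d : ℝ) (α : ℝ → Vec3) (φ : ℝ × ℝ → ℝ × ℝ), IsOpen U ∧ q₀ ∈ U ∧ U ⊆ D ∧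
      ContDiffOn ℝ ∞ α (Ioo c d) ∧ ContDiffOn ℝ ∞ φ U ∧ InjOn φ U ∧
      (∀ q ∈ U, (φ q).2 ∈ Ioo c d ∧ x q = α (φ q).2 + (φ q).1 • p) ∧
      ∀ t ∈ Ioo c d, gram p (deriv α t) < 0 ∧ deriv α t 2 = 0 := by
  have hD := hx.1
  have hxs := hx.2.1
  have hxd : ∀ q ∈ D, HasFDerivAt x (fderiv ℝ x q) q := fun q hq =>
    ((hxs.contDiffAt (hD.mem_nhds hq)).differentiableAt (by simp)).hasFDerivAt
  have hdec : ∀ q, ∀ ξ : ℝ × ℝ, fderiv ℝ x q ξ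
      = ξ.1 • fderiv ℝ x q (1, 0) + ξ.2 • fderiv ℝ x q (0, 1) := fun q ξ => by
    rw [← map_smul, ← map_smul, ← map_add]; simp
  have hgram : ∀ q ∈ D, gram (fderiv ℝ x q (1, 0)) (fderiv ℝ x q (0, 1)) < 0 := fun q hq =>
    gram_partials_neg hx hq
  obtain ⟨ξ₀, hξ₀⟩ := h.self_of_nhds
  -- Jacobian of the pair (x₂, xᵢ). If it vanished for every i, then both partial derivatives would
  -- be horizontal, since they are independent; but they span p, which has last coordinate 1.
  set jac : Fin 3 → ℝ × ℝ → ℝ := fun i q => fderiv ℝ x q (1, 0) 2 * fderiv ℝ x q (0, 1) i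
    - fderiv ℝ x q (0, 1) 2 * fderiv ℝ x q (1, 0) i with hjac
  obtain ⟨i, hi⟩ : ∃ i, jac i q₀ ≠ 0 := by
    by_contra hcon
    push Not at hcon
    have h0 := hcon 0
    have h1 := hcon 1
    have hg := hgram q₀ hq₀
    have h2 := congrFun hξ₀ 2
    rw [hdec, hp] at h2
    simp only [Pi.add_apply, Pi.smul_apply, smul_eq_mul] at h2
    simp only [hjac] at h0 h1
    generalize fderiv ℝ x q₀ (1, 0) = X at *
    generalize fderiv ℝ x q₀ (0, 1) = Y at *
    have e1 : X 2 ^ 2 * gram X Y = 0 := by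
      have : X 2 • Y = Y 2 • X := by
        funext j
        fin_cases j
        · simp; linarith
        · simp; linarith
        · simp; ring
      have h3 : X 2 ^ 2 * gram X Y = gram X (X 2 • Y) := by
        simp only [gram, lorentz, Pi.smul_apply, smul_eq_mul]; ring
      rw [h3, this]
      simp only [gram, lorentz, Pi.smul_apply, smul_eq_mul]; ring
    have e2 : Y 2 ^ 2 * gram X Y = 0 := by
      have : Y 2 • X = X 2 • Y := by
        funext j
        fin_cases j
        · simp; linarith
        · simp; linarith
        · simp; ring
      have h3 : Y 2 ^ 2 * gram X Y = gram (Y 2 • X) Y := by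
        simp only [gram, lorentz, Pi.smul_apply, smul_eq_mul]; ring
      rw [h3, this]
      simp only [gram, lorentz, Pi.smul_apply, smul_eq_mul]; ring
    have z1 : X 2 = 0 := pow_eq_zero_iff two_ne_zero |>.1 ((mul_eq_zero.1 e1).resolve_right hg.ne)
    have z2 : Y 2 = 0 := pow_eq_zero_iff two_ne_zero |>.1 ((mul_eq_zero.1 e2).resolve_right hg.ne)
    rw [z1, z2] at h2
    norm_num at h2
  -- the change of parameters
  set Φ : ℝ × ℝ → ℝ × ℝ := fun q => (x q 2, x q i - p i * x q 2) with hΦ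
  have hΦs : ContDiffOn ℝ ∞ Φ D := (contDiffOn_pi.1 hxs 2).prodMk
    ((contDiffOn_pi.1 hxs i).sub (contDiffOn_const.mul (contDiffOn_pi.1 hxs 2)))
  have hΦd : ∀ q ∈ D, HasFDerivAt Φ (fderiv ℝ Φ q) q := fun q hq =>
    ((hΦs.contDiffAt (hD.mem_nhds hq)).differentiableAt (by simp)).hasFDerivAt
  have hΦe : ∀ q ∈ D, ∀ ξ, fderiv ℝ Φ q ξ
      = (fderiv ℝ x q ξ 2, fderiv ℝ x q ξ i - p i * fderiv ℝ x q ξ 2) := fun q hq ξ => by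
    have hc := hasFDerivAt_pi'.1 (hxd q hq)
    have : HasFDerivAt Φ _ q := (hc 2).prodMk ((hc i).sub ((hc 2).const_mul (p i)))
    rw [this.fderiv]
    simp
  have hker : ∀ q ∈ D, jac i q ≠ 0 → ∀ ξ, fderiv ℝ Φ q ξ = 0 → ξ = 0 := by
    intro q hq hj ξ hξ
    rw [hΦe q hq, hdec, Prod.mk_eq_zero] at hξ
    obtain ⟨k1, k2⟩ := hξ
    rw [k1] at k2
    simp only [Pi.add_apply, Pi.smul_apply, smul_eq_mul] at k1 k2
    have l1 : ξ.1 * jac i q = 0 := by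
      simp only [hjac]; linear_combination fderiv ℝ x q (0, 1) i * k1 - fderiv ℝ x q (0, 1) 2 * k2
    have l2 : ξ.2 * jac i q = 0 := by
      simp only [hjac]; linear_combination -fderiv ℝ x q (1, 0) i * k1 + fderiv ℝ x q (1, 0) 2 * k2
    exact Prod.ext ((mul_eq_zero.1 l1).resolve_right hj) ((mul_eq_zero.1 l2).resolve_right hj)
  have hjc : ContinuousOn (jac i) D := by
    have hc : ∀ ξ, ContinuousOn (fun q => fderiv ℝ x q ξ) D := fun ξ =>
      (hxs.continuousOn_fderiv_of_isOpen hD (by simp)).clm_apply continuousOn_const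
    have c1 := continuousOn_pi.1 (hc (1, 0))
    have c2 := continuousOn_pi.1 (hc (0, 1))
    exact ((c1 2).mul (c2 i)).sub ((c2 2).mul (c1 i))
  obtain ⟨V₁, hV₁, hV₁o, hq₀V₁⟩ := mem_nhds_iff.1 h
  set V := (D ∩ jac i ⁻¹' {0}ᶜ) ∩ V₁ with hV
  have hVo : IsOpen V := (hjc.isOpen_inter_preimage hD isOpen_compl_singleton).inter hV₁o
  have hq₀V : q₀ ∈ V := ⟨⟨hq₀, hi⟩, hq₀V₁⟩
  have hequiv : ∀ q ∈ V, ∃ e : (ℝ × ℝ) ≃L[ℝ] ℝ × ℝ, HasFDerivAt Φ (e : ℝ × ℝ →L[ℝ] ℝ × ℝ) q := by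
    intro q hq
    obtain ⟨e, he⟩ := exists_equiv_of_injective (fderiv ℝ Φ q) (hker q hq.1.1 hq.1.2)
    exact ⟨e, he ▸ hΦd q hq.1.1⟩
  obtain ⟨e₀, he₀⟩ := hequiv q₀ hq₀V
  have hat : ContDiffAt ℝ ∞ Φ q₀ := hΦs.contDiffAt (hD.mem_nhds hq₀)
  set F := hat.toOpenPartialHomeomorph Φ he₀ (by simp) with hF
  have hFΦ : (F : ℝ × ℝ → ℝ × ℝ) = Φ := hat.toOpenPartialHomeomorph_coe he₀ (by simp)
  have hq₀F : q₀ ∈ F.source := hat.mem_toOpenPartialHomeomorph_source he₀ (by simp)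
  have hW : IsOpen (F.target ∩ F.symm ⁻¹' V) := F.isOpen_inter_preimage_symm hVo
  have hmem : F q₀ ∈ F.target ∩ F.symm ⁻¹' V :=
    ⟨F.map_source hq₀F, by rw [mem_preimage, F.left_inv hq₀F]; exact hq₀V⟩
  obtain ⟨S₁, S₂, hS₁, hS₂, hm₁, hm₂, hS⟩ := isOpen_prod_iff.1 hW (F q₀).1 (F q₀).2 hmem
  obtain ⟨a, b, hab, hI₁⟩ := exists_Ioo_subset hS₁ hm₁
  obtain ⟨c, d, hcd, hI₂⟩ := exists_Ioo_subset hS₂ hm₂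
  have hbox : ∀ s ∈ Ioo a b, ∀ t ∈ Ioo c d, (s, t) ∈ F.target ∧ F.symm (s, t) ∈ V :=
    fun s hs t ht => hS ⟨hI₁ hs, hI₂ ht⟩
  set s₀ := (F q₀).1
  have hψ : ∀ s ∈ Ioo a b, ∀ t ∈ Ioo c d, ContDiffAt ℝ ∞ F.symm (s, t) := fun s hs t ht => by
    obtain ⟨e, he⟩ := hequiv _ (hbox s hs t ht).2
    exact F.contDiffAt_symm (hbox s hs t ht).1 (by rw [hFΦ]; exact he)
      (by rw [hFΦ]; exact hΦs.contDiffAt (hD.mem_nhds (hbox s hs t ht).2.1.1))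
  have hψd : ∀ s ∈ Ioo a b, ∀ t ∈ Ioo c d, HasFDerivAt F.symm (fderiv ℝ F.symm (s, t)) (s, t) :=
    fun s hs t ht => ((hψ s hs t ht).differentiableAt (by simp)).hasFDerivAt
  have hcomp : ∀ s ∈ Ioo a b, ∀ t ∈ Ioo c d, ∀ ξ,
      fderiv ℝ Φ (F.symm (s, t)) (fderiv ℝ F.symm (s, t) ξ) = ξ := fun s hs t ht ξ => by
    have h1 := (hΦd _ (hbox s hs t ht).2.1.1).comp (s, t) (hψd s hs t ht)
    have h2 : HasFDerivAt (Φ ∘ F.symm) (ContinuousLinearMap.id ℝ (ℝ × ℝ)) (s, t) := by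
      refine (hasFDerivAt_id (𝕜 := ℝ) (s, t)).congr_of_eventuallyEq ?_
      filter_upwards [F.open_target.mem_nhds (hbox s hs t ht).1] with r hr
      rw [Function.comp_apply, ← hFΦ, F.right_inv hr]; rfl
    have := congrArg (fun L : ℝ × ℝ →L[ℝ] ℝ × ℝ => L ξ) (h1.unique h2)
    simpa using this
  -- The coordinates (x₂, xᵢ − pᵢx₂) are chosen so that p maps to (1, 0): moving along p raises the
  -- height at unit speed and fixes the second coordinate.
  have hX1 : ∀ s ∈ Ioo a b, ∀ t ∈ Ioo c d,
      fderiv ℝ x (F.symm (s, t)) (fderiv ℝ F.symm (s, t) (1, 0)) = p := fun s hs t ht => by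
    have hv := (hbox s hs t ht).2
    obtain ⟨ξ, hξ⟩ := hV₁ hv.2
    have h1 : fderiv ℝ Φ (F.symm (s, t)) ξ = (1, 0) := by
      rw [hΦe _ hv.1.1, hξ, hp]; simp
    have h2 : fderiv ℝ F.symm (s, t) (1, 0) - ξ = 0 := hker _ hv.1.1 hv.1.2 _ (by
      rw [map_sub, h1, hcomp s hs t ht, sub_self])
    rw [sub_eq_zero.1 h2, hξ]
  have hXd : ∀ s ∈ Ioo a b, ∀ t ∈ Ioo c d, HasFDerivAt (x ∘ F.symm)
      ((fderiv ℝ x (F.symm (s, t))).comp (fderiv ℝ F.symm (s, t))) (s, t) := fun s hs t ht =>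
    (hxd _ (hbox s hs t ht).2.1.1).comp (s, t) (hψd s hs t ht)
  set α : ℝ → Vec3 := fun t => x (F.symm (s₀, t)) - s₀ • p with hα
  have hXs : ∀ s ∈ Ioo a b, ∀ t ∈ Ioo c d, x (F.symm (s, t)) = α t + s • p := by
    intro s hs t ht
    have hder : ∀ r ∈ Ioo a b, HasDerivAt (fun r => x (F.symm (r, t)) - r • p) 0 r := by
      intro r hr
      have h1 : HasDerivAt (fun r : ℝ => (r, t)) ((1 : ℝ), (0 : ℝ)) r :=
        (hasDerivAt_id r).prodMk (hasDerivAt_const r t)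
      have h2 := ((hXd r hr t ht).comp_hasDerivAt r h1).sub ((hasDerivAt_id r).smul_const p)
      refine h2.congr_deriv ?_
      rw [ContinuousLinearMap.comp_apply, hX1 r hr t ht, one_smul, sub_self]
    have := isOpen_Ioo.is_const_of_deriv_eq_zero isPreconnected_Ioo
      (fun r hr => (hder r hr).differentiableAt.differentiableWithinAt)
      (fun r hr => (hder r hr).deriv) hs hab
    rw [hα]
    simp only at this ⊢
    rw [← this]; abel
  have hαs : ContDiffOn ℝ ∞ α (Ioo c d) := fun t ht => by
    have h1 : ContDiffAt ℝ ∞ (fun t : ℝ => (s₀, t)) t := contDiffAt_const.prodMk contDiffAt_id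
    have h2 : ContDiffAt ℝ ∞ x (F.symm (s₀, t)) :=
      hxs.contDiffAt (hD.mem_nhds (hbox s₀ hab t ht).2.1.1)
    exact ((h2.comp t ((hψ s₀ hab t ht).comp t h1)).sub contDiffAt_const).contDiffWithinAt
  have hαd : ∀ t ∈ Ioo c d, deriv α t
      = fderiv ℝ x (F.symm (s₀, t)) (fderiv ℝ F.symm (s₀, t) (0, 1)) := fun t ht => by
    have h1 : HasDerivAt (fun r : ℝ => (s₀, r)) ((0 : ℝ), (1 : ℝ)) t :=
      (hasDerivAt_const t s₀).prodMk (hasDerivAt_id t)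
    have h2 := ((hXd s₀ hab t ht).comp_hasDerivAt t h1).sub_const (s₀ • p)
    exact h2.deriv
  refine ⟨F.source ∩ F ⁻¹' (Ioo a b ×ˢ Ioo c d), c, d, α, Φ,
    F.isOpen_inter_preimage (isOpen_Ioo.prod isOpen_Ioo), ⟨hq₀F, hab, hcd⟩, ?_, hαs, ?_, ?_, ?_, ?_⟩
  · rintro q ⟨hq, hq1, hq2⟩
    have := (hbox _ hq1 _ hq2).2.1.1
    rwa [Prod.mk.eta, F.left_inv hq] at this
  · refine hΦs.mono ?_
    rintro q ⟨hq, hq1, hq2⟩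
    have := (hbox _ hq1 _ hq2).2.1.1
    rwa [Prod.mk.eta, F.left_inv hq] at this
  · rw [← hFΦ]; exact F.injOn.mono inter_subset_left
  · rintro q ⟨hq, hq1, hq2⟩
    have := hXs _ hq1 _ hq2
    rw [Prod.mk.eta, F.left_inv hq] at this
    rw [← hFΦ]
    exact ⟨hq2, this⟩
  · intro t ht
    have hv := (hbox s₀ hab t ht).2
    have c1 := hcomp s₀ hab t ht (1, 0)
    have c2 := hcomp s₀ hab t ht (0, 1)
    have hp1 := hX1 s₀ hab t ht
    have hg := hgram _ hv.1.1
    rw [hαd t ht]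
    rw [hΦe _ hv.1.1, Prod.mk.injEq] at c1 c2
    refine ⟨?_, c2.1⟩
    set ξ := fderiv ℝ F.symm (s₀, t) (1, 0)
    set ζ := fderiv ℝ F.symm (s₀, t) (0, 1)
    rw [← hp1]
    -- The inverse change of parameters has non-zero Jacobian, so the Gram determinant keeps its
    -- sign.
    have hdet : ξ.1 * ζ.2 - ξ.2 * ζ.1 ≠ 0 := by
      intro h0
      obtain ⟨a1, a2⟩ := c1
      obtain ⟨b1, b2⟩ := c2
      rw [a1] at a2
      rw [b1] at b2
      rw [hdec] at a1 a2 b1 b2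
      simp only [Pi.add_apply, Pi.smul_apply, smul_eq_mul] at a1 a2 b1 b2
      set X := fderiv ℝ x (F.symm (s₀, t)) (1, 0)
      set Y := fderiv ℝ x (F.symm (s₀, t)) (0, 1)
      have : (ξ.1 * ζ.2 - ξ.2 * ζ.1) * (X 2 * Y i - Y 2 * X i) = 1 := by
        linear_combination (ζ.1 * X i + ζ.2 * Y i) * a1 + b2
          - (ζ.1 * X 2 + ζ.2 * Y 2) * a2 - p i * b1
      rw [h0, zero_mul] at this
      exact zero_ne_one this
    rw [hdec _ ξ, hdec _ ζ]
    generalize fderiv ℝ x (F.symm (s₀, t)) (1, 0) = X at *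
    generalize fderiv ℝ x (F.symm (s₀, t)) (0, 1) = Y at *
    have : gram (ξ.1 • X + ξ.2 • Y) (ζ.1 • X + ζ.2 • Y)
        = (ξ.1 * ζ.2 - ξ.2 * ζ.1) ^ 2 * gram X Y := by
      simp only [gram, lorentz, Pi.add_apply, Pi.smul_apply, smul_eq_mul]; ring
    rw [this]
    exact mul_neg_of_pos_of_neg (by positivity) hg

/-- For vertical p the profile curve is horizontal and the Gram determinant is −⟨α', α'⟩. For null p
it is −⟨p, α'⟩², and a rotation takes p to (1, 0, 1). -/
lemma isLocallyListedAt_of_tangent {D : Set (ℝ × ℝ)} {x : ℝ × ℝ → Vec3}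
    (hx : IsTimelikeSurface D x) {p : Vec3} (hp2 : p 2 = 1)
    (hp : (p 0 = 0 ∧ p 1 = 0) ∨ p 0 ^ 2 + p 1 ^ 2 = 1) {q₀ : ℝ × ℝ} (hq₀ : q₀ ∈ D)
    (h : ∀ᶠ q in nhds q₀, ∃ ξ, fderiv ℝ x q ξ = p) : IsLocallyListedAt D x q₀ := by
  obtain ⟨U, c, d, α, φ, hU, hqU, hUD, hα, hφ, hinj, hform, hreg⟩ := exists_cylinder hx hp2 hq₀ h
  have hmaps : MapsTo φ U (univ ×ˢ Ioo c d) := fun q hq => ⟨mem_univ _, (hform q hq).1⟩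
  rcases hp with ⟨h0, h1⟩ | hp
  · have hpe : p = ![0, 0, 1] := by
      funext i; fin_cases i <;> simp [h0, h1, hp2]
    refine ⟨0, 0, 0, _, _, U, φ, Listed.cylinder (Ioo c d) α isOpen_Ioo ordConnected_Ioo hα ?_,
      hU, hqU, hUD, hφ, hinj, hmaps, fun q hq => ?_⟩
    · intro v hv
      obtain ⟨g, g2⟩ := hreg v hv
      rw [hpe] at g
      simp [gram, lorentz, g2] at g
      simp only [lorentz, g2]
      linarith
    · rw [← hpe, ← (hform q hq).2]
      funext i; fin_cases i <;> simp [isom]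
  · have hmn : p 0 ^ 2 + (-p 1) ^ 2 = 1 := by linarith
    obtain ⟨θ, hm, hn⟩ := exists_angle hmn
    have hrp : rot (p 0) (-p 1) p = ![1, 0, 1] := by
      funext i; fin_cases i
      · simp; linarith
      · simp; ring
      · simp [hp2]
    refine ⟨θ, 0, 0, _, _, U, φ, Listed.flaherty (Ioo c d) (fun v => rot (p 0) (-p 1) (α v))
      isOpen_Ioo ordConnected_Ioo (contDiffOn_rot _ _ hα) ?_, hU, hqU, hUD, hφ, hinj, hmaps,
      fun q hq => ?_⟩
    · intro v hv h0
      rw [(hasDerivAt_rot _ _ (hasDerivAt_of_smoothOn hα isOpen_Ioo hv)).deriv, ← hrp,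
        lorentz_rot hmn, lorentz_comm] at h0
      have g := (hreg v hv).1
      have hpp : lorentz p p = 0 := by rw [lorentz, hp2]; linarith
      rw [gram, h0, hpp] at g
      norm_num at g
    · rw [isom_eq_rot hm hn, ← hrp, ← rot_add_smul, ← (hform q hq).2]
      funext i; fin_cases i <;> simp

/-! ### Untwisted rulings -/

/-- A family of tangent planes that is constant along rulings, the normal `η` being stationary
unless the ruling is null or the plane is vertical, locally contains a fixed vertical or null
vector. -/
lemma exists_common_direction {J : Set ℝ} {η β : ℝ → Vec3} (hJ : IsOpen J)
    (hη : ContDiffOn ℝ ∞ η J) (hβ : ContDiffOn ℝ ∞ β J)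
    (hunit : ∀ v ∈ J, lorentz (η v) (η v) = 1) (horth : ∀ v ∈ J, lorentz (η v) (β v) = 0)
    (horth' : ∀ v ∈ J, lorentz (deriv η v) (β v) = 0) (hβ0 : ∀ v ∈ J, β v ≠ 0)
    (hG : ∀ v ∈ J, deriv η v ≠ 0 → lorentz (β v) (β v) = 0 ∨ η v 2 = 0) {v₀ : ℝ} (hv₀ : v₀ ∈ J) :
    ∃ p : Vec3, p 2 = 1 ∧ ((p 0 = 0 ∧ p 1 = 0) ∨ p 0 ^ 2 + p 1 ^ 2 = 1) ∧
      ∀ᶠ v in nhds v₀, lorentz (η v) p = 0 := by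
  have dη := fun v (hv : v ∈ J) => hasDerivAt_of_smoothOn hη hJ hv
  have hunit' : ∀ v ∈ J, lorentz (η v) (deriv η v) = 0 := fun v hv => by
    have h1 := (hasDerivAt_lorentz (dη v hv) (dη v hv)).unique
      ((hasDerivAt_const v (1 : ℝ)).congr_of_eventuallyEq
        (by filter_upwards [hJ.mem_nhds hv] with t ht using hunit t ht))
    rw [lorentz_comm (deriv η v)] at h1
    linarith
  have hGo : IsOpen (J ∩ deriv η ⁻¹' {0}ᶜ) :=
    (smoothOn_deriv hη hJ).continuousOn.isOpen_inter_preimage hJ isOpen_compl_singleton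
  have hcβ := fun i => (contDiffOn_pi.1 hβ i).continuousOn
  have hcη := fun i => (contDiffOn_pi.1 hη i).continuousOn
  have hR : ∀ v ∈ J, η v 0 ^ 2 + η v 1 ^ 2 = 1 + η v 2 ^ 2 := fun v hv => by
    have := hunit v hv
    rw [lorentz] at this; linarith
  have hR0 : ∀ v ∈ J, η v 0 ^ 2 + η v 1 ^ 2 ≠ 0 := fun v hv => by rw [hR v hv]; positivity
  -- null directions orthogonal to `η`
  set P : ℝ → ℝ → Vec3 := fun ε v => ![(η v 2 * η v 0 - ε * η v 1) / (η v 0 ^ 2 + η v 1 ^ 2),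
    (η v 2 * η v 1 + ε * η v 0) / (η v 0 ^ 2 + η v 1 ^ 2), 1] with hP
  have hPη : ∀ ε, ∀ v ∈ J, lorentz (η v) (P ε v) = 0 := fun ε v hv => by
    have := hR0 v hv
    simp only [lorentz, hP, Matrix.cons_val_zero, Matrix.cons_val_one, Matrix.cons_val]
    field_simp
    ring
  have hPn : ∀ ε, ε ^ 2 = 1 → ∀ v ∈ J, P ε v 0 ^ 2 + P ε v 1 ^ 2 = 1 := fun ε hε v hv => by
    have h0 := hR0 v hv
    have h1 := hR v hv
    simp only [hP, Matrix.cons_val_zero, Matrix.cons_val_one]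
    field_simp
    linear_combination (η v 0 ^ 2 + η v 1 ^ 2) * (hε - h1)
  -- A time-like plane contains two null directions P ε, one for each sign. If η' is orthogonal to P
  -- ε, then P ε' is orthogonal to η; its horizontal part is also orthogonal to that of P ε, which
  -- lies on the unit circle. These two conditions are independent, so P ε is constant.
  have finish : ∀ ε, ε ^ 2 = 1 → ∀ c d, v₀ ∈ Ioo c d → Ioo c d ⊆ J →
      (∀ v ∈ Ioo c d, lorentz (deriv η v) (P ε v) = 0) →
      ∃ p : Vec3, p 2 = 1 ∧ ((p 0 = 0 ∧ p 1 = 0) ∨ p 0 ^ 2 + p 1 ^ 2 = 1) ∧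
        ∀ᶠ v in nhds v₀, lorentz (η v) p = 0 := by
    intro ε hε c d hcd hI hort
    refine ⟨P ε v₀, rfl, Or.inr (hPn ε hε v₀ hv₀), ?_⟩
    have hPs : ContDiffOn ℝ ∞ (P ε) J := by
      have s := fun i => contDiffOn_pi.1 hη i
      rw [contDiffOn_pi]
      intro i
      fin_cases i
      · exact (((s 2).mul (s 0)).sub (contDiffOn_const.mul (s 1))).div
          (((s 0).pow 2).add ((s 1).pow 2)) hR0
      · exact (((s 2).mul (s 1)).add (contDiffOn_const.mul (s 0))).div
          (((s 0).pow 2).add ((s 1).pow 2)) hR0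
      · exact contDiffOn_const
    have dP := fun v (hv : v ∈ J) => hasDerivAt_of_smoothOn hPs hJ hv
    have hz : ∀ v ∈ Ioo c d, deriv (P ε) v = 0 := by
      intro v hv
      have hvJ := hI hv
      have z2 : deriv (P ε) v 2 = 0 :=
        (hasDerivAt_coord (dP v hvJ) 2).unique (hasDerivAt_const v (1 : ℝ))
      have e1 : η v 0 * deriv (P ε) v 0 + η v 1 * deriv (P ε) v 1 = 0 := by
        have h1 := (hasDerivAt_lorentz (dη v hvJ) (dP v hvJ)).unique
          ((hasDerivAt_const v (0 : ℝ)).congr_of_eventuallyEq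
            (by filter_upwards [hJ.mem_nhds hvJ] with t ht using hPη ε t ht))
        rw [hort v hv, zero_add, lorentz, z2] at h1
        linarith
      have e2 : P ε v 0 * deriv (P ε) v 0 + P ε v 1 * deriv (P ε) v 1 = 0 := by
        have h1 := (((hasDerivAt_coord (dP v hvJ) 0).pow 2).add
          ((hasDerivAt_coord (dP v hvJ) 1).pow 2)).unique
          ((hasDerivAt_const v (1 : ℝ)).congr_of_eventuallyEq
            (by filter_upwards [hJ.mem_nhds hvJ] with t ht using hPn ε hε t ht))
        norm_num at h1
        linarith
      have hdet : η v 0 * P ε v 1 - η v 1 * P ε v 0 = ε := by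
        have h0 := hR0 v hvJ
        simp only [hP, Matrix.cons_val_zero, Matrix.cons_val_one]
        field_simp
        ring
      have hε0 : ε ≠ 0 := by rintro rfl; norm_num at hε
      funext i
      fin_cases i
      · refine (mul_eq_zero.1 (?_ : ε * deriv (P ε) v 0 = 0)).resolve_left hε0
        linear_combination P ε v 1 * e1 - η v 1 * e2 - deriv (P ε) v 0 * hdet
      · refine (mul_eq_zero.1 (?_ : ε * deriv (P ε) v 1 = 0)).resolve_left hε0
        linear_combination -P ε v 0 * e1 + η v 0 * e2 - deriv (P ε) v 1 * hdet
      · exact z2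
    filter_upwards [isOpen_Ioo.mem_nhds hcd] with v hv
    rw [← hPη ε v (hI hv)]
    congr 1
    exact isOpen_Ioo.is_const_of_deriv_eq_zero isPreconnected_Ioo
      (fun t ht => (dP t (hI ht)).differentiableAt.differentiableWithinAt) hz hcd hv
  -- Away from the closure of {η' ≠ 0} the normal is locally constant, and either null direction
  -- serves.
  by_cases hcl : v₀ ∈ closure (J ∩ deriv η ⁻¹' {0}ᶜ)
  swap
  · have hopen : IsOpen (J ∩ (closure (J ∩ deriv η ⁻¹' {0}ᶜ))ᶜ) :=
      hJ.inter isClosed_closure.isOpen_compl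
    obtain ⟨c, d, hcd, hI⟩ := exists_Ioo_subset hopen ⟨hv₀, hcl⟩
    refine finish 1 (by norm_num) c d hcd (fun v hv => (hI hv).1) (fun v hv => ?_)
    have : deriv η v = 0 := by
      by_contra h0
      exact (hI hv).2 (subset_closure ⟨(hI hv).1, h0⟩)
    rw [this]; simp [lorentz]
  by_cases hver : β v₀ 0 ^ 2 + β v₀ 1 ^ 2 = 0
  · have h00 : β v₀ 0 = 0 := by nlinarith [sq_nonneg (β v₀ 0), sq_nonneg (β v₀ 1)]
    have h01 : β v₀ 1 = 0 := by nlinarith [sq_nonneg (β v₀ 0), sq_nonneg (β v₀ 1)]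
    have h02 : β v₀ 2 ≠ 0 := fun h0 => hβ0 v₀ hv₀ (by
      funext i; fin_cases i <;> simp [h00, h01, h0])
    have hopen : IsOpen (J ∩ (fun v => lorentz (β v) (β v)) ⁻¹' {0}ᶜ) :=
      ((((hcβ 0).mul (hcβ 0)).add ((hcβ 1).mul (hcβ 1))).sub
        ((hcβ 2).mul (hcβ 2))).isOpen_inter_preimage hJ isOpen_compl_singleton
    obtain ⟨c, d, hcd, hI⟩ := exists_Ioo_subset hopen ⟨hv₀, by simp [lorentz, h00, h01, h02]⟩
    refine ⟨![0, 0, 1], rfl, Or.inl ⟨rfl, rfl⟩, ?_⟩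
    -- Near a vertical ruling no ruling is null, so η₂ = 0 wherever η moves. Hence η₂ is locally
    -- constant, and it is zero at v₀ by orthogonality to the vertical ruling.
    have hz : ∀ v ∈ Ioo c d, HasDerivAt (fun v => η v 2) 0 v := by
      intro v hv
      have d2 := hasDerivAt_coord (dη v (hI hv).1) 2
      by_cases h0 : deriv η v = 0
      · rw [h0] at d2; exact d2
      · have hnb : (J ∩ deriv η ⁻¹' {0}ᶜ) ∩ Ioo c d ∈ nhds v :=
          (hGo.inter isOpen_Ioo).mem_nhds ⟨⟨(hI hv).1, h0⟩, hv⟩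
        refine (hasDerivAt_const v (0 : ℝ)).congr_of_eventuallyEq ?_
        filter_upwards [hnb] with t ht
        exact (hG t ht.1.1 ht.1.2).resolve_left (hI ht.2).2
    obtain ⟨C, hC⟩ := exists_const_of_hasDerivAt_zero hz
    have hC0 : C = 0 := by
      rw [← hC v₀ hcd]
      have := horth v₀ hv₀
      rw [lorentz, h00, h01] at this
      have h3 : η v₀ 2 * β v₀ 2 = 0 := by linarith
      exact (mul_eq_zero.1 h3).resolve_right h02
    filter_upwards [isOpen_Ioo.mem_nhds hcd] with v hv
    simp [lorentz, hC v hv, hC0]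
  -- non-vertical limit: the rulings are null where `η` moves
  have hopen : IsOpen (J ∩ (fun v => β v 0 ^ 2 + β v 1 ^ 2) ⁻¹' {0}ᶜ) :=
    (((hcβ 0).pow 2).add ((hcβ 1).pow 2)).isOpen_inter_preimage hJ isOpen_compl_singleton
  -- Otherwise η would be horizontal nearby, and η' a horizontal vector orthogonal both to η and to
  -- the horizontal part of β. The latter is non-zero and orthogonal to η, so η' = 0.
  have hnull : ∀ v ∈ J, β v 0 ^ 2 + β v 1 ^ 2 ≠ 0 → deriv η v ≠ 0 → lorentz (β v) (β v) = 0 := by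
    intro v hv hb hd
    by_contra hE
    have hopen' : IsOpen (J ∩ (fun v => lorentz (β v) (β v)) ⁻¹' {0}ᶜ) :=
      ((((hcβ 0).mul (hcβ 0)).add ((hcβ 1).mul (hcβ 1))).sub
        ((hcβ 2).mul (hcβ 2))).isOpen_inter_preimage hJ isOpen_compl_singleton
    have hnb := (hGo.inter hopen').mem_nhds ⟨⟨hv, hd⟩, hv, hE⟩
    have z : deriv η v 2 = 0 := by
      refine (hasDerivAt_coord (dη v hv) 2).unique
        ((hasDerivAt_const v (0 : ℝ)).congr_of_eventuallyEq ?_)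
      filter_upwards [hnb] with t ht
      exact (hG t ht.1.1 ht.1.2).resolve_left ht.2.2
    have z2 : η v 2 = 0 := (hG v hv hd).resolve_left hE
    have e1 := horth v hv
    have e2 := horth' v hv
    have e3 := hunit' v hv
    rw [lorentz, z2] at e1
    rw [lorentz, z] at e2
    rw [lorentz, z] at e3
    have hdet : η v 0 * β v 1 - η v 1 * β v 0 ≠ 0 := by
      intro h0
      have : (η v 0 ^ 2 + η v 1 ^ 2) * (β v 0 ^ 2 + β v 1 ^ 2) = 0 := by
        linear_combination (η v 0 * β v 1 - η v 1 * β v 0) * h0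
          + (η v 0 * β v 0 + η v 1 * β v 1) * e1
      exact mul_ne_zero (hR0 v hv) hb this
    refine hd ?_
    funext i
    fin_cases i
    · refine (mul_eq_zero.1 (?_ : (η v 0 * β v 1 - η v 1 * β v 0) * deriv η v 0 = 0)).resolve_left
        hdet
      linear_combination β v 1 * e3 - η v 1 * e2
    · refine (mul_eq_zero.1 (?_ : (η v 0 * β v 1 - η v 1 * β v 0) * deriv η v 1 = 0)).resolve_left
        hdet
      linear_combination -β v 0 * e3 + η v 0 * e2
    · exact z
  have harea : ∀ v ∈ J, lorentz (β v) (β v) = 0 → area (η v) (β v) ^ 2 = β v 2 ^ 2 := by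
    intro v hv hE
    have e1 := horth v hv
    have e2 := hR v hv
    rw [lorentz] at e1 hE
    rw [area]
    linear_combination (η v 0 ^ 2 + η v 1 ^ 2) * hE
      - (η v 0 * β v 0 + η v 1 * β v 1 + η v 2 * β v 2) * e1 + β v 2 ^ 2 * e2
  have hE0 : lorentz (β v₀) (β v₀) = 0 := by
    by_contra hE
    have hopen' : IsOpen ((J ∩ (fun v => lorentz (β v) (β v)) ⁻¹' {0}ᶜ)
        ∩ (J ∩ (fun v => β v 0 ^ 2 + β v 1 ^ 2) ⁻¹' {0}ᶜ)) :=
      (((((hcβ 0).mul (hcβ 0)).add ((hcβ 1).mul (hcβ 1))).sub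
        ((hcβ 2).mul (hcβ 2))).isOpen_inter_preimage hJ isOpen_compl_singleton).inter hopen
    obtain ⟨w, hw, hwJ, hwd⟩ := mem_closure_iff.1 hcl _ hopen' ⟨⟨hv₀, hE⟩, hv₀, hver⟩
    exact hw.1.2 (hnull w hwJ hw.2.2 hwd)
  have hβ2 : β v₀ 2 ≠ 0 := by
    intro h0
    rw [lorentz, h0] at hE0
    exact hver (by linarith)
  have hsq := harea v₀ hv₀ hE0
  -- The sign telling which of the two null directions the ruling at v₀ has; by continuity it is the
  -- same for all null rulings nearby.
  set ε := area (η v₀) (β v₀) / β v₀ 2 with hε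
  have hε2 : ε ^ 2 = 1 := by rw [hε]; field_simp; exact hsq
  have hopen2 : IsOpen (J ∩ (fun v => ε * (area (η v) (β v) * β v 2)) ⁻¹' Ioi 0) := by
    refine ContinuousOn.isOpen_inter_preimage ?_ hJ isOpen_Ioi
    exact continuousOn_const.mul ((((hcη 0).mul (hcβ 1)).sub ((hcη 1).mul (hcβ 0))).mul (hcβ 2))
  obtain ⟨c, d, hcd, hI⟩ := exists_Ioo_subset (hopen.inter hopen2) ⟨⟨hv₀, hver⟩, hv₀, by
    change 0 < ε * (area (η v₀) (β v₀) * β v₀ 2)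
    have : area (η v₀) (β v₀) = ε * β v₀ 2 := by rw [hε]; field_simp
    rw [this]
    have h3 : ε * (ε * β v₀ 2 * β v₀ 2) = β v₀ 2 ^ 2 := by linear_combination β v₀ 2 ^ 2 * hε2
    rw [h3]; positivity⟩
  refine finish ε hε2 c d hcd (fun v hv => (hI hv).1.1) (fun v hv => ?_)
  obtain ⟨⟨hvJ, hb⟩, -, hpos⟩ := hI hv
  by_cases hd : deriv η v = 0
  · rw [hd]; simp [lorentz]
  have hE := hnull v hvJ hb hd
  have hsqv := harea v hvJ hE
  have hposv : 0 < ε * (area (η v) (β v) * β v 2) := hpos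
  have hb2 : β v 2 ≠ 0 := by rintro h0; rw [h0] at hposv; simp at hposv
  have har : area (η v) (β v) = ε * β v 2 := by
    have h1 : (area (η v) (β v) - ε * β v 2) * (area (η v) (β v) + ε * β v 2) = 0 := by
      linear_combination hsqv - β v 2 ^ 2 * hε2
    rcases mul_eq_zero.1 h1 with h2 | h2
    · linarith
    · have h3 : area (η v) (β v) = -(ε * β v 2) := by linarith
      rw [h3] at hposv
      have : 0 < β v 2 ^ 2 := by positivity
      nlinarith
  -- Where η moves, the ruling is the null direction P ε itself, so ⟨η', β⟩ = 0 becomes the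
  -- condition of `finish`.
  have hbP : β v = β v 2 • P ε v := by
    have e1 := horth v hvJ
    have h0 := hR0 v hvJ
    rw [lorentz] at e1
    rw [area] at har
    funext i
    fin_cases i
    · simp only [hP, Pi.smul_apply, smul_eq_mul, Fin.zero_eta, Matrix.cons_val_zero]
      field_simp
      linear_combination η v 0 * e1 - η v 1 * har
    · change β v 1 = β v 2 * ((η v 2 * η v 1 + ε * η v 0) / (η v 0 ^ 2 + η v 1 ^ 2))
      field_simp
      linear_combination η v 1 * e1 + η v 0 * har
    · simp [hP]
  have h4 := horth' v hvJ
  rw [hbP, lorentz_comm, lorentz_smul_left, lorentz_comm] at h4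
  exact (mul_eq_zero.1 h4).resolve_left hb2

section

/-- Vector form of `tangent_decomposition`, obtained by pairing with the dual basis; the sign in
![0, 0, -1] comes from the signature. -/
lemma smul_eq_tangent_combination {X Y n Z : Vec3} (hn : lorentz n n = 1) (hX : lorentz n X = 0)
    (hY : lorentz n Y = 0) (hZ : lorentz n Z = 0) (hg : gram X Y ≠ 0) :
    gram X Y • Z = (lorentz Y Y * lorentz Z X - lorentz X Y * lorentz Z Y) • X
      + (lorentz X X * lorentz Z Y - lorentz X Y * lorentz Z X) • Y := by
  have h0 := tangent_decomposition hn hX hY hZ hg ![1, 0, 0]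
  have h1 := tangent_decomposition hn hX hY hZ hg ![0, 1, 0]
  have h2 := tangent_decomposition hn hX hY hZ hg ![0, 0, -1]
  have c0 : ∀ W : Vec3, lorentz W ![1, 0, 0] = W 0 := fun W => by simp [lorentz]
  have c1 : ∀ W : Vec3, lorentz W ![0, 1, 0] = W 1 := fun W => by simp [lorentz]
  have c2 : ∀ W : Vec3, lorentz W ![0, 0, -1] = W 2 := fun W => by simp [lorentz]
  simp only [c0] at h0
  simp only [c1] at h1
  simp only [c2] at h2
  funext i
  fin_cases i
  · exact h0
  · exact h1
  · exact h2

variable {D : Set (ℝ × ℝ)} {x N : ℝ × ℝ → Vec3} {α β : ℝ → Vec3}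

/-- A conformal ruled surface is a listed one near a ruling around which all rulings have a
constant tangent plane. -/
theorem isLocallyListedAt_of_twist_eq_zero (hx : IsTimelikeSurface D x) (hN : IsUnitNormal D x N)
    (h : RuledData (Prod.snd '' D) α β) (hr : ∀ q ∈ D, x q = α q.2 + q.1 • β q.2)
    {q₀ : ℝ × ℝ} (hq₀ : q₀ ∈ D)
    (hcl : q₀.2 ∉ closure {v ∈ Prod.snd '' D | twist α β v ≠ 0}) : IsLocallyListedAt D x q₀ := by
  have hα := h.smooth_base
  have hβ := h.smooth_dir
  obtain ⟨u₀, v₀⟩ := q₀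
  -- The tangent plane is constant along each untwisted ruling, so it suffices to follow the normal
  -- on the slice u = u₀.
  set J : Set ℝ := (fun v => (u₀, v)) ⁻¹' D ∩ (closure {v ∈ Prod.snd '' D | twist α β v ≠ 0})ᶜ
    with hJdef
  have hJ : IsOpen J :=
    (hx.1.preimage (Continuous.prodMk_right u₀)).inter isClosed_closure.isOpen_compl
  have hv₀ : v₀ ∈ J := ⟨hq₀, hcl⟩
  have hJD : J ⊆ Prod.snd '' D := fun v hv => ⟨(u₀, v), hv.1, rfl⟩
  have htw : ∀ v ∈ J, det3 (deriv β v) (β v) (deriv α v) = 0 := fun v hv => by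
    by_contra h0
    exact hv.2 (subset_closure ⟨hJD hv, h0⟩)
  set η : ℝ → Vec3 := fun v => normalGaussMap x N (u₀, v) with hηdef
  have hη : ContDiffOn ℝ ∞ η J := (smooth_normalGaussMap hx hN).comp
    (contDiff_prodMk_right u₀).contDiffOn (fun v hv => hv.1)
  set w : ℝ → Vec3 := fun v => deriv α v + u₀ • deriv β v with hw
  have hunit : ∀ v ∈ J, lorentz (η v) (η v) = 1 := fun v hv =>
    (normalGaussMap_unit_normal hx hN hv.1).1
  have hfd : ∀ q ∈ D, ∀ ξ, fderiv ℝ x q ξ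
      = ξ.1 • β q.2 + ξ.2 • (deriv α q.2 + q.1 • deriv β q.2) := fun q hq ξ =>
    fderiv_ruled hx.1 hα hβ hr hq ξ
  have horth : ∀ v ∈ J, lorentz (η v) (β v) = 0 := fun v hv => by
    have := (normalGaussMap_unit_normal hx hN hv.1).2 (1, 0)
    rw [hfd _ hv.1] at this
    simpa using this
  have hηw : ∀ v ∈ J, lorentz (η v) (w v) = 0 := fun v hv => by
    have := (normalGaussMap_unit_normal hx hN hv.1).2 (0, 1)
    rw [hfd _ hv.1] at this
    simpa using this
  have hg : ∀ v ∈ J, gram (β v) (w v) ≠ 0 := fun v hv =>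
    (gram_ruled_neg hx hα hβ hr hv.1).ne
  have dα := fun v (hv : v ∈ J) => hasDerivAt_of_smoothOn hα h.isOpen (hJD hv)
  have dβ := fun v (hv : v ∈ J) => hasDerivAt_of_smoothOn hβ h.isOpen (hJD hv)
  have dα' := fun v (hv : v ∈ J) =>
    hasDerivAt_of_smoothOn (smoothOn_deriv hα h.isOpen) h.isOpen (hJD hv)
  have dβ' := fun v (hv : v ∈ J) =>
    hasDerivAt_of_smoothOn (smoothOn_deriv hβ h.isOpen) h.isOpen (hJD hv)
  have dη := fun v (hv : v ∈ J) => hasDerivAt_of_smoothOn hη hJ hv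
  have dw := fun v (hv : v ∈ J) => (dα' v hv).add ((dβ' v hv).const_smul u₀)
  have hηβ' : ∀ v ∈ J, lorentz (η v) (deriv β v) = 0 := fun v hv => by
    obtain ⟨κ, -, -, hκ⟩ := exists_normal_factor (hunit v hv) (horth v hv) (hηw v hv) (hg v hv)
    rw [lorentz_comm, hκ]
    have e : det3 (deriv β v) (β v) (w v) = det3 (deriv β v) (β v) (deriv α v) := by
      simp only [hw, det3, Pi.add_apply, Pi.smul_apply, smul_eq_mul]; ring
    rw [e, htw v hv, mul_zero]
  have deriv_eq_zero : ∀ (f g : ℝ → Vec3) (f' g' : Vec3) (c v : ℝ), v ∈ J →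
      HasDerivAt f f' v → HasDerivAt g g' v → (∀ t ∈ J, lorentz (f t) (g t) = c) →
      lorentz f' (g v) + lorentz (f v) g' = 0 := by
    intro f g f' g' c v hv hf hg' hc
    exact (hasDerivAt_lorentz hf hg').unique ((hasDerivAt_const v c).congr_of_eventuallyEq
      (by filter_upwards [hJ.mem_nhds hv] with t ht using hc t ht))
  have horth' : ∀ v ∈ J, lorentz (deriv η v) (β v) = 0 := fun v hv => by
    have := deriv_eq_zero η β _ _ 0 v hv (dη v hv) (dβ v hv) horth
    rw [hηβ' v hv] at this
    linarith
  have hβ0 : ∀ v ∈ J, β v ≠ 0 := fun v hv h0 => hg v hv (by rw [h0]; simp [gram, lorentz])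
  -- Without twist the equation is a product: area · ⟨β, β⟩ · det(β, w, w') = 0. If the first two
  -- factors are non-zero, then w' is tangent, so η' is orthogonal to w as well as to β and η, and
  -- vanishes.
  have hG : ∀ v ∈ J, deriv η v ≠ 0 → lorentz (β v) (β v) = 0 ∨ η v 2 = 0 := by
    intro v hv hd
    by_contra! hne
    obtain ⟨hE, h2⟩ := hne
    obtain ⟨κ, hκ0, hκ2, hκ⟩ :=
      exists_normal_factor (hunit v hv) (horth v hv) (hηw v hv) (hg v hv)
    have harea : area (β v) (w v) ≠ 0 := fun h0 => h2 (by rw [hκ2, h0, mul_zero])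
    have hdef := h.eq_zero v (hJD hv) u₀
    rw [defect, htw v hv] at hdef
    have hdet : det3 (β v) (w v) (deriv (deriv α) v + u₀ • deriv (deriv β) v) = 0 := by
      have h3 : area (β v) (w v) * (lorentz (β v) (β v) *
          det3 (β v) (w v) (deriv (deriv α) v + u₀ • deriv (deriv β) v)) = 0 := by
        linear_combination hdef
      exact (mul_eq_zero.1 ((mul_eq_zero.1 h3).resolve_left harea)).resolve_left hE
    have h4 : lorentz (η v) (deriv (deriv α) v + u₀ • deriv (deriv β) v) = 0 := by
      rw [lorentz_comm, hκ]
      have e : ∀ a b c : Vec3, det3 a b c = det3 b c a := fun a b c => by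
        simp only [det3]; ring
      rw [e, hdet, mul_zero]
    have h5 := deriv_eq_zero η w _ _ 0 v hv (dη v hv) (dw v hv) hηw
    rw [h4, add_zero] at h5
    have h6 := deriv_eq_zero η η _ _ 1 v hv (dη v hv) (dη v hv) hunit
    rw [lorentz_comm (deriv η v)] at h6
    have h7 := smul_eq_tangent_combination (hunit v hv) (horth v hv) (hηw v hv)
      (by linarith : lorentz (η v) (deriv η v) = 0) (hg v hv)
    rw [h5, horth' v hv] at h7
    simp only [mul_zero, sub_zero, zero_smul, add_zero] at h7
    exact hd ((smul_eq_zero.1 h7).resolve_left (hg v hv))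
  obtain ⟨p, hp2, hp, hev⟩ := exists_common_direction hJ hη (hβ.mono hJD) hunit horth horth' hβ0 hG
    hv₀
  refine isLocallyListedAt_of_tangent hx hp2 hp hq₀ ?_
  have hsnd : Filter.Tendsto Prod.snd (nhds ((u₀, v₀) : ℝ × ℝ)) (nhds v₀) :=
    continuous_snd.continuousAt
  filter_upwards [hx.1.mem_nhds hq₀, hsnd (hJ.mem_nhds hv₀), hsnd hev] with q hq hqJ hqp
  have hqJ : q.2 ∈ J := hqJ
  have hqp : lorentz (η q.2) p = 0 := hqp
  have hgq := (gram_ruled_neg hx hα hβ hr hq).ne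
  -- The normal on the slice remains normal at the other points of the ruling, since it is
  -- orthogonal to β'.
  have hort : lorentz (η q.2) (deriv α q.2 + q.1 • deriv β q.2) = 0 := by
    have e1 := hηw _ hqJ
    have e2 := hηβ' _ hqJ
    simp only [hw, lorentz_comm (η q.2), lorentz_add_left, lorentz_smul_left] at e1 e2 ⊢
    rw [e2] at e1 ⊢
    linarith
  have key := smul_eq_tangent_combination (hunit _ hqJ) (horth _ hqJ) hort hqp hgq
  set g := gram (β q.2) (deriv α q.2 + q.1 • deriv β q.2)
  have split : ∀ (a b : ℝ) (X Y : Vec3), g • p = a • X + b • Y →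
      p = (g⁻¹ * a) • X + (g⁻¹ * b) • Y := fun a b X Y hab => by
    rw [mul_smul, mul_smul, ← smul_add, ← hab, smul_smul, inv_mul_cancel₀ hgq, one_smul]
  exact ⟨(_, _), (hfd q hq _).trans (split _ _ _ _ key).symm⟩

end

end DeSitter

end

theorem theorem7p4 (D : Set (ℝ × ℝ)) (x N : ℝ × ℝ → DeSitter.Vec3)
    (hx : DeSitter.IsTimelikeSurface D x) (hr : DeSitter.IsRuled D x)
    (hN : DeSitter.IsUnitNormal D x N)
    (hc : DeSitter.HasConformalNormalGaussMap D x N)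
    (hu : DeSitter.UmbilicPiecesPlanar D x N) :
    ∀ q ∈ D, DeSitter.IsLocallyListedAt D x q := by
  intro q hq
  obtain ⟨α, β, hα, hβ, hr⟩ := hr
  have h := DeSitter.ruledData_of_conformal hx hN hc hu hα hβ hr
  -- Splitting along the closure leaves no boundary case: off the closure the twist vanishes on a
  -- whole neighbourhood.
  by_cases hcl : q.2 ∈ closure {v ∈ Prod.snd '' D | DeSitter.twist α β v ≠ 0}
  · exact DeSitter.isLocallyListedAt_of_mem_closure hx.1 hr h hq ⟨q, hq, rfl⟩ hcl
  · exact DeSitter.isLocallyListedAt_of_twist_eq_zero hx hN h hr hq hcl
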